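/- **Theorem 6.5.** All spaces are over $\mathbb R$ and $\mathbb N=\{1,2,3,\dots\}$. For a Banach space $E$ let $W(E)$ be the set of weakly compact bounded linear operators $E\to E$. The space $E$ has the *weakly compact approximation property (W.A.P.) with constant $C$* if for every weakly compact set $D\subset E$ and every $\varepsilon>0$ there is $V\in W(E)$ with $\sup_{x\in D}\|x-Vx\|<\varepsilon$ and $\|V\|\le C$; it has the *W.A.P.* if it has the W.A.P. with some constant $C<\infty$. Let $\mathcal T=\bigcup_{n=0}^\infty\{0,1\}^n$ be the infinite binary tree, ordered by initial segments. A *segment* is a set $S=\{\gamma\in\mathcal T:\alpha\le\gamma\le\beta\}$ with $\alpha\le\beta$ in $\mathcal T$, and $S^*(x)=\sum_{\gamma\in S}x(\gamma)$ for $x:\mathcal T\to\mathbb R$. James' tree space $JT$ is the space of all $x:\mathcal T\to\mathbb R$ with $$\|x\|=\sup\Big(\sum_{j=1}^k S_j^*(x)^2\Big)^{1/2}<\infty,$$ the supremum being over all $k\in\mathbb N$ and all pairwise disjoint segments $S_1,\dots,S_k$. For $\alpha\in\mathcal T$ let $f_\alpha\in JT$ be the function that is $1$ at $\alpha$ and $0$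 elsewhere. For $n\in\mathbb N$ let $\mathcal T_n$ be the set of all $\alpha\in\mathcal T$ with at most $n$ entries equal to $1$ ("right turns"), and let $X_n=[f_\alpha:\alpha\in\mathcal T_n]$ be the closed linear span in $JT$. Then: (i) For every $n\in\mathbb N$, $X_n$ has the W.A.P. with constant $3\sqrt n$. (ii) There is a constant $C>0$ such that for every $n\in\mathbb N$ there is a weakly compact set $D_n\subset X_n$ with the following property: if $V\in W(X_n)$ and $\sup_{x\in D_n}\|x-Vx\|<\frac1{10}$, then $\|V\|\ge C\sqrt n$. (iii) $JT$ does not have the W.A.P. (iv) Let $Y=\ell^2(X_n)$ be the $\ell^2$-direct sum of the spaces $X_n$, $n\in\mathbb N$. Then $Y^{**}/Y$ (with the quotient norm, $Y$ being identified with its canonical image in $Y^{**}$) is linearly isometric to $\ell^2=\ell^2(\mathbb N)$, and $Y$ does not have the W.A.P. -/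

import Mathlib

set_option maxSynthPendingDepth 3

/-! ### The weakly compact approximation property -/

section WeaklyCompact

variable {E : Type*} [NormedAddCommGroup E] [NormedSpace ℝ E]

/-- `D` is compact in the weak topology `σ(E, E*)`. -/
def IsWeaklyCompact (D : Set E) : Prop :=
  IsCompact (toWeakSpace ℝ E '' D)

/-- `V` is a weakly compact operator (`V ∈ W(E)`): the image of the closed unit ball is relatively
compact in the weak topology. -/
def IsWeaklyCompactOperator (V : E →L[ℝ] E) : Prop :=
  IsCompact (closure (toWeakSpace ℝ E '' (V '' Metric.closedBall (0 : E) 1)))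

/-- `sup_{x ∈ D} ‖x - V x‖ < ε`. The bound is strict for the supremum (not just pointwise). -/
def ApproximatesIdOn (V : E →L[ℝ] E) (D : Set E) (ε : ℝ) : Prop :=
  ∃ r < ε, ∀ x ∈ D, ‖x - V x‖ ≤ r

variable (E)

/-- `E` has the weakly compact approximation property with constant `C`. -/
def HasWAPWith (C : ℝ) : Prop :=
  ∀ D : Set E, IsWeaklyCompact D → ∀ ε : ℝ, 0 < ε →
    ∃ V : E →L[ℝ] E, IsWeaklyCompactOperator V ∧ ApproximatesIdOn V D ε ∧ ‖V‖ ≤ C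

/-- `E` has the weakly compact approximation property (W.A.P.). -/
def HasWAP : Prop :=
  ∃ C : ℝ, HasWAPWith E C

/-- The quotient `E** / E`, with the quotient norm, where `E` is identified with its canonical
image in `E**`. -/
abbrev BidualQuotient : Type _ :=
  StrongDual ℝ (StrongDual ℝ E) ⧸
    LinearMap.range (NormedSpace.inclusionInDoubleDual ℝ E).toLinearMap

end WeaklyCompact

/-! ### James' tree space -/

namespace JamesTree

/-- Nodes of the infinite binary tree `⋃ₙ {0,1}ⁿ`: finite words, the root being the empty word,
`false` standing for `0` (left) and `true` for `1` (right). The tree order is the prefix order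
`<+:` on words. -/
abbrev Node : Type := List Bool

/-- `S` is a segment `{γ : α ≤ γ ≤ β}` with `α ≤ β`. -/
def IsSegment (S : Finset Node) : Prop :=
  ∃ α β : Node, α <+: β ∧ ∀ γ : Node, γ ∈ S ↔ α <+: γ ∧ γ <+: β

/-- Finite families of pairwise disjoint segments. (Segments are non-empty, so disjoint ones are
distinct, and nothing is lost by considering sets of segments.) -/
def IsDisjointFamily (F : Finset (Finset Node)) : Prop :=
  (∀ S ∈ F, IsSegment S) ∧ ∀ S ∈ F, ∀ T ∈ F, S ≠ T → Disjoint S T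

/-- `(∑_{S ∈ F} S*(x)²)^{1/2}`, where `S*(x) = ∑_{γ ∈ S} x_γ`. -/
noncomputable def famNorm (F : Finset (Finset Node)) (x : Node → ℝ) : ℝ :=
  √(∑ S ∈ F, (∑ γ ∈ S, x γ) ^ 2)

lemma famNorm_add_le (F : Finset (Finset Node)) (x y : Node → ℝ) :
    famNorm F (x + y) ≤ famNorm F x + famNorm F y := by
  have key : ∀ z : Node → ℝ, famNorm F z =
      ‖(WithLp.toLp 2 (fun S : F => ∑ γ ∈ S.1, z γ) : EuclideanSpace ℝ F)‖ := by
    intro z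
    rw [EuclideanSpace.norm_eq, famNorm, ← Finset.sum_coe_sort]
    simp
  rw [key, key, key]
  refine le_trans (le_of_eq ?_) (norm_add_le _ _)
  congr 1
  ext S
  simp [Finset.sum_add_distrib]

lemma famNorm_smul (F : Finset (Finset Node)) (c : ℝ) (x : Node → ℝ) :
    famNorm F (c • x) = |c| * famNorm F x := by
  have h : ∑ S ∈ F, (∑ γ ∈ S, (c • x) γ) ^ 2 = c ^ 2 * ∑ S ∈ F, (∑ γ ∈ S, x γ) ^ 2 := by
    rw [Finset.mul_sum]
    refine Finset.sum_congr rfl fun S _ => ?_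
    rw [← mul_pow, Finset.mul_sum]
    rfl
  rw [famNorm, h, Real.sqrt_mul (sq_nonneg c), Real.sqrt_sq_eq_abs, famNorm]

lemma famNorm_nonneg (F : Finset (Finset Node)) (x : Node → ℝ) : 0 ≤ famNorm F x :=
  Real.sqrt_nonneg _

/-- The vector space of all functions `x` on the tree with
`sup_F (∑_{S ∈ F} S*(x)²)^{1/2} < ∞`. -/
def jtSubmodule : Submodule ℝ (Node → ℝ) where
  carrier := {x | ∃ M : ℝ, ∀ F, IsDisjointFamily F → famNorm F x ≤ M}
  zero_mem' := ⟨0, fun F _ => by simp [famNorm]⟩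
  add_mem' := by
    rintro x y ⟨M, hM⟩ ⟨N, hN⟩
    exact ⟨M + N, fun F hF => (famNorm_add_le F x y).trans (add_le_add (hM F hF) (hN F hF))⟩
  smul_mem' := by
    rintro c x ⟨M, hM⟩
    refine ⟨|c| * M, fun F hF => ?_⟩
    rw [famNorm_smul]
    exact mul_le_mul_of_nonneg_left (hM F hF) (abs_nonneg c)

/-- James' tree space, as a vector space. (A type of its own, so that it carries only the norm
topology below and not the topology of pointwise convergence.) -/
def JT : Type := jtSubmodule

namespace JT

noncomputable instance : AddCommGroup JT := inferInstanceAs (AddCommGroup jtSubmodule)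

noncomputable instance : Module ℝ JT := inferInstanceAs (Module ℝ jtSubmodule)

/-- The function on the tree underlying an element of `JT`. -/
def toFun (x : JT) : Node → ℝ := x.1

/-- The norm of `JT`: `sup (∑_{S ∈ F} S*(x)²)^{1/2}` over finite families `F` of pairwise disjoint
segments. -/
noncomputable instance : Norm JT where
  norm x := ⨆ F : {F : Finset (Finset Node) // IsDisjointFamily F}, famNorm F.1 x.toFun

lemma norm_def (x : JT) :
    ‖x‖ = ⨆ F : {F : Finset (Finset Node) // IsDisjointFamily F}, famNorm F.1 x.toFun := rfl

instance : Nonempty {F : Finset (Finset Node) // IsDisjointFamily F} :=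
  ⟨∅, by simp [IsDisjointFamily]⟩

lemma famNorm_le_norm (x : JT) {F : Finset (Finset Node)} (hF : IsDisjointFamily F) :
    famNorm F x.toFun ≤ ‖x‖ := by
  obtain ⟨M, hM⟩ := x.2
  exact le_ciSup (f := fun F : {F : Finset (Finset Node) // IsDisjointFamily F} =>
    famNorm F.1 x.toFun) ⟨M, by rintro _ ⟨G, rfl⟩; exact hM G.1 G.2⟩ ⟨F, hF⟩

lemma norm_le {x : JT} {M : ℝ} (h : ∀ F, IsDisjointFamily F → famNorm F x.toFun ≤ M) :
    ‖x‖ ≤ M :=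
  ciSup_le fun F => h F.1 F.2

lemma isDisjointFamily_singleton (α : Node) : IsDisjointFamily {{α}} := by
  refine ⟨fun S hS => ⟨α, α, List.prefix_rfl, fun γ => ?_⟩, fun S hS T hT h => ?_⟩
  · rw [Finset.mem_singleton.1 hS, Finset.mem_singleton]
    constructor
    · rintro rfl
      exact ⟨List.prefix_rfl, List.prefix_rfl⟩
    · rintro ⟨h1, h2⟩
      exact h2.eq_of_length_le h1.length_le
  · exact absurd ((Finset.mem_singleton.1 hS).trans (Finset.mem_singleton.1 hT).symm) h

lemma abs_apply_le_norm (x : JT) (α : Node) : |x.toFun α| ≤ ‖x‖ := by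
  have := famNorm_le_norm x (isDisjointFamily_singleton α)
  simpa [famNorm, Real.sqrt_sq_eq_abs] using this

lemma core : NormedSpace.Core ℝ JT where
  norm_nonneg x := (abs_nonneg _).trans (abs_apply_le_norm x [])
  norm_smul c x := by
    rw [norm_def, norm_def, Real.norm_eq_abs, Real.mul_iSup_of_nonneg (abs_nonneg c)]
    exact iSup_congr fun F => famNorm_smul F.1 c x.toFun
  norm_triangle x y :=
    norm_le fun F hF => (famNorm_add_le F x.toFun y.toFun).trans
      (add_le_add (famNorm_le_norm x hF) (famNorm_le_norm y hF))
  norm_eq_zero_iff x := by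
    constructor
    · intro h
      refine Subtype.ext (funext fun α => ?_)
      have := abs_apply_le_norm x α
      rw [h] at this
      exact abs_nonpos_iff.1 this
    · rintro rfl
      refine le_antisymm (norm_le fun F _ => ?_) ((abs_nonneg _).trans (abs_apply_le_norm 0 []))
      have h0 : (0 : JT).toFun = 0 := rfl
      simp [h0, famNorm]

noncomputable instance : NormedAddCommGroup JT := NormedAddCommGroup.ofCore core

noncomputable instance : NormedSpace ℝ JT := NormedSpace.ofCore core

end JT

lemma single_mem (α : Node) : (Pi.single α 1 : Node → ℝ) ∈ jtSubmodule := by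
  refine ⟨1, fun F hF => ?_⟩
  rw [famNorm, Real.sqrt_le_left zero_le_one, one_pow]
  have h : ∀ S : Finset Node,
      (∑ γ ∈ S, (Pi.single α 1 : Node → ℝ) γ) ^ 2 = if α ∈ S then 1 else 0 := by
    intro S
    rw [Finset.sum_pi_single']
    split_ifs <;> simp
  simp only [h]
  rw [Finset.sum_ite, Finset.sum_const_zero, add_zero, Finset.sum_const, nsmul_eq_mul, mul_one]
  have hc : (F.filter fun S => α ∈ S).card ≤ 1 := by
    refine Finset.card_le_one.2 fun S hS T hT => ?_
    rw [Finset.mem_filter] at hS hT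
    by_contra hne
    exact Finset.disjoint_left.1 (hF.2 S hS.1 T hT.1 hne) hS.2 hT.2
  exact_mod_cast hc

/-- The node vector `f_α ∈ JT`: the function equal to `1` at `α` and `0` elsewhere. -/
noncomputable def nodeVec (α : Node) : JT := ⟨Pi.single α 1, single_mem α⟩

/-- The number of right turns in `α`, i.e. of entries equal to `1`. -/
def rightTurns (α : Node) : ℕ := α.count true

/-- `X_n = [f_α : α has at most n right turns]`, the closed linear span in `JT`. -/
noncomputable def X (n : ℕ) : Submodule ℝ JT :=
  (Submodule.span ℝ (nodeVec '' {α | rightTurns α ≤ n})).topologicalClosure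

/-- `Y = ℓ²(X_n)`, the `ℓ²`-direct sum of `X_1, X_2, X_3, …` (the `n`-th summand, counted from
`n = 0`, is `X_{n+1}`). -/
abbrev Y : Type := lp (fun n : ℕ => X (n + 1)) 2

end JamesTree

/-! The tree splits into chains β, β0, β00, …, one for each β that is the root or ends in a right
turn. Restrictions to disjoint order-convex sets satisfy a lower 2-estimate with constant 1
(`JT.sum_norm_restr_sq_le`). A segment meets at most n + 1 chains inside T_n
(`card_image_start_le`), so by Cauchy–Schwarz the chains satisfy an upper 2-estimate with constant n
+ 1 for the squared norms (`norm_sq_le_sum_chains`). Thus X_n is, up to a factor √(n + 1), the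
ℓ²-sum of its chains, and each chain carries a James-type space.

On one chain, successive blocks of sum zero satisfy an upper 2-estimate, because a segment cuts at
most two of them. Hence a functional is small on far out vectors of sum zero, and the coordinates
together with the sums along whole chains span a dense subspace of the dual
(`closure_span_basicFunctionalsX`). The unit ball of X_n is compact for pointwise convergence on the
tree, so an operator is weakly compact once the coordinates and chain sums of its values are
pointwise continuous on the ball (`isWeaklyCompactOperator_X`).

(i) The tails of the chain sums tend to 0 pointwise and have bounded quadratic variation, so
suitable averages of them are uniformly small on a given weakly compact set
(`IsWeaklyCompact.exists_average_le`). Replacing the partial sums along each chain by averages over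
successive sets of positions gives an operator that is small on that set; the identity minus it is
weakly compact, because its chain sums telescope to finite averages.

(ii) The starts f_β of the chains form, with 0, a weakly compact set. If V is weakly compact and
almost fixes them, then on each chain some simple vector is sent to one with large sum along every
path leaving the chain at a suitable position (`exists_test_vector`). Following n such exits gives n
vectors whose sum has norm O(√n), since a segment sees at most two of them, while its image has a
path sum of order n (`exists_test_sum`).

(iii) and the last claim of (iv) follow because the X_n are 1-complemented in JT and occur as
1-complemented summands of Y.

(iv) A bidual functional is determined by its values on coordinates and chain sums. The coordinate
values always come from an element of Y; what remains is one mass for each chain. Far out nodes of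
different chains are incomparable, hence satisfy an upper 2-estimate with constant 1, and tails of
chain sums give the matching lower bound: the masses form exactly ℓ², with its own norm. -/

namespace JamesTree

/-! ### Combinatorics of the tree -/

/-- The node reached from `β` by `k` left turns. -/
def leftExt (β : Node) (k : ℕ) : Node := β ++ List.replicate k false

@[simp] lemma leftExt_zero (β : Node) : leftExt β 0 = β := by simp [leftExt]

lemma leftExt_leftExt (β : Node) (j k : ℕ) : leftExt (leftExt β j) k = leftExt β (j + k) := by
  simp [leftExt]

@[simp] lemma length_leftExt (β : Node) (k : ℕ) : (leftExt β k).length = β.length + k := by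
  simp [leftExt]

lemma leftExt_injective (β : Node) : Function.Injective (leftExt β) := by
  intro j k h
  simpa using congrArg List.length h

lemma prefix_leftExt (β : Node) (k : ℕ) : β <+: leftExt β k := List.prefix_append _ _

lemma leftExt_prefix_leftExt {β : Node} {j k : ℕ} :
    leftExt β j <+: leftExt β k ↔ j ≤ k := by
  constructor
  · intro h
    simpa using h.length_le
  · intro h
    obtain ⟨i, rfl⟩ := Nat.exists_eq_add_of_le h
    rw [← leftExt_leftExt]
    exact prefix_leftExt _ _

lemma exists_eq_leftExt {β γ : Node} {k : ℕ} (h : β <+: γ) (h' : γ <+: leftExt β k) :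
    ∃ i ≤ k, γ = leftExt β i := by
  obtain ⟨t, rfl⟩ := h
  rw [leftExt, List.prefix_append_right_inj] at h'
  have ht : t = List.replicate t.length false :=
    List.eq_replicate_of_mem fun b hb => (List.mem_replicate.1 (h'.subset hb)).2
  refine ⟨t.length, ?_, ?_⟩
  · simpa using h'.length_le
  · rw [leftExt, ← ht]

lemma prefix_total {a b c : Node} (ha : a <+: c) (hb : b <+: c) : a <+: b ∨ b <+: a :=
  List.prefix_or_prefix_of_prefix ha hb

/-- The node from which `α` is reached by its final run of left turns. -/
def start (α : Node) : Node := List.rdropWhile (fun b => !b) α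

/-- The length of the final run of left turns of `α`. -/
def trail (α : Node) : ℕ := α.length - (start α).length

lemma start_prefix (α : Node) : start α <+: α := List.rdropWhile_prefix _ _

lemma start_concat_true (α : Node) : start (α ++ [true]) = α ++ [true] := by
  simp [start]

lemma start_concat_false (α : Node) : start (α ++ [false]) = start α := by
  simp [start]

@[simp] lemma start_leftExt (β : Node) (k : ℕ) : start (leftExt β k) = start β := by
  induction k with
  | zero => simp
  | succ k ih =>
    rw [← leftExt_leftExt, show leftExt (leftExt β k) 1 = leftExt β k ++ [false] from rfl,
      start_concat_false, ih]

@[simp] lemma start_start (α : Node) : start (start α) = start α :=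
  List.rdropWhile_idempotent _ _

lemma leftExt_start_trail (α : Node) : leftExt (start α) (trail α) = α := by
  induction α using List.reverseRecOn with
  | nil => rfl
  | append_singleton α b ih =>
    cases b with
    | true => simp [trail, start_concat_true]
    | false =>
      have h : trail (α ++ [false]) = trail α + 1 := by
        have := (start_prefix α).length_le
        simp only [trail, start_concat_false, List.length_append, List.length_singleton]
        omega
      rw [start_concat_false, h, ← leftExt_leftExt, ih]
      rfl

lemma trail_leftExt {β : Node} (hβ : start β = β) (k : ℕ) : trail (leftExt β k) = k := by
  simp [trail, hβ]

@[simp] lemma rightTurns_leftExt (β : Node) (k : ℕ) : rightTurns (leftExt β k) = rightTurns β := by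
  simp [rightTurns, leftExt, List.count_append, List.count_replicate]

@[simp] lemma rightTurns_start (α : Node) : rightTurns (start α) = rightTurns α := by
  conv_rhs => rw [← leftExt_start_trail α, rightTurns_leftExt]

lemma rightTurns_concat_true (α : Node) : rightTurns (α ++ [true]) = rightTurns α + 1 := by
  simp [rightTurns, List.count_append]

lemma rightTurns_mono {a b : Node} (h : a <+: b) : rightTurns a ≤ rightTurns b :=
  h.sublist.count_le _

lemma eq_leftExt_of_prefix {a b : Node} (h : a <+: b) (hr : rightTurns b ≤ rightTurns a) :
    ∃ k, b = leftExt a k := by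
  obtain ⟨t, rfl⟩ := h
  have h0 : t.count true = 0 := by
    have : rightTurns (a ++ t) = rightTurns a + t.count true := by
      simp [rightTurns, List.count_append]
    omega
  refine ⟨t.length, ?_⟩
  have ht : t = List.replicate t.length false :=
    List.eq_replicate_of_mem fun b hb => by
      cases b with
      | false => rfl
      | true => exact absurd hb (List.count_eq_zero.1 h0)
  rw [leftExt, ← ht]

lemma start_eq_of_prefix {a b : Node} (h : a <+: b) (hr : rightTurns b ≤ rightTurns a) :
    start b = start a := by
  obtain ⟨k, rfl⟩ := eq_leftExt_of_prefix h hr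
  simp

/-- Far out, different chains are incomparable. -/
lemma not_leftExt_prefix {β β' : Node} (hβ : start β = β) (hβ' : start β' = β') (h : β ≠ β')
    {k : ℕ} (hk : β'.length ≤ k) : ¬ leftExt β k <+: leftExt β' k := by
  intro hp
  have h1 : β <+: leftExt β' k := (prefix_leftExt β k).trans hp
  have hl := hp.length_le
  simp only [length_leftExt] at hl
  have h2 : β <+: β' := List.prefix_of_prefix_length_le h1 (prefix_leftExt β' k) (by omega)
  -- As k is at least the length of β', the node β' is also a prefix of β0ᵏ, hence lies on the chain
  -- of β.
  have h3 : β' <+: leftExt β k :=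
    List.prefix_of_prefix_length_le (prefix_leftExt β' k) hp (by simp; omega)
  obtain ⟨i, -, hi⟩ := exists_eq_leftExt h2 h3
  apply h
  rw [← hβ, ← hβ', hi, start_leftExt]

/-! ### Order-convex sets and pieces of branches -/

/-- `A` contains with two nodes everything between them. -/
def OrderConvex (A : Set Node) : Prop :=
  ∀ a ∈ A, ∀ c ∈ A, ∀ b : Node, a <+: b → b <+: c → b ∈ A

/-- A finite order-convex set of pairwise comparable nodes, i.e. a segment or the empty set. -/
def IsPiece (S : Finset Node) : Prop :=
  (∀ a ∈ S, ∀ b ∈ S, a <+: b ∨ b <+: a) ∧ OrderConvex (S : Set Node)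

lemma OrderConvex.inter {A B : Set Node} (hA : OrderConvex A) (hB : OrderConvex B) :
    OrderConvex (A ∩ B) := fun a ha c hc b h h' =>
  ⟨hA a ha.1 c hc.1 b h h', hB a ha.2 c hc.2 b h h'⟩

lemma IsPiece.filter {S : Finset Node} (hS : IsPiece S) {A : Set Node} (hA : OrderConvex A)
    [DecidablePred (· ∈ A)] : IsPiece (S.filter (· ∈ A)) := by
  refine ⟨fun a ha b hb => hS.1 a (Finset.mem_filter.1 ha).1 b (Finset.mem_filter.1 hb).1, ?_⟩
  rw [Finset.coe_filter]
  exact hS.2.inter hA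

lemma IsSegment.isPiece {S : Finset Node} (hS : IsSegment S) : IsPiece S := by
  obtain ⟨α, β, -, h⟩ := hS
  refine ⟨fun a ha b hb => prefix_total ((h a).1 ha).2 ((h b).1 hb).2, fun a ha c hc b h1 h2 => ?_⟩
  exact (h b).2 ⟨((h a).1 ha).1.trans h1, h2.trans ((h c).1 hc).2⟩

lemma IsPiece.isSegment {S : Finset Node} (hS : IsPiece S) (hne : S.Nonempty) : IsSegment S := by
  obtain ⟨a, ha, hmin⟩ := S.exists_min_image List.length hne
  obtain ⟨b, hb, hmax⟩ := S.exists_max_image List.length hne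
  have key : ∀ x ∈ S, ∀ y ∈ S, x.length ≤ y.length → x <+: y := by
    intro x hx y hy hl
    rcases hS.1 x hx y hy with h | h
    · exact h
    · rw [h.eq_of_length_le hl]
  refine ⟨a, b, key a ha b hb (hmin b hb), fun γ => ⟨fun hγ => ?_, fun hγ => ?_⟩⟩
  · exact ⟨key a ha γ hγ (hmin γ hγ), key γ hγ b hb (hmax γ hγ)⟩
  · exact hS.2 a ha b hb γ hγ.1 hγ.2

/-- The nodes `β0ⁱ`, `a ≤ i < b`. -/
def chainIco (β : Node) (a b : ℕ) : Finset Node := (Finset.Ico a b).image (leftExt β)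

lemma mem_chainIco {β γ : Node} {a b : ℕ} :
    γ ∈ chainIco β a b ↔ ∃ i, (a ≤ i ∧ i < b) ∧ leftExt β i = γ := by
  simp [chainIco]

lemma isPiece_chainIco (β : Node) (a b : ℕ) : IsPiece (chainIco β a b) := by
  constructor
  · intro x hx y hy
    obtain ⟨i, -, rfl⟩ := mem_chainIco.1 hx
    obtain ⟨j, -, rfl⟩ := mem_chainIco.1 hy
    rw [leftExt_prefix_leftExt, leftExt_prefix_leftExt]
    exact le_total i j
  · intro x hx y hy z h1 h2
    obtain ⟨i, hi, rfl⟩ := mem_chainIco.1 hx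
    obtain ⟨j, hj, rfl⟩ := mem_chainIco.1 hy
    obtain ⟨l, -, rfl⟩ := exists_eq_leftExt ((prefix_leftExt β i).trans h1) h2
    rw [leftExt_prefix_leftExt] at h1 h2
    exact mem_chainIco.2 ⟨l, ⟨by omega, by omega⟩, rfl⟩

lemma sum_chainIco (x : Node → ℝ) (β : Node) (a b : ℕ) :
    ∑ γ ∈ chainIco β a b, x γ = ∑ i ∈ Finset.Ico a b, x (leftExt β i) :=
  Finset.sum_image fun _ _ _ _ h => leftExt_injective β h

/-- The prefixes of `b`. -/
def path (b : Node) : Finset Node := b.inits.toFinset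

@[simp] lemma mem_path {b γ : Node} : γ ∈ path b ↔ γ <+: b := by simp [path]

lemma isPiece_path (b : Node) : IsPiece (path b) := by
  refine ⟨fun x hx y hy => prefix_total (mem_path.1 hx) (mem_path.1 hy), fun x _ y hy z _ h2 => ?_⟩
  exact mem_path.2 (h2.trans (mem_path.1 hy))

/-- The chain of all nodes with the same start. -/
def chain (β : Node) : Set Node := {α | start α = β}

lemma orderConvex_chain (β : Node) : OrderConvex (chain β) := by
  intro a ha c hc b h1 h2
  have hac : rightTurns c = rightTurns a := by
    rw [← rightTurns_start c, ← rightTurns_start a, show start a = β from ha,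
      show start c = β from hc]
  exact (start_eq_of_prefix h1 (by rw [← hac]; exact rightTurns_mono h2)).trans ha

/-- The nodes with at most `n` right turns. -/
def subtree (n : ℕ) : Set Node := {α | rightTurns α ≤ n}

lemma orderConvex_subtree (n : ℕ) : OrderConvex (subtree n) := fun _ _ _ hc _ _ h2 =>
  (rightTurns_mono h2).trans hc

/-- The part of a chain from position `m` on. -/
def chainFrom (β : Node) (m : ℕ) : Set Node := {α | start α = β ∧ m ≤ trail α}

lemma chainFrom_zero (β : Node) : chainFrom β 0 = chain β := by simp [chainFrom, chain]

lemma orderConvex_chainFrom (β : Node) (m : ℕ) : OrderConvex (chainFrom β m) := by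
  intro a ha c hc b h1 h2
  have hb : start b = β := orderConvex_chain β a ha.1 c hc.1 b h1 h2
  refine ⟨hb, ha.2.trans ?_⟩
  have := h1.length_le
  rw [trail, trail, hb, show start a = β from ha.1]
  omega

/-- A piece of the subtree `T_n` meets at most `n + 1` chains. -/
lemma card_image_start_le {S : Finset Node} (hS : IsPiece S) {n : ℕ}
    (hn : ∀ α ∈ S, rightTurns α ≤ n) : (S.image start).card ≤ n + 1 := by
  rw [← Finset.card_range (n + 1)]
  -- Comparable nodes with equally many right turns differ by left turns only, so on a piece the
  -- number of right turns determines the chain; it takes values in 0, …, n.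
  refine Finset.card_le_card_of_injOn rightTurns ?_ ?_
  · intro β hβ
    obtain ⟨α, hα, rfl⟩ := Finset.mem_image.1 (Finset.mem_coe.1 hβ)
    simpa [Nat.lt_succ_iff] using hn α hα
  · intro β hβ β' hβ' h
    obtain ⟨α, hα, rfl⟩ := Finset.mem_image.1 (Finset.mem_coe.1 hβ)
    obtain ⟨α', hα', rfl⟩ := Finset.mem_image.1 (Finset.mem_coe.1 hβ')
    simp only [rightTurns_start] at h
    rcases hS.1 α hα α' hα' with hp | hp
    · exact (start_eq_of_prefix hp h.ge).symm
    · exact start_eq_of_prefix hp h.le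

end JamesTree
namespace JamesTree

/-! ### Sums over pieces and the norm of `JT` -/

lemma famNorm_sq (F : Finset (Finset Node)) (g : Node → ℝ) :
    famNorm F g ^ 2 = ∑ S ∈ F, (∑ γ ∈ S, g γ) ^ 2 :=
  Real.sq_sqrt (Finset.sum_nonneg fun _ _ => sq_nonneg _)

lemma famNorm_le_iff {F : Finset (Finset Node)} {g : Node → ℝ} {M : ℝ} (hM : 0 ≤ M) :
    famNorm F g ≤ M ↔ ∑ S ∈ F, (∑ γ ∈ S, g γ) ^ 2 ≤ M ^ 2 := by
  rw [← famNorm_sq, sq_le_sq₀ (famNorm_nonneg _ _) hM]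

lemma mem_jtSubmodule {g : Node → ℝ} {M : ℝ}
    (h : ∀ F, IsDisjointFamily F → ∑ S ∈ F, (∑ γ ∈ S, g γ) ^ 2 ≤ M) : g ∈ jtSubmodule :=
  ⟨√M, fun F hF => Real.sqrt_le_sqrt (h F hF)⟩

lemma isDisjointFamily_empty : IsDisjointFamily ∅ := by simp [IsDisjointFamily]

namespace JT

lemma ext {x y : JT} (h : ∀ α, x.toFun α = y.toFun α) : x = y := Subtype.ext (funext h)

@[simp] lemma toFun_add (x y : JT) : (x + y).toFun = x.toFun + y.toFun := rfl

@[simp] lemma toFun_smul (c : ℝ) (x : JT) : (c • x).toFun = c • x.toFun := rfl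

@[simp] lemma toFun_sub (x y : JT) : (x - y).toFun = x.toFun - y.toFun := rfl

@[simp] lemma toFun_zero : (0 : JT).toFun = 0 := rfl

/-- The coordinate functional at the node `α`. -/
noncomputable def coord (α : Node) : StrongDual ℝ JT :=
  LinearMap.mkContinuous
    { toFun := fun x => x.toFun α
      map_add' := fun _ _ => rfl
      map_smul' := fun _ _ => rfl } 1 fun x => by
    rw [one_mul, Real.norm_eq_abs]
    exact abs_apply_le_norm x α

@[simp] lemma coord_apply (α : Node) (x : JT) : coord α x = x.toFun α := rfl

@[simp] lemma toFun_sum {ι : Type*} (s : Finset ι) (x : ι → JT) (α : Node) :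
    (∑ i ∈ s, x i).toFun α = ∑ i ∈ s, (x i).toFun α := map_sum (coord α) x s

/-- The functional `x ↦ ∑_{γ ∈ S} x_γ`. -/
noncomputable def segSum (S : Finset Node) : StrongDual ℝ JT := ∑ γ ∈ S, coord γ

@[simp] lemma segSum_apply (S : Finset Node) (x : JT) : segSum S x = ∑ γ ∈ S, x.toFun γ := by
  simp [segSum]

lemma norm_sq_le {x : JT} {M : ℝ}
    (h : ∀ F, IsDisjointFamily F → ∑ S ∈ F, (∑ γ ∈ S, x.toFun γ) ^ 2 ≤ M) : ‖x‖ ^ 2 ≤ M := by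
  have hM : 0 ≤ M := by simpa using h ∅ isDisjointFamily_empty
  rw [← Real.sq_sqrt hM, sq_le_sq₀ (norm_nonneg _) (Real.sqrt_nonneg _)]
  refine norm_le fun F hF => ?_
  rw [famNorm_le_iff (Real.sqrt_nonneg _), Real.sq_sqrt hM]
  exact h F hF

/-- An element of `JT` from a function with bounded sums. -/
noncomputable def mk (g : Node → ℝ) (M : ℝ)
    (h : ∀ F, IsDisjointFamily F → ∑ S ∈ F, (∑ γ ∈ S, g γ) ^ 2 ≤ M) : JT :=
  ⟨g, mem_jtSubmodule h⟩

@[simp] lemma toFun_mk (g : Node → ℝ) (M : ℝ)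
    (h : ∀ F, IsDisjointFamily F → ∑ S ∈ F, (∑ γ ∈ S, g γ) ^ 2 ≤ M) : (mk g M h).toFun = g := rfl

lemma exists_family {x : JT} {δ : ℝ} (hδ : 0 < δ) :
    ∃ F, IsDisjointFamily F ∧ ‖x‖ ^ 2 - δ < ∑ S ∈ F, (∑ γ ∈ S, x.toFun γ) ^ 2 := by
  by_contra! h
  have := norm_sq_le h
  linarith

-- The form of the norm inequality suited to cutting segments: intersections with order-convex sets
-- may be empty and are indexed rather than collected. Empty pieces contribute nothing, and
-- non-empty disjoint ones are distinct segments.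
open Classical in
lemma sum_sq_le {ι : Type*} (x : JT) (s : Finset ι) (S : ι → Finset Node)
    (hS : ∀ i ∈ s, IsPiece (S i)) (hd : ∀ i ∈ s, ∀ j ∈ s, i ≠ j → Disjoint (S i) (S j)) :
    ∑ i ∈ s, (∑ γ ∈ S i, x.toFun γ) ^ 2 ≤ ‖x‖ ^ 2 := by
  set t := s.filter fun i => (S i).Nonempty with ht
  have h1 : ∑ i ∈ s, (∑ γ ∈ S i, x.toFun γ) ^ 2 = ∑ i ∈ t, (∑ γ ∈ S i, x.toFun γ) ^ 2 := by
    refine (Finset.sum_subset (Finset.filter_subset _ _) fun i hi hit => ?_).symm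
    have : S i = ∅ := by
      by_contra hne
      exact hit (Finset.mem_filter.2 ⟨hi, Finset.nonempty_iff_ne_empty.2 hne⟩)
    simp [this]
  have hinj : Set.InjOn S t := by
    intro i hi j hj hij
    by_contra hne
    have hi' := Finset.mem_filter.1 hi
    have hj' := Finset.mem_filter.1 hj
    have := hd i hi'.1 j hj'.1 hne
    rw [← hij, disjoint_self] at this
    exact Finset.nonempty_iff_ne_empty.1 hi'.2 this
  have hF : IsDisjointFamily (t.image S) := by
    constructor
    · intro A hA
      obtain ⟨i, hi, rfl⟩ := Finset.mem_image.1 hA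
      have hi' := Finset.mem_filter.1 hi
      exact (hS i hi'.1).isSegment hi'.2
    · intro A hA B hB hAB
      obtain ⟨i, hi, rfl⟩ := Finset.mem_image.1 hA
      obtain ⟨j, hj, rfl⟩ := Finset.mem_image.1 hB
      exact hd i (Finset.mem_filter.1 hi).1 j (Finset.mem_filter.1 hj).1 fun h => hAB (by rw [h])
  rw [h1, ← Finset.sum_image (f := fun A => (∑ γ ∈ A, x.toFun γ) ^ 2) hinj, ← famNorm_sq]
  exact pow_le_pow_left₀ (famNorm_nonneg _ _) (famNorm_le_norm x hF) 2

lemma abs_segSum_le {S : Finset Node} (hS : IsPiece S) (x : JT) : |segSum S x| ≤ ‖x‖ := by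
  have := sum_sq_le x {()} (fun _ => S) (by simpa using hS) (by simp)
  rw [Finset.sum_singleton, sq_le_sq, abs_of_nonneg (norm_nonneg x)] at this
  simpa using this

open Classical in
/-- The restriction of the elements of `JT` to an order-convex set of nodes. -/
noncomputable def restr (A : Set Node) (hA : OrderConvex A) : JT →L[ℝ] JT :=
  LinearMap.mkContinuous
    { toFun := fun x => mk (A.indicator x.toFun) (‖x‖ ^ 2) fun F hF => by
        have := sum_sq_le x F (fun S => S.filter (· ∈ A)) (fun S hS => (hF.1 S hS).isPiece.filter hA)
          fun S hS T hT h => (hF.2 S hS T hT h).mono (Finset.filter_subset _ _)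
            (Finset.filter_subset _ _)
        refine le_trans (le_of_eq (Finset.sum_congr rfl fun S _ => ?_)) this
        rw [Finset.sum_filter]
        rfl
      map_add' := fun x y => ext fun α => by
        by_cases h : α ∈ A <;> simp [h]
      map_smul' := fun c x => ext fun α => by
        by_cases h : α ∈ A <;> simp [h] } 1 fun x => by
    rw [one_mul, ← sq_le_sq₀ (norm_nonneg _) (norm_nonneg _)]
    refine norm_sq_le fun F hF => ?_
    have := sum_sq_le x F (fun S => S.filter (· ∈ A)) (fun S hS => (hF.1 S hS).isPiece.filter hA)
      fun S hS T hT h => (hF.2 S hS T hT h).mono (Finset.filter_subset _ _)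
        (Finset.filter_subset _ _)
    refine le_trans (le_of_eq (Finset.sum_congr rfl fun S _ => ?_)) this
    rw [Finset.sum_filter]
    rfl

@[simp] lemma toFun_restr (A : Set Node) (hA : OrderConvex A) (x : JT) :
    (restr A hA x).toFun = A.indicator x.toFun := rfl

lemma norm_restr_le (A : Set Node) (hA : OrderConvex A) (x : JT) : ‖restr A hA x‖ ≤ ‖x‖ := by
  simpa using (restr A hA).le_of_opNorm_le (LinearMap.mkContinuous_norm_le _ zero_le_one _) x

open Classical in
lemma sum_indicator_eq (S : Finset Node) (A : Set Node) (g : Node → ℝ) :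
    ∑ γ ∈ S, A.indicator g γ = ∑ γ ∈ S.filter (· ∈ A), g γ := by
  rw [Finset.sum_filter]
  rfl

open Classical in
/-- Sums over disjoint pieces and norms of restrictions to disjoint order-convex sets are jointly
square-additive. -/
lemma sum_sq_add_sum_norm_restr_sq_le {κ ι : Type*} (x : JT) (t : Finset κ) (S : κ → Finset Node)
    (hS : ∀ j ∈ t, IsPiece (S j)) (hd : ∀ i ∈ t, ∀ j ∈ t, i ≠ j → Disjoint (S i) (S j))
    (s : Finset ι) (A : ι → Set Node) (hA : ∀ i, OrderConvex (A i))
    (hAd : ∀ i ∈ s, ∀ j ∈ s, i ≠ j → Disjoint (A i) (A j))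
    (hSA : ∀ j ∈ t, ∀ i ∈ s, Disjoint (S j : Set Node) (A i)) :
    ∑ j ∈ t, (∑ γ ∈ S j, x.toFun γ) ^ 2 + ∑ i ∈ s, ‖restr (A i) (hA i) x‖ ^ 2 ≤ ‖x‖ ^ 2 := by
  refine le_of_forall_pos_le_add fun ε hε => ?_
  have hδ : 0 < ε / (s.card + 1) := by positivity
  choose F hF hFx using fun i => exists_family (x := restr (A i) (hA i) x) hδ
  -- One disjoint family made of the given pieces and of almost norming families for the
  -- restrictions, each cut down to its own set.
  let P : κ ⊕ (Σ _ : ι, Finset Node) → Finset Node :=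
    Sum.elim S fun q => q.2.filter (· ∈ A q.1)
  have key := sum_sq_le x (t.disjSum (s.sigma F)) P ?_ ?_
  · rw [Finset.sum_disjSum, Finset.sum_sigma] at key
    have h2 : ∑ i ∈ s, ‖restr (A i) (hA i) x‖ ^ 2 ≤
        ∑ i ∈ s, (∑ T ∈ F i, (∑ γ ∈ T.filter (· ∈ A i), x.toFun γ) ^ 2 + ε / (s.card + 1)) := by
      refine Finset.sum_le_sum fun i _ => ?_
      have := (hFx i).le
      simp only [toFun_restr, sum_indicator_eq] at this
      linarith
    rw [Finset.sum_add_distrib, Finset.sum_const, nsmul_eq_mul] at h2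
    have h3 : (s.card : ℝ) * (ε / (s.card + 1)) ≤ ε := by
      rw [mul_div_assoc', div_le_iff₀ (by positivity)]
      nlinarith
    have key' : ∑ j ∈ t, (∑ γ ∈ S j, x.toFun γ) ^ 2 +
        ∑ i ∈ s, ∑ T ∈ F i, (∑ γ ∈ T.filter (· ∈ A i), x.toFun γ) ^ 2 ≤ ‖x‖ ^ 2 := key
    linarith
  · rintro (j | ⟨i, T⟩) h
    · exact hS j (by simpa using h)
    · have h' : i ∈ s ∧ T ∈ F i := by simpa using h
      exact ((hF i).1 T h'.2).isPiece.filter (hA i)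
  · rintro (j | ⟨i, T⟩) h (j' | ⟨i', T'⟩) h' hne
    · exact hd j (by simpa using h) j' (by simpa using h') fun e => hne (by rw [e])
    · have h1 : i' ∈ s ∧ T' ∈ F i' := by simpa using h'
      have := hSA j (by simpa using h) i' h1.1
      refine Finset.disjoint_left.2 fun γ hγ hγ' => ?_
      exact Set.disjoint_left.1 this hγ (Finset.mem_filter.1 hγ').2
    · have h1 : i ∈ s ∧ T ∈ F i := by simpa using h
      have := hSA j' (by simpa using h') i h1.1
      refine Finset.disjoint_left.2 fun γ hγ hγ' => ?_
      exact Set.disjoint_left.1 this hγ' (Finset.mem_filter.1 hγ).2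
    · have h1 : i ∈ s ∧ T ∈ F i := by simpa using h
      have h2 : i' ∈ s ∧ T' ∈ F i' := by simpa using h'
      refine Finset.disjoint_left.2 fun γ hγ hγ' => ?_
      have hγ1 := Finset.mem_filter.1 hγ
      have hγ2 := Finset.mem_filter.1 hγ'
      by_cases hi : i = i'
      · subst hi
        refine Finset.disjoint_left.1 ((hF i).2 T h1.2 T' h2.2 fun e => hne (by rw [e])) hγ1.1 hγ2.1
      · exact Set.disjoint_left.1 (hAd i h1.1 i' h2.1 hi) hγ1.2 hγ2.2

lemma sum_norm_restr_sq_le {ι : Type*} (x : JT)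
    (s : Finset ι) (A : ι → Set Node) (hA : ∀ i, OrderConvex (A i))
    (hAd : ∀ i ∈ s, ∀ j ∈ s, i ≠ j → Disjoint (A i) (A j)) :
    ∑ i ∈ s, ‖restr (A i) (hA i) x‖ ^ 2 ≤ ‖x‖ ^ 2 := by
  simpa using sum_sq_add_sum_norm_restr_sq_le x (∅ : Finset Unit) (fun _ => ∅) (by simp) (by simp)
    s A hA hAd (by simp)

/-- Off a finite set of nodes, `x` is small on order-convex sets. -/
lemma exists_finset_sum_norm_restr_sq_le (x : JT) {δ : ℝ} (hδ : 0 < δ) :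
    ∃ G : Finset Node, ∀ (s : Finset Node) (A : Node → Set Node) (hA : ∀ i, OrderConvex (A i)),
      (∀ i ∈ s, ∀ j ∈ s, i ≠ j → Disjoint (A i) (A j)) →
      (∀ i ∈ s, Disjoint (G : Set Node) (A i)) →
      ∑ i ∈ s, ‖restr (A i) (hA i) x‖ ^ 2 ≤ δ := by
  classical
  -- An almost norming family already uses up all but δ of the squared norm, so sets avoiding its
  -- nodes share at most δ.
  obtain ⟨F, hF, hFx⟩ := exists_family (x := x) hδ
  refine ⟨F.biUnion id, fun s A hA hAd hG => ?_⟩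
  have := sum_sq_add_sum_norm_restr_sq_le x F id (fun S hS => (hF.1 S hS).isPiece) hF.2 s A hA hAd
    fun S hS i hi => (hG i hi).mono_left (by
      intro γ hγ
      exact Finset.mem_coe.2 (Finset.mem_biUnion.2 ⟨S, hS, hγ⟩))
  simp only [id] at this
  linarith

lemma exists_finset_abs_segSum_le (x : JT) {δ : ℝ} (hδ : 0 < δ) :
    ∃ G : Finset Node, ∀ S : Finset Node, IsPiece S → Disjoint G S → |segSum S x| ≤ δ := by
  obtain ⟨G, hG⟩ := exists_finset_sum_norm_restr_sq_le x (pow_pos hδ 2)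
  refine ⟨G, fun S hS hd => ?_⟩
  -- The root only serves as a dummy index for a single set.
  have h1 := hG {[]} (fun _ => S) (fun _ => hS.2) (by simp)
    (fun i _ => Finset.disjoint_coe.2 hd)
  rw [Finset.sum_singleton, sq_le_sq₀ (norm_nonneg _) hδ.le] at h1
  refine le_trans ?_ h1
  refine le_trans (le_of_eq ?_) (abs_segSum_le hS _)
  simp only [segSum_apply, toFun_restr]
  congr 1
  exact Finset.sum_congr rfl fun γ hγ => (Set.indicator_of_mem (Finset.mem_coe.2 hγ) _).symm

end JT

/-- If a segment sees at most `K` of the functions `g i`, which have squares summing to at most `M`,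
then `∑ g i` has squares summing to at most `K * M`. -/
lemma sum_sq_le_of_decomposition {ι : Type*} {g : Node → ℝ} {gs : ι → Node → ℝ} {w : ι → ℝ} {M : ℝ}
    {K : ℕ} (hg : ∀ S, IsSegment S → ∃ t : Finset ι, t.card ≤ K ∧
      ∑ γ ∈ S, g γ = ∑ i ∈ t, ∑ γ ∈ S, gs i γ)
    (hw : ∀ i F, IsDisjointFamily F → ∑ S ∈ F, (∑ γ ∈ S, gs i γ) ^ 2 ≤ w i)
    (hM : ∀ s : Finset ι, ∑ i ∈ s, w i ≤ M) {F : Finset (Finset Node)} (hF : IsDisjointFamily F) :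
    ∑ S ∈ F, (∑ γ ∈ S, g γ) ^ 2 ≤ K * M := by
  classical
  choose! t ht hgt using hg
  set T := F.biUnion t
  calc ∑ S ∈ F, (∑ γ ∈ S, g γ) ^ 2 ≤ ∑ S ∈ F, K * ∑ i ∈ T, (∑ γ ∈ S, gs i γ) ^ 2 := by
        refine Finset.sum_le_sum fun S hS => ?_
        rw [hgt S (hF.1 S hS)]
        refine (sq_sum_le_card_mul_sum_sq).trans ?_
        have h1 : ((t S).card : ℝ) ≤ K := by exact_mod_cast ht S (hF.1 S hS)
        have h2 : ∑ i ∈ t S, (∑ γ ∈ S, gs i γ) ^ 2 ≤ ∑ i ∈ T, (∑ γ ∈ S, gs i γ) ^ 2 :=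
          Finset.sum_le_sum_of_subset_of_nonneg (Finset.subset_biUnion_of_mem t hS)
            fun _ _ _ => sq_nonneg _
        exact mul_le_mul h1 h2 (Finset.sum_nonneg fun _ _ => sq_nonneg _) (Nat.cast_nonneg _)
    _ = K * ∑ i ∈ T, ∑ S ∈ F, (∑ γ ∈ S, gs i γ) ^ 2 := by
        rw [← Finset.mul_sum, Finset.sum_comm]
    _ ≤ K * M := by
        refine mul_le_mul_of_nonneg_left ?_ (Nat.cast_nonneg _)
        exact (Finset.sum_le_sum fun i _ => hw i F hF).trans (hM T)

lemma JT.sum_family_le (x : JT) {F : Finset (Finset Node)} (hF : IsDisjointFamily F) :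
    ∑ S ∈ F, (∑ γ ∈ S, x.toFun γ) ^ 2 ≤ ‖x‖ ^ 2 :=
  JT.sum_sq_le x F id (fun S hS => (hF.1 S hS).isPiece) hF.2

/-- If every segment sees at most `K` of the vectors `z i`, then they satisfy an upper
`2`-estimate. -/
lemma norm_sum_sq_le {ι : Type*} (s : Finset ι) (z : ι → JT) {K : ℕ}
    (h : ∀ S, IsSegment S → ∃ t ⊆ s, t.card ≤ K ∧ ∀ i ∈ s, i ∉ t → JT.segSum S (z i) = 0) :
    ‖∑ i ∈ s, z i‖ ^ 2 ≤ K * ∑ i ∈ s, ‖z i‖ ^ 2 := by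
  classical
  refine JT.norm_sq_le fun F hF => ?_
  refine sum_sq_le_of_decomposition (gs := fun i => if i ∈ s then (z i).toFun else 0)
    (w := fun i => if i ∈ s then ‖z i‖ ^ 2 else 0) (fun S hS => ?_) (fun i F hF => ?_)
    (fun t => ?_) hF
  · obtain ⟨t, hts, htK, h0⟩ := h S hS
    refine ⟨t, htK, ?_⟩
    simp only [JT.segSum_apply] at h0
    simp only [JT.toFun_sum]
    rw [Finset.sum_comm, ← Finset.sum_subset hts h0]
    exact Finset.sum_congr rfl fun i hi => by simp [hts hi]
  · by_cases hi : i ∈ s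
    · simpa [hi] using JT.sum_family_le (z i) hF
    · simp [hi]
  · rw [← Finset.sum_filter]
    refine Finset.sum_le_sum_of_subset_of_nonneg ?_ fun _ _ _ => sq_nonneg _
    intro i hi
    exact (Finset.mem_filter.1 hi).2

end JamesTree
open Filter Topology

namespace JamesTree

/-! ### Sums along chains -/

namespace JT

lemma exists_abs_segSum_le_of_length (x : JT) {δ : ℝ} (hδ : 0 < δ) :
    ∃ N : ℕ, ∀ S : Finset Node, IsPiece S → (∀ γ ∈ S, N ≤ γ.length) → |segSum S x| ≤ δ := by
  obtain ⟨G, hG⟩ := exists_finset_abs_segSum_le x hδ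
  refine ⟨G.sup List.length + 1, fun S hS hl => hG S hS (Finset.disjoint_left.2 fun γ hγ hγ' => ?_)⟩
  have h1 := hl γ hγ'
  have h2 : γ.length ≤ G.sup List.length := Finset.le_sup (f := List.length) hγ
  omega

/-- The partial sums along the chain of left turns starting from `β`. -/
lemma segSum_chainIco (β : Node) (a b : ℕ) (x : JT) :
    segSum (chainIco β a b) x = ∑ i ∈ Finset.Ico a b, x.toFun (leftExt β i) := by
  rw [segSum_apply, sum_chainIco]

lemma segSum_chainIco_sub (β : Node) {a b : ℕ} (h : a ≤ b) (x : JT) :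
    segSum (chainIco β 0 b) x - segSum (chainIco β 0 a) x = segSum (chainIco β a b) x := by
  simp only [segSum_chainIco]
  rw [← Finset.sum_Ico_consecutive _ (Nat.zero_le a) h]
  ring

/-- Differences of partial sums are sums over deep pieces, which are uniformly small; convergence is
only conditional. -/
lemma exists_tendsto_chain (β : Node) (x : JT) :
    ∃ l, Tendsto (fun k => segSum (chainIco β 0 k) x) atTop (𝓝 l) := by
  refine cauchySeq_tendsto_of_complete (Metric.cauchySeq_iff'.2 fun ε hε => ?_)
  obtain ⟨N, hN⟩ := exists_abs_segSum_le_of_length x (half_pos hε)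
  refine ⟨N, fun k hk => ?_⟩
  rw [Real.dist_eq, segSum_chainIco_sub β hk]
  refine (hN _ (isPiece_chainIco _ _ _) fun γ hγ => ?_).trans_lt (half_lt_self hε)
  obtain ⟨i, hi, rfl⟩ := mem_chainIco.1 hγ
  simp only [length_leftExt]
  omega

/-- The sum over the infinite chain of left turns starting from `β`. -/
noncomputable def chainSum (β : Node) : StrongDual ℝ JT :=
  LinearMap.mkContinuous
    (linearMapOfTendsto (fun x => (exists_tendsto_chain β x).choose)
      (fun k => (segSum (chainIco β 0 k)).toLinearMap)
      (tendsto_pi_nhds.2 fun x => (exists_tendsto_chain β x).choose_spec)) 1 fun x => by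
    rw [one_mul]
    exact le_of_tendsto (exists_tendsto_chain β x).choose_spec.norm
      (Eventually.of_forall fun k => abs_segSum_le (isPiece_chainIco _ _ _) x)

lemma tendsto_chainSum (β : Node) (x : JT) :
    Tendsto (fun k => segSum (chainIco β 0 k) x) atTop (𝓝 (chainSum β x)) :=
  (exists_tendsto_chain β x).choose_spec

lemma tendsto_chainSum_range (β : Node) (x : JT) :
    Tendsto (fun k => ∑ i ∈ Finset.range k, x.toFun (leftExt β i)) atTop (𝓝 (chainSum β x)) := by
  simpa only [segSum_chainIco, Nat.Ico_zero_eq_range] using tendsto_chainSum β x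

lemma abs_chainSum_le (β : Node) (x : JT) : |chainSum β x| ≤ ‖x‖ := by
  simpa using (chainSum β).le_of_opNorm_le (LinearMap.mkContinuous_norm_le _ zero_le_one _) x

lemma chainSum_congr {β : Node} {x y : JT}
    (h : ∀ i, x.toFun (leftExt β i) = y.toFun (leftExt β i)) : chainSum β x = chainSum β y := by
  refine tendsto_nhds_unique (tendsto_chainSum_range β x) ?_
  simp only [h]
  exact tendsto_chainSum_range β y

lemma chainSum_leftExt (β : Node) (k : ℕ) (x : JT) :
    chainSum (leftExt β k) x = chainSum β x - ∑ i ∈ Finset.range k, x.toFun (leftExt β i) := by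
  refine tendsto_nhds_unique (tendsto_chainSum_range (leftExt β k) x) ?_
  have h := ((tendsto_chainSum_range β x).comp (tendsto_add_atTop_nat k)).sub_const
    (∑ i ∈ Finset.range k, x.toFun (leftExt β i))
  refine h.congr fun j => ?_
  simp only [Function.comp, leftExt_leftExt]
  rw [add_comm j k, Finset.sum_range_add]
  ring

lemma tendsto_chainSum_leftExt (β : Node) (x : JT) :
    Tendsto (fun k => chainSum (leftExt β k) x) atTop (𝓝 0) := by
  simp only [chainSum_leftExt]
  simpa using (tendsto_const_nhds (x := chainSum β x)).sub (tendsto_chainSum_range β x)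

lemma mem_chain_leftExt {β : Node} (hβ : start β = β) (i : ℕ) : leftExt β i ∈ chain β := by
  simp [chain, hβ]

end JT

lemma disjoint_chain {β β' : Node} (h : β ≠ β') : Disjoint (chain β) (chain β') :=
  Set.disjoint_left.2 fun _ h1 h2 => h (h1.symm.trans h2)

/-! ### The spaces `X n` -/

@[simp] lemma toFun_nodeVec (α : Node) : (nodeVec α).toFun = Pi.single α 1 := rfl

lemma sum_single_eq (S : Finset Node) (α : Node) :
    JT.segSum S (nodeVec α) = if α ∈ S then 1 else 0 := by
  rw [JT.segSum_apply, toFun_nodeVec, Finset.sum_pi_single']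

lemma norm_nodeVec_le (α : Node) : ‖nodeVec α‖ ≤ 1 := by
  classical
  rw [← sq_le_sq₀ (norm_nonneg _) zero_le_one, one_pow]
  refine JT.norm_sq_le fun F hF => ?_
  simp only [← JT.segSum_apply, sum_single_eq]
  have hc : (F.filter fun S => α ∈ S).card ≤ 1 := by
    refine Finset.card_le_one.2 fun S hS T hT => ?_
    rw [Finset.mem_filter] at hS hT
    by_contra hne
    exact Finset.disjoint_left.1 (hF.2 S hS.1 T hT.1 hne) hS.2 hT.2
  calc ∑ S ∈ F, (if α ∈ S then (1 : ℝ) else 0) ^ 2 = (F.filter fun S => α ∈ S).card := by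
        simp
    _ ≤ 1 := by exact_mod_cast hc

lemma chainSum_nodeVec {β β' : Node} (hβ : start β = β) (hβ' : start β' = β') (k : ℕ) :
    JT.chainSum β (nodeVec (leftExt β' k)) = if β = β' then 1 else 0 := by
  refine tendsto_nhds_unique (JT.tendsto_chainSum β _) ?_
  refine tendsto_const_nhds.congr' ?_
  filter_upwards [eventually_gt_atTop k] with j hj
  rw [sum_single_eq]
  congr 1
  rw [mem_chainIco, eq_iff_iff]
  constructor
  · rintro rfl
    exact ⟨k, ⟨by omega, hj⟩, rfl⟩
  · rintro ⟨i, -, hi⟩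
    rw [← hβ, ← start_leftExt β i, hi, start_leftExt, hβ']

/-- Chainwise control of the norm of functions supported in `T_n`. -/
lemma sum_sq_le_of_chains {n : ℕ} {g : Node → ℝ} (hg : ∀ α, n < rightTurns α → g α = 0)
    {w : Node → ℝ} {M : ℝ}
    (hw : ∀ β F, IsDisjointFamily F → ∑ S ∈ F, (∑ γ ∈ S, (chain β).indicator g γ) ^ 2 ≤ w β)
    (hM : ∀ s : Finset Node, ∑ β ∈ s, w β ≤ M) {F : Finset (Finset Node)}
    (hF : IsDisjointFamily F) : ∑ S ∈ F, (∑ γ ∈ S, g γ) ^ 2 ≤ (n + 1) * M := by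
  classical
  have := sum_sq_le_of_decomposition (K := n + 1) (g := g) (gs := fun β => (chain β).indicator g)
    (fun S hS => ?_) hw hM hF
  · simpa using this
  -- Nodes outside T_n do not contribute, so only the at most n + 1 chains meeting S ∩ T_n matter.
  · set S' := S.filter (· ∈ subtree n) with hS'
    refine ⟨S'.image start, card_image_start_le (hS.isPiece.filter (orderConvex_subtree n))
      fun α hα => (Finset.mem_filter.1 hα).2, ?_⟩
    rw [Finset.sum_comm]
    refine Finset.sum_congr rfl fun γ hγ => ?_
    by_cases hn : γ ∈ subtree n
    · rw [Finset.sum_eq_single_of_mem (start γ)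
        (Finset.mem_image_of_mem _ (Finset.mem_filter.2 ⟨hγ, hn⟩))]
      · exact (Set.indicator_of_mem (show γ ∈ chain (start γ) from rfl) g).symm
      · exact fun β _ hne => Set.indicator_of_notMem (fun h : γ ∈ chain β => hne h.symm) g
    · have h0 : g γ = 0 := hg γ (not_le.1 hn)
      rw [h0]
      exact (Finset.sum_eq_zero fun β _ => Set.indicator_apply_eq_zero.2 fun _ => h0).symm

/-- Meant for remainders: y is what is left of x when only the part `A β` of each chain is kept. If
these parts avoid the finite set where x has almost all its norm, then y is small. -/
lemma norm_sq_le_of_parts {n : ℕ} {x y : JT} (hx : ∀ α, n < rightTurns α → x.toFun α = 0)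
    {A : Node → Set Node} (hA : ∀ β, OrderConvex (A β)) (hAc : ∀ β, A β ⊆ chain β)
    (hy : ∀ α, y.toFun α = (A (start α)).indicator x.toFun α) {M : ℝ}
    (hM : ∀ s : Finset Node, ∑ β ∈ s, ‖JT.restr (A β) (hA β) x‖ ^ 2 ≤ M) :
    ‖y‖ ^ 2 ≤ (n + 1) * M := by
  refine JT.norm_sq_le fun F hF => sum_sq_le_of_chains (fun α hα => ?_) (fun β F hF => ?_) hM hF
  · rw [hy]
    exact Set.indicator_apply_eq_zero.2 fun _ => hx α hα
  · refine le_trans (le_of_eq ?_) (JT.sum_family_le (JT.restr (A β) (hA β) x) hF)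
    refine Finset.sum_congr rfl fun S _ => ?_
    congr 1
    refine Finset.sum_congr rfl fun γ _ => ?_
    rw [JT.toFun_restr]
    by_cases h : γ ∈ chain β
    · rw [Set.indicator_of_mem h, hy, show start γ = β from h]
    · rw [Set.indicator_of_notMem h, Set.indicator_of_notMem fun h' => h (hAc β h')]

lemma norm_sq_le_sum_chains {n : ℕ} {x : JT} (hx : ∀ α, n < rightTurns α → x.toFun α = 0)
    {M : ℝ} (hM : ∀ s : Finset Node,
      ∑ β ∈ s, ‖JT.restr (chain β) (orderConvex_chain β) x‖ ^ 2 ≤ M) :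
    ‖x‖ ^ 2 ≤ (n + 1) * M :=
  norm_sq_le_of_parts hx orderConvex_chain (fun _ => subset_rfl)
    (fun α => (Set.indicator_of_mem (by exact rfl) _).symm) hM

lemma toFun_eq_zero_of_mem {n : ℕ} {x : JT} (hx : x ∈ X n) {α : Node} (hα : n < rightTurns α) :
    x.toFun α = 0 := by
  have hle : X n ≤ LinearMap.ker (JT.coord α).toLinearMap := by
    refine Submodule.topologicalClosure_minimal _ ?_ (JT.coord α).isClosed_ker
    rw [Submodule.span_le]
    rintro _ ⟨α', hα', rfl⟩
    have hne : α ≠ α' := by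
      rintro rfl
      exact absurd hα' (not_le.2 hα)
    simp [hne]
  exact hle hx

lemma nodeVec_mem {n : ℕ} {α : Node} (h : rightTurns α ≤ n) : nodeVec α ∈ X n :=
  Submodule.le_topologicalClosure _ (Submodule.subset_span ⟨α, h, rfl⟩)

/-- Every element of `JT` supported in `T_n` is in the closed span of the node vectors. -/
lemma mem_X {n : ℕ} {x : JT} (hx : ∀ α, n < rightTurns α → x.toFun α = 0) : x ∈ X n := by
  classical
  refine Metric.mem_closure_iff.2 fun ε hε => ?_
  have hδ : 0 < (ε / 2) ^ 2 / (n + 1) := by positivity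
  obtain ⟨G, hG⟩ := JT.exists_finset_sum_norm_restr_sq_le x hδ
  set s := G.image start
  set N := G.sup trail + 1
  -- The truncation y keeps the first N positions on every chain that meets G, and N exceeds all
  -- positions occurring in G.
  set P := s.biUnion fun β => chainIco β 0 N
  set y : JT := ∑ α ∈ P, x.toFun α • nodeVec α
  have hy : ∀ α, y.toFun α = if α ∈ P then x.toFun α else 0 := by
    intro α
    simp only [y, JT.toFun_sum, JT.toFun_smul, toFun_nodeVec, Pi.smul_apply, smul_eq_mul]
    simp [Pi.single_apply]
  refine ⟨y, ?_, ?_⟩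
  · refine Submodule.sum_mem _ fun α _ => ?_
    by_cases h : rightTurns α ≤ n
    · exact Submodule.smul_mem _ _ (Submodule.subset_span ⟨α, h, rfl⟩)
    · rw [hx α (not_le.1 h), zero_smul]
      exact Submodule.zero_mem _
  · have hP : ∀ α, α ∈ P ↔ start α ∈ s ∧ trail α < N := by
      intro α
      simp only [P, Finset.mem_biUnion, mem_chainIco]
      constructor
      · rintro ⟨β, hβ, i, hi, rfl⟩
        obtain ⟨γ, hγ, rfl⟩ := Finset.mem_image.1 hβ
        rw [start_leftExt, start_start, trail_leftExt (start_start γ)]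
        exact ⟨hβ, hi.2⟩
      · rintro ⟨h1, h2⟩
        exact ⟨start α, h1, trail α, ⟨Nat.zero_le _, h2⟩, leftExt_start_trail α⟩
    -- The support left for x - y: a tail of each chain meeting G, all of every other chain. None of
    -- these parts meets G.
    let A : Node → Set Node := fun β => chainFrom β (if β ∈ s then N else 0)
    have hAG : ∀ β, Disjoint (G : Set Node) (A β) := by
      refine fun β => Set.disjoint_left.2 fun γ hγ hγ' => ?_
      have h1 : β ∈ s := by
        rw [← hγ'.1]
        exact Finset.mem_image_of_mem _ hγ
      have h2 := hγ'.2
      rw [if_pos h1] at h2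
      have h3 : trail γ ≤ G.sup trail := Finset.le_sup (f := trail) hγ
      omega
    have hle : ‖x - y‖ ^ 2 ≤ (n + 1) * ((ε / 2) ^ 2 / (n + 1)) := by
      refine norm_sq_le_of_parts hx (A := A) (fun β => orderConvex_chainFrom β _)
        (fun β α h => h.1) (fun α => ?_) fun t => hG t A _ ?_ fun β _ => hAG β
      · have hAα : α ∈ A (start α) ↔ α ∉ P := by
          rw [hP, not_and, not_lt]
          by_cases h : start α ∈ s <;> simp [A, chainFrom, h]
        simp only [JT.toFun_sub, Pi.sub_apply, hy]
        by_cases h : α ∈ P <;> simp [h, hAα]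
      · exact fun i _ j _ hij => (disjoint_chain hij).mono (fun α h => h.1) fun α h => h.1
    rw [mul_div_cancel₀ _ (by positivity : (n + 1 : ℝ) ≠ 0),
      sq_le_sq₀ (norm_nonneg _) (by positivity)] at hle
    rw [dist_eq_norm]
    linarith

/-- Once every chain meeting an almost norming finite set has been included, the remaining chains
avoid that set and carry little norm. -/
lemma hasSum_restr_chain {n : ℕ} {x : JT} (hx : ∀ α, n < rightTurns α → x.toFun α = 0) :
    HasSum (fun β => JT.restr (chain β) (orderConvex_chain β) x) x := by
  classical
  refine Metric.tendsto_atTop.2 fun ε hε => ?_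
  have hδ : 0 < (ε / 2) ^ 2 / (n + 1) := by positivity
  obtain ⟨G, hG⟩ := JT.exists_finset_sum_norm_restr_sq_le x hδ
  refine ⟨G.image start, fun s hs => ?_⟩
  let A : Node → Set Node := fun β => if β ∈ s then ∅ else chain β
  have hAc : ∀ β, A β ⊆ chain β := fun β => by
    by_cases h : β ∈ s <;> simp [A, h]
  have hA : ∀ β, OrderConvex (A β) := fun β => by
    by_cases h : β ∈ s
    · simp [A, h, OrderConvex]
    · simpa [A, h] using orderConvex_chain β
  have hle : ‖x - ∑ β ∈ s, JT.restr (chain β) (orderConvex_chain β) x‖ ^ 2 ≤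
      (n + 1) * ((ε / 2) ^ 2 / (n + 1)) := by
    refine norm_sq_le_of_parts hx hA hAc (fun α => ?_) fun t => hG t A hA ?_ fun β _ => ?_
    · simp only [JT.toFun_sub, Pi.sub_apply, JT.toFun_sum, JT.toFun_restr]
      by_cases h : start α ∈ s
      · rw [Finset.sum_eq_single_of_mem (start α) h fun β _ hne =>
          Set.indicator_of_notMem (fun h' => hne h'.symm) _]
        rw [Set.indicator_of_mem (by exact rfl)]
        simp [A, h]
      · have h0 : ∀ β ∈ s, (chain β).indicator x.toFun α = 0 := fun β hβ =>
          Set.indicator_of_notMem (fun h' : α ∈ chain β => h ((show start α = β from h') ▸ hβ)) _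
        rw [Finset.sum_eq_zero h0]
        have : α ∈ A (start α) := by simp [A, h, chain]
        simp [this]
    · exact fun i _ j _ hij => (disjoint_chain hij).mono (hAc i) (hAc j)
    · refine Set.disjoint_left.2 fun γ hγ hγ' => ?_
      have h1 : start γ = β := hAc β hγ'
      have h2 : β ∈ s := hs (h1 ▸ Finset.mem_image_of_mem _ hγ)
      simp [A, h2] at hγ'
  rw [mul_div_cancel₀ _ (by positivity : (n + 1 : ℝ) ≠ 0),
    sq_le_sq₀ (norm_nonneg _) (by positivity)] at hle
  rw [dist_comm, dist_eq_norm]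
  linarith

end JamesTree
open Filter Topology

/-! ### Upper and lower `2`-estimates in normed spaces -/

section Estimates

variable {E : Type*} [NormedAddCommGroup E] [NormedSpace ℝ E] {ι : Type*}

lemma exists_norm_le_one_half_norm_le (ψ : StrongDual ℝ E) :
    ∃ x : E, ‖x‖ ≤ 1 ∧ ‖ψ‖ / 2 ≤ ψ x := by
  by_contra! h
  have h0 : 0 < ‖ψ‖ / 2 := by simpa using h 0 (by simp)
  have : ‖ψ‖ ≤ ‖ψ‖ / 2 := by
    refine ψ.opNorm_le_of_unit_norm h0.le fun x hx => ?_
    rw [Real.norm_eq_abs, abs_le]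
    have h1 := h x hx.le
    have h2 := h (-x) (by simpa using hx.le)
    rw [map_neg] at h2
    exact ⟨by linarith, h1.le⟩
  linarith

lemma le_of_sq_le_mul {Q a : ℝ} (ha : 0 ≤ a) (h : Q ^ 2 ≤ a * Q) : Q ≤ a := by
  rcases le_or_gt Q 0 with h0 | h0
  · exact h0.trans ha
  · exact le_of_mul_le_mul_right (by rwa [← sq]) h0

/-- A functional takes square-summable values on a family with an upper `2`-estimate. -/
lemma sum_sq_apply_le {K : ℝ} (hK : 0 ≤ K) (ψ : StrongDual ℝ E) (s : Finset ι) (v : ι → E)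
    (h : ∀ c : ι → ℝ, ‖∑ i ∈ s, c i • v i‖ ^ 2 ≤ K * ∑ i ∈ s, c i ^ 2) :
    ∑ i ∈ s, ψ (v i) ^ 2 ≤ K * ‖ψ‖ ^ 2 := by
  set Q := ∑ i ∈ s, ψ (v i) ^ 2 with hQ
  have hQ0 : 0 ≤ Q := Finset.sum_nonneg fun _ _ => sq_nonneg _
  -- Duality: test ψ on the combination whose coefficients are the values of ψ themselves.
  have h1 : Q = ψ (∑ i ∈ s, ψ (v i) • v i) := by
    rw [map_sum]
    exact Finset.sum_congr rfl fun i _ => by rw [map_smul, smul_eq_mul, sq]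
  have h2 : Q ≤ ‖ψ‖ * ‖∑ i ∈ s, ψ (v i) • v i‖ := by
    conv_lhs => rw [h1]
    exact (le_abs_self _).trans (ψ.le_opNorm _)
  refine le_of_sq_le_mul (by positivity) ?_
  calc Q ^ 2 ≤ (‖ψ‖ * ‖∑ i ∈ s, ψ (v i) • v i‖) ^ 2 := pow_le_pow_left₀ hQ0 h2 2
    _ = ‖ψ‖ ^ 2 * ‖∑ i ∈ s, ψ (v i) • v i‖ ^ 2 := mul_pow _ _ _
    _ ≤ ‖ψ‖ ^ 2 * (K * Q) := mul_le_mul_of_nonneg_left (h _) (sq_nonneg _)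
    _ = K * ‖ψ‖ ^ 2 * Q := by ring

/-- By Cauchy–Schwarz, square-summability of the values of the functionals dualizes to an upper
2-estimate for the functionals. -/
lemma norm_sum_smul_sq_le (s : Finset ι) (g : ι → StrongDual ℝ E)
    (h : ∀ y, ∑ i ∈ s, g i y ^ 2 ≤ ‖y‖ ^ 2) (c : ι → ℝ) :
    ‖∑ i ∈ s, c i • g i‖ ^ 2 ≤ ∑ i ∈ s, c i ^ 2 := by
  have h0 : 0 ≤ ∑ i ∈ s, c i ^ 2 := Finset.sum_nonneg fun _ _ => sq_nonneg _
  rw [← Real.sq_sqrt h0, sq_le_sq₀ (norm_nonneg _) (Real.sqrt_nonneg _)]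
  refine ContinuousLinearMap.opNorm_le_bound _ (Real.sqrt_nonneg _) fun y => ?_
  rw [sum_apply, Real.norm_eq_abs, ← sq_le_sq₀ (abs_nonneg _) (by positivity),
    sq_abs, mul_pow, Real.sq_sqrt h0]
  refine (Finset.sum_mul_sq_le_sq_mul_sq s c fun i => g i y).trans ?_
  exact mul_le_mul_of_nonneg_left (h y) h0

/-- A bidual functional takes square-summable values on a family with a lower `2`-estimate. -/
lemma sum_sq_bidual_apply_le (Φ : StrongDual ℝ (StrongDual ℝ E)) (s : Finset ι)
    (g : ι → StrongDual ℝ E) (h : ∀ y, ∑ i ∈ s, g i y ^ 2 ≤ ‖y‖ ^ 2) :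
    ∑ i ∈ s, Φ (g i) ^ 2 ≤ ‖Φ‖ ^ 2 := by
  simpa using sum_sq_apply_le zero_le_one Φ s g fun c => by
    simpa using norm_sum_smul_sq_le s g h c

/-- For an unconditional decomposition with upper and lower `2`-estimates, every functional is the
norm limit of the sums of its parts. -/
lemma mem_closure_span_comp_of_decomposition (R : ι → E →L[ℝ] E) {K : ℝ} (hK : 0 ≤ K)
    (hR : ∀ i x, R i (R i x) = R i x)
    (hup : ∀ (s : Finset ι) (x : ι → E),
      ‖∑ i ∈ s, R i (x i)‖ ^ 2 ≤ K * ∑ i ∈ s, ‖R i (x i)‖ ^ 2)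
    (hlow : ∀ (s : Finset ι) x, ∑ i ∈ s, ‖R i x‖ ^ 2 ≤ ‖x‖ ^ 2)
    (hsum : ∀ x, HasSum (fun i => R i x) x) (ψ : StrongDual ℝ E) :
    ψ ∈ (Submodule.span ℝ (Set.range fun i => ψ.comp (R i))).topologicalClosure := by
  classical
  have hle : ∀ i x, ‖R i x‖ ≤ ‖x‖ := fun i x => by
    have := hlow {i} x
    rwa [Finset.sum_singleton, sq_le_sq₀ (norm_nonneg _) (norm_nonneg _)] at this
  -- Half-norming vectors suffice to make the norms of the parts of ψ square-summable; halving costs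
  -- the factor 4 below.
  choose x hx1 hx using fun i => exists_norm_le_one_half_norm_le (ψ.comp (R i))
  have hbound : ∀ s : Finset ι, ∑ i ∈ s, ‖ψ.comp (R i)‖ ^ 2 ≤ 4 * (K * ‖ψ‖ ^ 2) := by
    intro s
    have h1 := sum_sq_apply_le hK ψ s (fun i => R i (x i)) fun c => by
      simp only [← map_smul]
      refine (hup s _).trans (mul_le_mul_of_nonneg_left (Finset.sum_le_sum fun i _ => ?_) hK)
      rw [map_smul, norm_smul, mul_pow, Real.norm_eq_abs, sq_abs]
      refine mul_le_of_le_one_right (sq_nonneg _) (pow_le_one₀ (norm_nonneg _) ?_)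
      exact (hle i _).trans (hx1 i)
    refine le_trans ?_ (mul_le_mul_of_nonneg_left h1 (by norm_num))
    rw [Finset.mul_sum]
    refine Finset.sum_le_sum fun i _ => ?_
    have h2 : ‖ψ.comp (R i)‖ / 2 ≤ ψ (R i (x i)) := hx i
    have h3 := norm_nonneg (ψ.comp (R i))
    nlinarith
  have hsummable : Summable fun i => ‖ψ.comp (R i)‖ ^ 2 :=
    summable_of_sum_le (fun _ => sq_nonneg _) hbound
  refine Metric.mem_closure_iff.2 fun ε hε => ?_
  obtain ⟨s, hs⟩ := summable_iff_vanishing_norm.1 hsummable _ (pow_pos (half_pos hε) 2)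
  refine ⟨∑ i ∈ s, ψ.comp (R i), Submodule.sum_mem _ fun i _ =>
    Submodule.subset_span ⟨i, rfl⟩, ?_⟩
  rw [dist_eq_norm]
  refine lt_of_le_of_lt ?_ (half_lt_self hε)
  refine ContinuousLinearMap.opNorm_le_bound _ (half_pos hε).le fun y => ?_
  have hlim : Tendsto (fun t : Finset ι => ‖ψ (∑ i ∈ t, R i y) - ∑ i ∈ s, ψ (R i y)‖) atTop
      (𝓝 ‖ψ y - ∑ i ∈ s, ψ (R i y)‖) :=
    (((ψ.continuous.tendsto y).comp (hsum y)).sub_const _).norm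
  have hrw : (ψ - ∑ i ∈ s, ψ.comp (R i)) y = ψ y - ∑ i ∈ s, ψ (R i y) := by
    simp
  rw [hrw]
  refine le_of_tendsto hlim ?_
  filter_upwards [eventually_ge_atTop s] with t ht
  -- Idempotence puts a second `R i` next to y, so that Cauchy–Schwarz can pair the small tail of
  -- the norms of `ψ.comp (R i)` with the lower 2-estimate for y.
  have h1 : ψ (∑ i ∈ t, R i y) - ∑ i ∈ s, ψ (R i y) = ∑ i ∈ t \ s, ψ.comp (R i) (R i y) := by
    rw [map_sum, ← Finset.sum_sdiff ht]
    simp [hR]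
  rw [h1]
  have h2 := hs (t \ s) Finset.sdiff_disjoint
  rw [Real.norm_of_nonneg (Finset.sum_nonneg fun _ _ => sq_nonneg _)] at h2
  calc ‖∑ i ∈ t \ s, ψ.comp (R i) (R i y)‖ ≤ ∑ i ∈ t \ s, ‖ψ.comp (R i)‖ * ‖R i y‖ :=
        (norm_sum_le _ _).trans (Finset.sum_le_sum fun i _ => (ψ.comp (R i)).le_opNorm _)
    _ ≤ ε / 2 * ‖y‖ := by
        rw [← sq_le_sq₀ (Finset.sum_nonneg fun _ _ => by positivity) (by positivity), mul_pow]
        refine (Finset.sum_mul_sq_le_sq_mul_sq _ _ _).trans ?_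
        exact mul_le_mul h2.le (hlow _ _) (Finset.sum_nonneg fun _ _ => sq_nonneg _)
          (sq_nonneg _)

end Estimates

/-- Only the minimum and the maximum can survive. This is how the two ends of a segment enter the
upper 2-estimates. -/
lemma Finset.card_le_two_of_no_middle {t : Finset ℕ}
    (h : ∀ i ∈ t, ∀ j ∈ t, ∀ k ∈ t, i < j → j < k → False) : t.card ≤ 2 := by
  rcases t.eq_empty_or_nonempty with rfl | hne
  · simp
  · refine (Finset.card_le_card (t := {t.min' hne, t.max' hne}) fun j hj => ?_).trans
      Finset.card_le_two
    rw [Finset.mem_insert, Finset.mem_singleton]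
    by_contra! hj'
    exact h _ (t.min'_mem hne) j hj _ (t.max'_mem hne)
      (lt_of_le_of_ne (t.min'_le j hj) hj'.1.symm) (lt_of_le_of_ne (t.le_max' j hj) hj'.2)

namespace JamesTree

/-! ### The dual of `X n` -/

lemma orderConvex_chainIco (β : Node) (a b : ℕ) : OrderConvex (chainIco β a b : Set Node) :=
  (isPiece_chainIco β a b).2

/-- The part of `x` on the nodes `β0ⁱ`, `a ≤ i < b`, shifted by a multiple of `f_{β0ᵃ}` to have
sum zero. -/
noncomputable def block (β : Node) (a b : ℕ) (x : JT) : JT :=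
  JT.restr _ (orderConvex_chainIco β a b) x - JT.segSum (chainIco β a b) x • nodeVec (leftExt β a)

lemma norm_block_le (β : Node) (a b : ℕ) (x : JT) : ‖block β a b x‖ ≤ 2 * ‖x‖ := by
  have h1 := JT.norm_restr_le _ (orderConvex_chainIco β a b) x
  have h2 : ‖JT.segSum (chainIco β a b) x • nodeVec (leftExt β a)‖ ≤ ‖x‖ := by
    rw [norm_smul, Real.norm_eq_abs]
    exact (mul_le_of_le_one_right (abs_nonneg _) (norm_nodeVec_le _)).trans
      (JT.abs_segSum_le (isPiece_chainIco _ _ _) x)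
  refine (norm_sub_le _ _).trans ?_
  linarith

lemma segSum_restr (S : Finset Node) {A : Set Node} (hA : OrderConvex A) (hSA : ↑S ⊆ A) (x : JT) :
    JT.segSum S (JT.restr A hA x) = JT.segSum S x := by
  simp only [JT.segSum_apply, JT.toFun_restr]
  exact Finset.sum_congr rfl fun γ hγ => Set.indicator_of_mem (hSA hγ) _

lemma segSum_chainIco_block (β : Node) {a b : ℕ} (hab : a < b) (x : JT) :
    JT.segSum (chainIco β a b) (block β a b x) = 0 := by
  rw [block, map_sub, segSum_restr _ _ subset_rfl, map_smul, sum_single_eq, if_pos]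
  · simp
  · exact mem_chainIco.2 ⟨a, ⟨le_rfl, hab⟩, rfl⟩

lemma toFun_block_eq_zero (β : Node) {a b : ℕ} (hab : a < b) (x : JT) {γ : Node}
    (hγ : γ ∉ chainIco β a b) : (block β a b x).toFun γ = 0 := by
  have h1 : γ ≠ leftExt β a := by
    rintro rfl
    exact hγ (mem_chainIco.2 ⟨a, ⟨le_rfl, hab⟩, rfl⟩)
  simp [block, hγ, h1]

/-- Vectors with sum zero on successive parts of a chain satisfy an upper `2`-estimate. -/
lemma norm_sum_blocks_sq_le {β : Node} {m : ℕ → ℕ} (hm : StrictMono m) {y : ℕ → JT}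
    (hy : ∀ j, ∀ γ ∉ chainIco β (m j) (m (j + 1)), (y j).toFun γ = 0)
    (hy0 : ∀ j, JT.segSum (chainIco β (m j) (m (j + 1))) (y j) = 0) (N : ℕ) :
    ‖∑ j ∈ Finset.range N, y j‖ ^ 2 ≤ 2 * ∑ j ∈ Finset.range N, ‖y j‖ ^ 2 := by
  classical
  have := norm_sum_sq_le (K := 2) (Finset.range N) y fun S hS => by
    refine ⟨(Finset.range N).filter fun j => JT.segSum S (y j) ≠ 0, Finset.filter_subset _ _,
      Finset.card_le_two_of_no_middle fun i hi j hj k hk hij hjk => ?_, fun j hj hj' => ?_⟩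
    · have hmeet : ∀ l, JT.segSum S (y l) ≠ 0 →
          ∃ p, (m l ≤ p ∧ p < m (l + 1)) ∧ leftExt β p ∈ S := by
        intro l hl
        by_contra! h
        refine hl ?_
        rw [JT.segSum_apply]
        refine Finset.sum_eq_zero fun γ hγ => hy l γ fun hγ' => ?_
        obtain ⟨p, hp, rfl⟩ := mem_chainIco.1 hγ'
        exact h p hp hγ
      obtain ⟨p, hp, hpS⟩ := hmeet i (Finset.mem_filter.1 hi).2
      obtain ⟨q, hq, hqS⟩ := hmeet k (Finset.mem_filter.1 hk).2
      refine (Finset.mem_filter.1 hj).2 ?_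
      -- A segment meeting an earlier and a later block swallows the middle one, whose sum is zero.
      have hsub : chainIco β (m j) (m (j + 1)) ⊆ S := by
        intro γ hγ
        obtain ⟨r, hr, rfl⟩ := mem_chainIco.1 hγ
        have h1 : m (i + 1) ≤ m j := hm.monotone hij
        have h2 : m (j + 1) ≤ m k := hm.monotone hjk
        exact hS.isPiece.2 _ hpS _ hqS _ (leftExt_prefix_leftExt.2 (by omega))
          (leftExt_prefix_leftExt.2 (by omega))
      rw [← hy0 j, JT.segSum_apply, JT.segSum_apply]
      exact (Finset.sum_subset hsub fun γ _ hγ => hy j γ hγ).symm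
    · by_contra hne
      exact hj' (Finset.mem_filter.2 ⟨hj, hne⟩)
  simpa using this

/-- The part of `x` on the chain from position `m` on, shifted to have sum zero. -/
noncomputable def tailBlock (β : Node) (m : ℕ) : JT →L[ℝ] JT :=
  JT.restr _ (orderConvex_chainFrom β m) -
    (JT.chainSum (leftExt β m)).smulRight (nodeVec (leftExt β m))

lemma mem_chainFrom_leftExt {β : Node} (hβ : start β = β) {m i : ℕ} :
    leftExt β i ∈ chainFrom β m ↔ m ≤ i := by
  simp [chainFrom, hβ, trail_leftExt hβ]

lemma mem_chainFrom_iff {β : Node} (hβ : start β = β) {m : ℕ} {γ : Node} :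
    γ ∈ chainFrom β m ↔ ∃ i, m ≤ i ∧ leftExt β i = γ := by
  constructor
  · rintro ⟨h1, h2⟩
    exact ⟨trail γ, h2, by rw [← h1, leftExt_start_trail]⟩
  · rintro ⟨i, hi, rfl⟩
    exact (mem_chainFrom_leftExt hβ).2 hi

/-- A tail of the chain eventually avoids the finite set carrying almost all of the norm of x. Hence
tail blocks are limits of finite blocks. -/
lemma tendsto_restr_chainFrom (β : Node) (x : JT) :
    Tendsto (fun m => JT.restr _ (orderConvex_chainFrom β m) x) atTop (𝓝 0) := by
  refine tendsto_zero_iff_norm_tendsto_zero.2 (Metric.tendsto_atTop.2 fun ε hε => ?_)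
  obtain ⟨G, hG⟩ := JT.exists_finset_sum_norm_restr_sq_le x (pow_pos (half_pos hε) 2)
  refine ⟨G.sup trail + 1, fun m hm => ?_⟩
  have h := hG {[]} (fun _ => chainFrom β m) (fun _ => orderConvex_chainFrom β m) (by simp)
    fun _ _ => Set.disjoint_left.2 fun γ hγ hγ' => by
      have h1 : trail γ ≤ G.sup trail := Finset.le_sup (f := trail) hγ
      have h2 := hγ'.2
      omega
  rw [Finset.sum_singleton, sq_le_sq₀ (norm_nonneg _) (half_pos hε).le] at h
  simp only [dist_zero_right, norm_norm]
  linarith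

lemma tendsto_block {β : Node} (hβ : start β = β) (m : ℕ) (x : JT) :
    Tendsto (fun b => block β m b x) atTop (𝓝 (tailBlock β m x)) := by
  classical
  have h1 : Tendsto (fun b => JT.restr _ (orderConvex_chainIco β m b) x) atTop
      (𝓝 (JT.restr _ (orderConvex_chainFrom β m) x)) := by
    have := (tendsto_const_nhds (x := JT.restr _ (orderConvex_chainFrom β m) x)).sub
      (tendsto_restr_chainFrom β x)
    rw [sub_zero] at this
    refine this.congr' ?_
    filter_upwards [eventually_ge_atTop m] with b hb
    refine JT.ext fun γ => ?_
    simp only [JT.toFun_sub, Pi.sub_apply, JT.toFun_restr]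
    by_cases h : γ ∈ chainFrom β 0
    · obtain ⟨i, -, rfl⟩ := (mem_chainFrom_iff hβ).1 h
      have h3 : leftExt β i ∈ (chainIco β m b : Set Node) ↔ m ≤ i ∧ i < b := by
        rw [Finset.mem_coe, mem_chainIco]
        constructor
        · rintro ⟨j, hj, hij⟩
          rwa [← leftExt_injective β hij]
        · exact fun hi => ⟨i, hi, rfl⟩
      simp only [Set.indicator_apply, mem_chainFrom_leftExt hβ, h3]
      split_ifs <;> first | omega | simp
    · have h0 : ∀ k, γ ∉ chainFrom β k := fun k hk => h ⟨hk.1, Nat.zero_le _⟩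
      have h3 : γ ∉ (chainIco β m b : Set Node) := by
        intro h'
        obtain ⟨i, hi, rfl⟩ := mem_chainIco.1 (Finset.mem_coe.1 h')
        exact h0 m ((mem_chainFrom_leftExt hβ).2 hi.1)
      simp [Set.indicator_of_notMem, h0, h3]
  have h2 : Tendsto (fun b => JT.segSum (chainIco β m b) x) atTop
      (𝓝 (JT.chainSum (leftExt β m) x)) := by
    rw [JT.chainSum_leftExt]
    refine ((JT.tendsto_chainSum_range β x).sub_const _).congr' ?_
    filter_upwards [eventually_ge_atTop m] with b hb
    rw [JT.segSum_chainIco, Finset.sum_Ico_eq_sub _ hb]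
  exact h1.sub (h2.smul_const _)

/-- On a chain, functionals are uniformly small on far out vectors with sum zero. -/
lemma exists_norm_comp_tailBlock_le (ψ : StrongDual ℝ JT) {β : Node} (hβ : start β = β) {ε : ℝ}
    (hε : 0 < ε) : ∃ m, ‖ψ.comp (tailBlock β m)‖ ≤ ε := by
  by_contra! hcon
  have step : ∀ m, ∃ b, m < b ∧ ∃ x : JT, ‖x‖ ≤ 1 ∧ ε / 4 ≤ ψ (block β m b x) := by
    intro m
    obtain ⟨x, hx1, hx⟩ := exists_norm_le_one_half_norm_le (ψ.comp (tailBlock β m))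
    have hlt : ε / 4 < ψ (tailBlock β m x) := by
      have h1 : ‖ψ.comp (tailBlock β m)‖ / 2 ≤ ψ (tailBlock β m x) := hx
      have := hcon m
      linarith
    have hlim := (ψ.continuous.tendsto _).comp (tendsto_block hβ m x)
    obtain ⟨b, hb1, hb2⟩ := ((hlim.eventually (eventually_gt_nhds hlt)).and
      (eventually_gt_atTop m)).exists
    exact ⟨b, hb2, x, hx1, le_of_lt hb1⟩
  choose b hb x hx1 hx using step
  -- Successive blocks of norm at most 2 on which ψ is at least ε/4. Their sum over N blocks has
  -- squared norm at most 2 · 4N, too small for ψ to reach Nε/4 once N is large.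
  let m : ℕ → ℕ := fun j => b^[j] 0
  have hm1 : ∀ j, m (j + 1) = b (m j) := fun j => Function.iterate_succ_apply' b j 0
  have hm : StrictMono m := strictMono_nat_of_lt_succ fun j => by rw [hm1]; exact hb _
  have key : ∀ N : ℕ, (N * (ε / 4)) ^ 2 ≤ ‖ψ‖ ^ 2 * (8 * N) := by
    intro N
    have h1 := norm_sum_blocks_sq_le hm (y := fun j => block β (m j) (m (j + 1)) (x (m j)))
      (fun j γ hγ => toFun_block_eq_zero β (hm (Nat.lt_succ_self j)) _ hγ)
      (fun j => segSum_chainIco_block β (hm (Nat.lt_succ_self j)) _) N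
    have h2 : ∑ j ∈ Finset.range N, ‖block β (m j) (m (j + 1)) (x (m j))‖ ^ 2 ≤ N * 4 := by
      refine (Finset.sum_le_card_nsmul _ _ 4 fun j _ => ?_).trans (by simp)
      have h3 := (norm_block_le β (m j) (m (j + 1)) (x (m j)))
      have h4 := hx1 (m j)
      have h5 := norm_nonneg (block β (m j) (m (j + 1)) (x (m j)))
      nlinarith
    have h3 : N * (ε / 4) ≤ ψ (∑ j ∈ Finset.range N, block β (m j) (m (j + 1)) (x (m j))) := by
      rw [map_sum]
      refine le_trans (by simp) (Finset.card_nsmul_le_sum _ _ (ε / 4) fun j _ => ?_)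
      rw [hm1]
      exact hx (m j)
    have h4 := (h3.trans (le_abs_self _)).trans (ψ.le_opNorm _)
    calc (N * (ε / 4)) ^ 2 ≤
        (‖ψ‖ * ‖∑ j ∈ Finset.range N, block β (m j) (m (j + 1)) (x (m j))‖) ^ 2 :=
          pow_le_pow_left₀ (by positivity) h4 2
      _ ≤ ‖ψ‖ ^ 2 * (8 * N) := by
          rw [mul_pow]
          refine mul_le_mul_of_nonneg_left ?_ (sq_nonneg _)
          linarith
  obtain ⟨N, hN⟩ := exists_nat_gt (‖ψ‖ ^ 2 * 8 / (ε / 4) ^ 2)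
  rw [div_lt_iff₀ (by positivity)] at hN
  have hN0 : (0 : ℝ) < N := by
    rcases Nat.eq_zero_or_pos N with rfl | h
    · exact absurd hN (not_lt.2 (by simp))
    · exact_mod_cast h
  have := key N
  nlinarith

/-- The coordinate functionals and the sums along the chains. -/
def basicFunctionals : Set (StrongDual ℝ JT) :=
  Set.range JT.coord ∪ JT.chainSum '' {β | start β = β}

/-- On a chain, x is a finite head, plus its tail sum times the node vector at position m, plus a
tail block of sum zero. On the first two, ψ is a combination of coordinates and the chain sum; on
the third it is uniformly small for a suitable m. -/
lemma comp_restr_chain_mem (ψ : StrongDual ℝ JT) {β : Node} (hβ : start β = β) :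
    ψ.comp (JT.restr (chain β) (orderConvex_chain β)) ∈
      (Submodule.span ℝ basicFunctionals).topologicalClosure := by
  classical
  refine Metric.mem_closure_iff.2 fun ε hε => ?_
  obtain ⟨m, hm⟩ := exists_norm_comp_tailBlock_le ψ hβ (half_pos hε)
  have hcoord : ∀ α, JT.coord α ∈ Submodule.span ℝ basicFunctionals := fun α =>
    Submodule.subset_span (Or.inl ⟨α, rfl⟩)
  refine ⟨∑ i ∈ Finset.range m, ψ (nodeVec (leftExt β i)) • JT.coord (leftExt β i) +
    ψ (nodeVec (leftExt β m)) • (JT.chainSum β - ∑ i ∈ Finset.range m, JT.coord (leftExt β i)),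
    ?_, ?_⟩
  · refine Submodule.add_mem _ (Submodule.sum_mem _ fun i _ => Submodule.smul_mem _ _ (hcoord _))
      (Submodule.smul_mem _ _ (Submodule.sub_mem _ (Submodule.subset_span (Or.inr ⟨β, hβ, rfl⟩))
        (Submodule.sum_mem _ fun i _ => hcoord _)))
  · rw [dist_eq_norm]
    refine lt_of_le_of_lt (le_trans (le_of_eq ?_) hm) (half_lt_self hε)
    congr 1
    ext x
    have hx : JT.restr (chain β) (orderConvex_chain β) x =
        ∑ i ∈ Finset.range m, x.toFun (leftExt β i) • nodeVec (leftExt β i) +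
          JT.restr _ (orderConvex_chainFrom β m) x := by
      refine JT.ext fun γ => ?_
      simp only [JT.toFun_add, Pi.add_apply, JT.toFun_restr, JT.toFun_sum, JT.toFun_smul,
        Pi.smul_apply, toFun_nodeVec, smul_eq_mul]
      by_cases h : γ ∈ chain β
      · rw [← chainFrom_zero] at h
        obtain ⟨j, -, rfl⟩ := (mem_chainFrom_iff hβ).1 h
        rw [Set.indicator_of_mem (JT.mem_chain_leftExt hβ j)]
        simp only [Pi.single_apply, (leftExt_injective β).eq_iff, Set.indicator_apply,
          mem_chainFrom_leftExt hβ, mul_ite, mul_one, mul_zero, Finset.sum_ite_eq,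
          Finset.mem_range]
        split_ifs <;> first | omega | simp
      · have h1 : γ ∉ chainFrom β m := fun h' => h h'.1
        rw [Set.indicator_of_notMem h, Set.indicator_of_notMem h1, add_zero]
        refine (Finset.sum_eq_zero fun i _ => ?_).symm
        have : γ ≠ leftExt β i := by
          rintro rfl
          exact h (JT.mem_chain_leftExt hβ i)
        simp [this]
    simp only [sub_apply, add_apply,
      ContinuousLinearMap.comp_apply, sum_apply, tailBlock,
      ContinuousLinearMap.smulRight_apply, hx, map_add, map_sub, map_sum, map_smul, smul_eq_mul,
      JT.chainSum_leftExt, smul_apply, JT.coord_apply]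
    have : ∀ i, x.toFun (leftExt β i) * ψ (nodeVec (leftExt β i)) =
      ψ (nodeVec (leftExt β i)) * x.toFun (leftExt β i) := fun i => mul_comm _ _
    simp only [this]
    ring

end JamesTree
open Filter Topology

/-! ### Weak topology: total sets of functionals and weakly compact operators -/

section WeakTopology

variable {E F : Type*} [NormedAddCommGroup E] [NormedSpace ℝ E]
  [NormedAddCommGroup F] [NormedSpace ℝ F]

lemma comp_mem_closure_span (L : E →L[ℝ] F) {B : Set (StrongDual ℝ F)} {φ : StrongDual ℝ F}
    (hφ : φ ∈ (Submodule.span ℝ B).topologicalClosure) :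
    φ.comp L ∈ (Submodule.span ℝ ((fun f : StrongDual ℝ F => f.comp L) '' B)).topologicalClosure := by
  let T : StrongDual ℝ F →L[ℝ] StrongDual ℝ E := ContinuousLinearMap.precomp ℝ L
  suffices h : Set.MapsTo T (Submodule.span ℝ B)
      (Submodule.span ℝ ((fun f : StrongDual ℝ F => f.comp L) '' B)) by
    have hT : T φ ∈ closure _ := map_mem_closure T.continuous hφ h
    exact hT
  intro f hf
  have : Submodule.map T.toLinearMap (Submodule.span ℝ B) =
      Submodule.span ℝ ((fun f : StrongDual ℝ F => f.comp L) '' B) := by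
    rw [Submodule.map_span]
    rfl
  exact this ▸ ⟨f, hf, rfl⟩

lemma continuous_toWeakSpace_eval (φ : StrongDual ℝ E) :
    Continuous fun x : WeakSpace ℝ E => φ ((toWeakSpace ℝ E).symm x) :=
  WeakBilin.eval_continuous (topDualPairing ℝ E).flip φ

lemma continuous_toWeakSpace_of_forall {K : Type*} [TopologicalSpace K] {Θ : K → E}
    (h : ∀ φ : StrongDual ℝ E, Continuous fun k => φ (Θ k)) :
    Continuous fun k => toWeakSpace ℝ E (Θ k) :=
  WeakBilin.continuous_of_continuous_eval (topDualPairing ℝ E).flip h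

lemma tendsto_toWeakSpace_of_forall {ι : Type*} {l : Filter ι} {Θ : ι → E} {x : E}
    (h : ∀ φ : StrongDual ℝ E, Tendsto (fun k => φ (Θ k)) l (𝓝 (φ x))) :
    Tendsto (fun k => toWeakSpace ℝ E (Θ k)) l (𝓝 (toWeakSpace ℝ E x)) :=
  (WeakBilin.tendsto_iff_forall_eval_tendsto (topDualPairing ℝ E).flip
    (by
      intro x y hxy
      by_contra hne
      obtain ⟨f, hf⟩ := SeparatingDual.exists_separating_of_ne (R := ℝ) hne
      exact hf (DFunLike.congr_fun hxy f))).2 h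

lemma IsWeaklyCompact.exists_norm_le {D : Set E} (hD : IsWeaklyCompact D) :
    ∃ M, 0 ≤ M ∧ ∀ x ∈ D, ‖x‖ ≤ M := by
  obtain ⟨M, hM⟩ := banach_steinhaus
    (g := fun x : D => NormedSpace.inclusionInDoubleDual ℝ E x.1) fun φ => by
    obtain ⟨C, hC⟩ := (IsCompact.image hD (continuous_toWeakSpace_eval φ)).isBounded.exists_norm_le
    exact ⟨C, fun x => hC _ ⟨_, ⟨x.1, x.2, rfl⟩, rfl⟩⟩
  refine ⟨max M 0, le_max_right _ _, fun x hx => ?_⟩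
  refine le_trans (le_of_eq ?_) ((hM ⟨x, hx⟩).trans (le_max_left _ _))
  exact ((NormedSpace.inclusionInDoubleDualLi ℝ (E := E)).norm_map x).symm

/-- An operator is weakly compact if it maps the unit ball into the range of a bounded map on a
compact space that is continuous when tested against a total set of functionals. -/
lemma isWeaklyCompactOperator_of_continuous {V : E →L[ℝ] E} {B : Set (StrongDual ℝ E)}
    (hB : (Submodule.span ℝ B).topologicalClosure = ⊤) {K : Type*} [TopologicalSpace K]
    [CompactSpace K] (Θ : K → E) {M : ℝ} (hΘ : ∀ k, ‖Θ k‖ ≤ M)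
    (hV : ∀ x, ‖x‖ ≤ 1 → ∃ k, Θ k = V x) (hc : ∀ φ ∈ B, Continuous fun k => φ (Θ k)) :
    IsWeaklyCompactOperator V := by
  have hspan : ∀ φ ∈ Submodule.span ℝ B, Continuous fun k => φ (Θ k) := by
    intro φ hφ
    induction hφ using Submodule.span_induction with
    | mem φ h => exact hc φ h
    | zero => exact continuous_const
    | add φ ψ _ _ h1 h2 => exact h1.add h2
    | smul a φ _ h => exact continuous_const.mul h
  have hall : ∀ φ : StrongDual ℝ E, Continuous fun k => φ (Θ k) := by
    intro φ
    have hφ : φ ∈ (Submodule.span ℝ B).topologicalClosure := hB ▸ Submodule.mem_top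
    refine continuous_of_uniform_approx_of_continuous fun u hu => ?_
    obtain ⟨ε, hε, hu⟩ := Metric.mem_uniformity_dist.1 hu
    obtain ⟨ψ, hψ, hd⟩ := Metric.mem_closure_iff.1 hφ (ε / (|M| + 1)) (by positivity)
    refine ⟨_, hspan ψ hψ, fun k => hu ?_⟩
    rw [dist_eq_norm] at hd ⊢
    calc ‖φ (Θ k) - ψ (Θ k)‖ = ‖(φ - ψ) (Θ k)‖ := rfl
      _ ≤ ‖φ - ψ‖ * (|M| + 1) := by
        refine ((φ - ψ).le_opNorm _).trans (mul_le_mul_of_nonneg_left ?_ (norm_nonneg _))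
        have := hΘ k
        have := le_abs_self M
        linarith
      _ < ε := by rwa [← lt_div_iff₀ (by positivity)]
  refine (isCompact_range (continuous_toWeakSpace_of_forall hall)).closure_of_subset ?_
  rintro _ ⟨_, ⟨x, hx, rfl⟩, rfl⟩
  obtain ⟨k, hk⟩ := hV x (by simpa using hx)
  exact ⟨k, by rw [← hk]⟩

end WeakTopology

namespace JamesTree

/-! ### The spaces `X n`, continued -/

/-- The norm-one projection of `JT` onto `X n`. -/
noncomputable def proj (n : ℕ) : JT →L[ℝ] X n :=
  (JT.restr (subtree n) (orderConvex_subtree n)).codRestrict (X n) fun x => mem_X fun α hα => by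
    rw [JT.toFun_restr]
    exact Set.indicator_of_notMem (show α ∉ subtree n from not_le.2 hα) _

lemma norm_proj_le (n : ℕ) (x : JT) : ‖proj n x‖ ≤ ‖x‖ :=
  JT.norm_restr_le _ (orderConvex_subtree n) x

lemma proj_coe {n : ℕ} (x : X n) : proj n x = x := by
  refine Subtype.ext (JT.ext fun α => ?_)
  change (subtree n).indicator x.1.toFun α = x.1.toFun α
  by_cases h : α ∈ subtree n
  · rw [Set.indicator_of_mem h]
  · rw [Set.indicator_of_notMem h, toFun_eq_zero_of_mem x.2 (not_le.1 h)]

/-- The restriction to a chain, as an operator on `X n`. -/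
noncomputable def chainPart (n : ℕ) (β : Node) : X n →L[ℝ] X n :=
  ((JT.restr (chain β) (orderConvex_chain β)).comp (X n).subtypeL).codRestrict (X n) fun x =>
    mem_X fun α hα => by
      simp [Set.indicator_apply_eq_zero.2 fun _ => toFun_eq_zero_of_mem x.2 hα]

@[simp] lemma coe_chainPart (n : ℕ) (β : Node) (x : X n) :
    (chainPart n β x : JT) = JT.restr (chain β) (orderConvex_chain β) x := rfl

lemma restr_restr_chain (β β' : Node) (x : JT) :
    JT.restr (chain β) (orderConvex_chain β) (JT.restr (chain β') (orderConvex_chain β') x) =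
      if β = β' then JT.restr (chain β) (orderConvex_chain β) x else 0 := by
  refine JT.ext fun α => ?_
  split_ifs with h
  · subst h
    simp [Set.indicator_indicator]
  · simp [Set.indicator_indicator, (disjoint_chain h).inter_eq]

lemma norm_sum_restr_chain_sq_le {n : ℕ} (s : Finset Node) {x : Node → JT}
    (hx : ∀ β, ∀ α, n < rightTurns α → (x β).toFun α = 0) :
    ‖∑ β ∈ s, JT.restr (chain β) (orderConvex_chain β) (x β)‖ ^ 2 ≤
      (n + 1) * ∑ β ∈ s, ‖JT.restr (chain β) (orderConvex_chain β) (x β)‖ ^ 2 := by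
  refine norm_sq_le_sum_chains (n := n) (fun α hα => ?_) fun t => ?_
  · rw [JT.toFun_sum]
    exact Finset.sum_eq_zero fun β _ => Set.indicator_apply_eq_zero.2 fun _ => hx β α hα
  · have h : ∀ β, ‖JT.restr (chain β) (orderConvex_chain β)
        (∑ β' ∈ s, JT.restr (chain β') (orderConvex_chain β') (x β'))‖ ^ 2 =
        if β ∈ s then ‖JT.restr (chain β) (orderConvex_chain β) (x β)‖ ^ 2 else 0 := by
      intro β
      simp only [map_sum, restr_restr_chain, Finset.sum_ite_eq]
      split_ifs <;> simp
    simp only [h]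
    rw [← Finset.sum_filter]
    exact Finset.sum_le_sum_of_subset_of_nonneg (fun β hβ => (Finset.mem_filter.1 hβ).2)
      fun _ _ _ => sq_nonneg _

/-- The coordinate functionals and the sums along the chains, on `X n`. -/
def basicFunctionalsX (n : ℕ) : Set (StrongDual ℝ (X n)) :=
  (fun φ : StrongDual ℝ JT => φ.comp (X n).subtypeL) '' basicFunctionals

/-- The chains decompose X_n with both 2-estimates, so a functional is approximated by sums of its
parts on single chains, and these are covered by the one-chain result. -/
lemma closure_span_basicFunctionalsX (n : ℕ) :
    (Submodule.span ℝ (basicFunctionalsX n)).topologicalClosure = ⊤ := by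
  refine eq_top_iff.2 fun ψ _ => ?_
  have hψ := mem_closure_span_comp_of_decomposition (chainPart n) (K := n + 1) (by positivity)
    (fun β x => Subtype.ext (by simp [restr_restr_chain]))
    (fun s x => by
      have := norm_sum_restr_chain_sq_le (n := n) s (x := fun β => (x β : JT))
        fun β α hα => toFun_eq_zero_of_mem (x β).2 hα
      simpa only [← coe_chainPart, ← Submodule.coe_sum, Submodule.coe_norm] using this)
    (fun s x => by
      have := JT.sum_norm_restr_sq_le (x : JT) s chain orderConvex_chain
        fun i _ j _ hij => disjoint_chain hij
      simpa only [← coe_chainPart, Submodule.coe_norm] using this)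
    (fun x => by
      have := hasSum_restr_chain (n := n) fun α hα => toFun_eq_zero_of_mem x.2 hα
      exact (Topology.IsInducing.subtypeVal.hasSum_iff (g := (X n).subtype) _ _).1 this) ψ
  refine Submodule.topologicalClosure_minimal _ (Submodule.span_le.2 ?_)
    (Submodule.isClosed_topologicalClosure _) hψ
  rintro _ ⟨β, rfl⟩
  -- Extending ψ to JT through the projection makes the result for single chains in JT applicable.
  have hrw : ψ.comp (chainPart n β) = ((ψ.comp (proj n)).comp
      (JT.restr (chain β) (orderConvex_chain β))).comp (X n).subtypeL := by
    ext x
    change ψ _ = ψ (proj n (chainPart n β x : JT))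
    rw [proj_coe]
    rfl
  change ψ.comp (chainPart n β) ∈ _
  by_cases hβ : start β = β
  · rw [hrw]
    exact comp_mem_closure_span _ (comp_restr_chain_mem _ hβ)
  · have h0 : chainPart n β = 0 := by
      refine ContinuousLinearMap.ext fun x => Subtype.ext (JT.ext fun α => ?_)
      have : α ∉ chain β := by
        rintro rfl
        exact hβ (start_start α)
      change (chain β).indicator x.1.toFun α = 0
      rw [Set.indicator_of_notMem this]
    rw [h0, ContinuousLinearMap.comp_zero]
    exact Submodule.zero_mem _

/-- The unit ball of `X n`, as a set of functions on the tree. -/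
def ballFunctions (n : ℕ) : Set (Node → ℝ) :=
  {g | (∀ F, IsDisjointFamily F → ∑ S ∈ F, (∑ γ ∈ S, g γ) ^ 2 ≤ 1) ∧
    ∀ α, n < rightTurns α → g α = 0}

/-- Each norm condition involves finitely many coordinates, so the ball is pointwise closed in a
product of intervals. -/
lemma isCompact_ballFunctions (n : ℕ) : IsCompact (ballFunctions n) := by
  refine (isCompact_univ_pi fun _ : Node => isCompact_Icc (a := (-1 : ℝ)) (b := 1)).of_isClosed_subset
    ?_ fun g hg α _ => ?_
  · have h : ballFunctions n =
        (⋂ F, ⋂ (_ : IsDisjointFamily F), {g | ∑ S ∈ F, (∑ γ ∈ S, g γ) ^ 2 ≤ 1}) ∩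
          ⋂ α, ⋂ (_ : n < rightTurns α), {g : Node → ℝ | g α = 0} := by
      ext g
      simp [ballFunctions]
    rw [h]
    refine IsClosed.inter ?_ ?_
    · exact isClosed_iInter fun F => isClosed_iInter fun _ =>
        isClosed_le (by fun_prop) continuous_const
    · exact isClosed_iInter fun α => isClosed_iInter fun _ =>
        isClosed_eq (continuous_apply α) continuous_const
  · have := hg.1 _ (JT.isDisjointFamily_singleton α)
    simp only [Finset.sum_singleton, sq_le_one_iff_abs_le_one, abs_le] at this
    exact this

/-- The element of `X n` given by a function in the unit ball. -/
noncomputable def ofBall {n : ℕ} (g : ballFunctions n) : X n :=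
  ⟨JT.mk g.1 1 g.2.1, mem_X g.2.2⟩

lemma norm_ofBall_le {n : ℕ} (g : ballFunctions n) : ‖ofBall g‖ ≤ 1 := by
  rw [← sq_le_sq₀ (norm_nonneg _) zero_le_one, one_pow]
  exact JT.norm_sq_le g.2.1

lemma exists_ofBall {n : ℕ} {x : X n} (hx : ‖x‖ ≤ 1) : ∃ g, ofBall g = x := by
  refine ⟨⟨x.1.toFun, fun F hF => ?_, fun α hα => toFun_eq_zero_of_mem x.2 hα⟩, rfl⟩
  exact (JT.sum_family_le x.1 hF).trans (pow_le_one₀ (norm_nonneg _) hx)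

/-- Criterion for weak compactness of operators on `X n`. -/
lemma isWeaklyCompactOperator_X {n : ℕ} {V : X n →L[ℝ] X n}
    (hcoord : ∀ α, Continuous fun g : ballFunctions n => (V (ofBall g)).1.toFun α)
    (hchain : ∀ β, start β = β →
      Continuous fun g : ballFunctions n => JT.chainSum β (V (ofBall g)).1) :
    IsWeaklyCompactOperator V := by
  have : CompactSpace (ballFunctions n) := isCompact_iff_compactSpace.1 (isCompact_ballFunctions n)
  refine isWeaklyCompactOperator_of_continuous (closure_span_basicFunctionalsX n)
    (fun g : ballFunctions n => V (ofBall g)) (M := ‖V‖) (fun g => ?_) (fun x hx => ?_) ?_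
  · exact (V.le_opNorm _).trans (mul_le_of_le_one_right (norm_nonneg _) (norm_ofBall_le g))
  · obtain ⟨g, rfl⟩ := exists_ofBall hx
    exact ⟨g, rfl⟩
  · rintro _ ⟨φ, ⟨α, rfl⟩ | ⟨β, hβ, rfl⟩, rfl⟩
    · exact hcoord α
    · exact hchain β hβ

end JamesTree
open Filter Topology

/-! ### Uniformly small averages on weakly compact sets -/

/-- A pointwise null sequence of functionals of bounded quadratic variation has averages that are
uniformly small on a given weakly compact set. -/
lemma IsWeaklyCompact.exists_average_le {E : Type*} [NormedAddCommGroup E] [NormedSpace ℝ E]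
    {D : Set E} (hD : IsWeaklyCompact D) (τ : ℕ → StrongDual ℝ E)
    (hτ : ∀ x, Tendsto (fun k => τ k x) atTop (𝓝 0))
    (hvar : ∀ x (N : ℕ) (p q : ℕ → ℕ), (∀ r, p r ≤ q r ∧ q r ≤ p (r + 1)) →
      ∑ r ∈ Finset.range N, (τ (p r) x - τ (q r) x) ^ 2 ≤ ‖x‖ ^ 2)
    (a : ℕ) {ε : ℝ} (hε : 0 < ε) :
    ∃ K : Finset ℕ, K.Nonempty ∧ (∀ k ∈ K, a ≤ k) ∧
      ∀ x ∈ D, |(K.card : ℝ)⁻¹ * ∑ k ∈ K, τ k x| ≤ ε := by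
  obtain ⟨M, hM0, hM⟩ := hD.exists_norm_le
  -- Weak compactness: finitely many indices beyond a suffice for every x in D to have a small value
  -- at one of them.
  have window : ∀ a : ℕ, ∃ b, a < b ∧ ∀ x ∈ D, ∃ i, a ≤ i ∧ i < b ∧ |τ i x| < ε / 2 := by
    intro a
    obtain ⟨t, ht⟩ := IsCompact.elim_finite_subcover hD
      (fun i : ℕ => {x : WeakSpace ℝ E | a ≤ i ∧ |τ i ((toWeakSpace ℝ E).symm x)| < ε / 2})
      (fun i => by
        by_cases h : a ≤ i
        · simpa [h] using isOpen_lt (continuous_toWeakSpace_eval (τ i)).abs continuous_const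
        · simp [h])
      (by
        rintro _ ⟨x, hx, rfl⟩
        have h1 : Tendsto (fun k => |τ k x|) atTop (𝓝 0) := by simpa using (hτ x).abs
        obtain ⟨i, hi, hi'⟩ := ((h1.eventually (eventually_lt_nhds (half_pos hε))).and
          (eventually_ge_atTop a)).exists
        exact Set.mem_iUnion.2 ⟨i, hi', hi⟩)
    refine ⟨max a (t.sup id) + 1, by omega, fun x hx => ?_⟩
    obtain ⟨i, hi⟩ := Set.mem_iUnion.1 (ht ⟨x, hx, rfl⟩)
    obtain ⟨hit, h1, h2⟩ := Set.mem_iUnion.1 hi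
    have : i ≤ t.sup id := Finset.le_sup (f := id) hit
    exact ⟨i, h1, by omega, h2⟩
  choose b hb hbD using window
  let p : ℕ → ℕ := fun r => b^[r] a
  have hp1 : ∀ r, p (r + 1) = b (p r) := fun r => Function.iterate_succ_apply' b r a
  have hp : StrictMono p := strictMono_nat_of_lt_succ fun r => by rw [hp1]; exact hb _
  -- The average runs over the left ends of N windows. By Cauchy–Schwarz, moving from the left ends
  -- to the good indices `q r` costs at most √N · M ≤ N · ε/2 in total.
  obtain ⟨N, hN⟩ := exists_nat_gt (M ^ 2 / (ε / 2) ^ 2)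
  have hN0 : (0 : ℝ) < N := lt_of_le_of_lt (by positivity) hN
  rw [div_lt_iff₀ (by positivity)] at hN
  refine ⟨(Finset.range N).image p, ?_, ?_, fun x hx => ?_⟩
  · rw [Finset.image_nonempty, Finset.nonempty_range_iff]
    rintro rfl
    simp at hN0
  · intro k hk
    obtain ⟨r, -, rfl⟩ := Finset.mem_image.1 hk
    exact hp.monotone (Nat.zero_le r)
  · rw [Finset.card_image_of_injective _ hp.injective, Finset.card_range,
      Finset.sum_image fun _ _ _ _ h => hp.injective h, abs_mul, abs_inv, abs_of_pos hN0,
      inv_mul_le_iff₀ hN0]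
    choose q hq1 hq2 hq3 using fun r => hbD (p r) x hx
    have hv := hvar x N p q fun r => ⟨hq1 r, by rw [hp1]; exact (hq2 r).le⟩
    have hd : ∑ r ∈ Finset.range N, |τ (p r) x - τ (q r) x| ≤ N * (ε / 2) := by
      rw [← sq_le_sq₀ (Finset.sum_nonneg fun _ _ => abs_nonneg _) (by positivity)]
      refine sq_sum_le_card_mul_sum_sq.trans ?_
      simp only [sq_abs, Finset.card_range]
      have hx2 : ‖x‖ ^ 2 ≤ M ^ 2 := pow_le_pow_left₀ (norm_nonneg _) (hM x hx) 2
      nlinarith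
    calc |∑ r ∈ Finset.range N, τ (p r) x| ≤
        ∑ r ∈ Finset.range N, (ε / 2 + |τ (p r) x - τ (q r) x|) := by
          refine (Finset.abs_sum_le_sum_abs _ _).trans (Finset.sum_le_sum fun r _ => ?_)
          have h1 := (hq3 r).le
          have h2 : τ (p r) x = τ (q r) x + (τ (p r) x - τ (q r) x) := by ring
          calc |τ (p r) x| = |τ (q r) x + (τ (p r) x - τ (q r) x)| := by rw [← h2]
            _ ≤ |τ (q r) x| + |τ (p r) x - τ (q r) x| := abs_add_le _ _
            _ ≤ _ := by linarith
      _ ≤ N * ε := by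
          rw [Finset.sum_add_distrib, Finset.sum_const, Finset.card_range, nsmul_eq_mul]
          linarith

namespace JamesTree

/-! ### Weakly compact approximation in `X n` -/

/-- The norm of JT is dominated by the ℓ¹-norm, so summable coordinatewise errors are enough to
control an operator on a weakly compact set. -/
lemma JT.norm_le_of_hasSum {x : JT} {e : Node → ℝ} {c : ℝ} (he : HasSum e c)
    (hx : ∀ α, |x.toFun α| ≤ e α) : ‖x‖ ≤ c := by
  classical
  have he0 : ∀ α, 0 ≤ e α := fun α => (abs_nonneg _).trans (hx α)
  have hc : 0 ≤ c := he.nonneg he0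
  rw [← sq_le_sq₀ (norm_nonneg _) hc]
  refine norm_sq_le fun F hF => ?_
  calc ∑ S ∈ F, (∑ γ ∈ S, x.toFun γ) ^ 2 ≤ ∑ S ∈ F, (∑ γ ∈ S, e γ) ^ 2 := by
        refine Finset.sum_le_sum fun S _ => sq_le_sq' ?_ ?_
        · rw [← Finset.sum_neg_distrib]
          exact Finset.sum_le_sum fun γ _ => (abs_le.1 (hx γ)).1
        · exact Finset.sum_le_sum fun γ _ => (abs_le.1 (hx γ)).2
    _ ≤ (∑ S ∈ F, ∑ γ ∈ S, e γ) ^ 2 :=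
        Finset.sum_sq_le_sq_sum_of_nonneg fun S _ => Finset.sum_nonneg fun γ _ => he0 γ
    _ ≤ c ^ 2 := by
        refine pow_le_pow_left₀ (Finset.sum_nonneg fun S _ => Finset.sum_nonneg fun γ _ => he0 γ)
          ?_ 2
        have := Finset.sum_biUnion (f := e) (s := F) (t := id) fun S hS T hT h => hF.2 S hS T hT h
        simp only [id] at this
        rw [← this]
        exact sum_le_hasSum _ (fun α _ => he0 α) he

lemma IsPiece.exists_eq_chainIco {S : Finset Node} (hS : IsPiece S) {β : Node}
    (hSβ : ↑S ⊆ chain β) : ∃ a b, a ≤ b ∧ S = chainIco β a b := by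
  rcases S.eq_empty_or_nonempty with rfl | hne
  · exact ⟨0, 0, le_rfl, by simp [chainIco]⟩
  obtain ⟨α, α', -, h⟩ := hS.isSegment hne
  obtain ⟨γ, hγ⟩ := hne
  have hαα' : α <+: α' := ((h γ).1 hγ).1.trans ((h γ).1 hγ).2
  have hα : start α = β := hSβ ((h α).2 ⟨List.prefix_rfl, hαα'⟩)
  have hα' : start α' = β := hSβ ((h α').2 ⟨hαα', List.prefix_rfl⟩)
  rw [← leftExt_start_trail α, ← leftExt_start_trail α', hα, hα'] at hαα' h
  rw [leftExt_prefix_leftExt] at hαα'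
  refine ⟨trail α, trail α' + 1, by omega, Finset.ext fun δ => ?_⟩
  rw [h, mem_chainIco]
  constructor
  · rintro ⟨h1, h2⟩
    obtain ⟨i, hi, rfl⟩ := exists_eq_leftExt ((prefix_leftExt _ _).trans h1) h2
    exact ⟨i, ⟨leftExt_prefix_leftExt.1 h1, by omega⟩, rfl⟩
  · rintro ⟨i, hi, rfl⟩
    exact ⟨leftExt_prefix_leftExt.2 hi.1, leftExt_prefix_leftExt.2 (by omega)⟩

lemma disjoint_chainIco_iff {β : Node} {a b c d : ℕ} :
    Disjoint (chainIco β a b) (chainIco β c d) ↔ ∀ i, a ≤ i → i < b → c ≤ i → i < d → False := by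
  rw [Finset.disjoint_left]
  constructor
  · intro h i h1 h2 h3 h4
    exact h (mem_chainIco.2 ⟨i, ⟨h1, h2⟩, rfl⟩) (mem_chainIco.2 ⟨i, ⟨h3, h4⟩, rfl⟩)
  · intro h γ h1 h2
    obtain ⟨i, hi, rfl⟩ := mem_chainIco.1 h1
    obtain ⟨j, hj, hij⟩ := mem_chainIco.1 h2
    obtain rfl := leftExt_injective β hij
    exact h j hi.1 hi.2 hj.1 hj.2

/-- Successive finite sets of positions. -/
structure IsSuccessive (K : ℕ → Finset ℕ) : Prop where
  nonempty : ∀ j, (K j).Nonempty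
  lt : ∀ j, ∀ k ∈ K j, ∀ l ∈ K (j + 1), k < l
  ge : ∀ j, ∀ k ∈ K j, j ≤ k

/-- The average over `k ∈ K` of the `k`-th partial sums along the chain from `β`. -/
noncomputable def avgSum (β : Node) (K : Finset ℕ) : StrongDual ℝ JT :=
  (K.card : ℝ)⁻¹ • ∑ k ∈ K, JT.segSum (chainIco β 0 k)

lemma avgSum_apply (β : Node) (K : Finset ℕ) (x : JT) :
    avgSum β K x = (K.card : ℝ)⁻¹ * ∑ k ∈ K, JT.segSum (chainIco β 0 k) x := by
  simp [avgSum]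

lemma tendsto_avgSum (β : Node) {K : ℕ → Finset ℕ} (hK : IsSuccessive K) (x : JT) :
    Tendsto (fun j => avgSum β (K j) x) atTop (𝓝 (JT.chainSum β x)) := by
  refine Metric.tendsto_atTop.2 fun ε hε => ?_
  obtain ⟨N, hN⟩ := Metric.tendsto_atTop.1 (JT.tendsto_chainSum β x) ε hε
  refine ⟨N, fun j hj => ?_⟩
  have hmem := (convex_ball (JT.chainSum β x) ε).sum_mem (t := K j)
    (w := fun _ => ((K j).card : ℝ)⁻¹) (z := fun k => JT.segSum (chainIco β 0 k) x)
    (fun _ _ => by positivity)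
    (by
      rw [Finset.sum_const, nsmul_eq_mul]
      exact mul_inv_cancel₀ (by exact_mod_cast (hK.nonempty j).card_pos.ne'))
    (fun k hk => hN k (hj.trans (hK.ge j k hk)))
  rw [← Finset.smul_sum, smul_eq_mul, ← avgSum_apply] at hmem
  exact hmem

/-- The differences of successive averaged partial sums along the chains. -/
noncomputable def avgDiff (K : Node → ℕ → Finset ℕ) (x : JT) (α : Node) : ℝ :=
  avgSum (start α) (K (start α) (trail α + 1)) x - avgSum (start α) (K (start α) (trail α)) x

lemma sum_chainIco_avgDiff (K : Node → ℕ → Finset ℕ) (x : JT) {β : Node} (hβ : start β = β)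
    {a b : ℕ} (hab : a ≤ b) :
    ∑ γ ∈ chainIco β a b, avgDiff K x γ = avgSum β (K β b) x - avgSum β (K β a) x := by
  rw [sum_chainIco]
  simp only [avgDiff, start_leftExt, hβ, trail_leftExt hβ]
  rw [Finset.sum_Ico_eq_sub _ hab, Finset.sum_range_sub fun i => avgSum β (K β i) x,
    Finset.sum_range_sub fun i => avgSum β (K β i) x]
  ring

/-- Averaging positions does not increase the quadratic variation. -/
lemma sum_sq_avgSum_sub_le {κ : Type*} {β : Node} {K : ℕ → Finset ℕ} (hK : IsSuccessive K)
    (x : JT) (s : Finset κ) (a b : κ → ℕ) (hab : ∀ i ∈ s, a i ≤ b i)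
    (hd : ∀ i ∈ s, ∀ j ∈ s, i ≠ j → Disjoint (chainIco β (a i) (b i)) (chainIco β (a j) (b j))) :
    ∑ i ∈ s, (avgSum β (K (b i)) x - avgSum β (K (a i)) x) ^ 2 ≤ ‖x‖ ^ 2 := by
  set N := s.sup b + 1
  have hbN : ∀ i ∈ s, b i < N := fun i hi => Nat.lt_succ_of_le (Finset.le_sup hi)
  let ext : (Fin N → ℝ) → ℕ → ℝ := fun u j => if h : j < N then u ⟨j, h⟩ else 0
  -- Quadratic variation is convex in the tuple of values, so a bound for tuples of true partial
  -- sums passes to averages. `ext` pads by 0 beyond N, but all indices used are below N.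
  let C : Set (Fin N → ℝ) := {u | ∑ i ∈ s, (ext u (b i) - ext u (a i)) ^ 2 ≤ ‖x‖ ^ 2}
  have hext : ∀ (p q : ℝ) (u v : Fin N → ℝ) j, ext (p • u + q • v) j = p * ext u j + q * ext v j := by
    intro p q u v j
    simp only [ext]
    split_ifs <;> simp
  have hC : Convex ℝ C := by
    intro u hu v hv p q hp hq hpq
    change ∑ i ∈ s, (ext (p • u + q • v) (b i) - ext (p • u + q • v) (a i)) ^ 2 ≤ ‖x‖ ^ 2
    calc ∑ i ∈ s, (ext (p • u + q • v) (b i) - ext (p • u + q • v) (a i)) ^ 2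
        ≤ ∑ i ∈ s, (p * (ext u (b i) - ext u (a i)) ^ 2 +
            q * (ext v (b i) - ext v (a i)) ^ 2) := by
          refine Finset.sum_le_sum fun i _ => ?_
          rw [hext, hext]
          obtain rfl : q = 1 - p := by linarith
          nlinarith [mul_nonneg (mul_nonneg hp hq)
            (sq_nonneg ((ext u (b i) - ext u (a i)) - (ext v (b i) - ext v (a i))))]
      _ ≤ p * ‖x‖ ^ 2 + q * ‖x‖ ^ 2 := by
          rw [Finset.sum_add_distrib, ← Finset.mul_sum, ← Finset.mul_sum]
          exact add_le_add (mul_le_mul_of_nonneg_left hu hp) (mul_le_mul_of_nonneg_left hv hq)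
      _ = ‖x‖ ^ 2 := by rw [← add_mul, hpq, one_mul]
  let P : Fin N → Set ℝ := fun j => (fun k => JT.segSum (chainIco β 0 k) x) '' K j
  -- One position from each K j: successiveness makes the choice monotone, so disjoint index
  -- intervals become disjoint pieces of the chain.
  have hPC : Set.univ.pi P ⊆ C := by
    intro u hu
    choose k hkK hku using fun j => hu j (Set.mem_univ j)
    let k' : ℕ → ℕ := fun j => if h : j < N then k ⟨j, h⟩ else 0
    have hk' : ∀ j < N, k' j ∈ K j ∧ ext u j = JT.segSum (chainIco β 0 (k' j)) x := by
      intro j hj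
      have h1 : k' j = k ⟨j, hj⟩ := dif_pos hj
      have h2 : ext u j = u ⟨j, hj⟩ := dif_pos hj
      rw [h1, h2]
      exact ⟨hkK ⟨j, hj⟩, (hku ⟨j, hj⟩).symm⟩
    have hmono : ∀ i j, i ≤ j → j < N → k' i ≤ k' j := by
      intro i j hij
      induction j, hij using Nat.le_induction with
      | base => exact fun _ => le_rfl
      | succ j hij ih =>
        intro hj
        exact (ih (by omega)).trans
          (hK.lt j _ (hk' j (by omega)).1 _ (hk' (j + 1) hj).1).le
    change ∑ i ∈ s, (ext u (b i) - ext u (a i)) ^ 2 ≤ ‖x‖ ^ 2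
    have hmain := JT.sum_sq_le x s (fun i => chainIco β (k' (a i)) (k' (b i)))
      (fun i _ => isPiece_chainIco _ _ _) fun i hi j hj hij => by
        have hdij := disjoint_chainIco_iff.1 (hd i hi j hj hij)
        rw [disjoint_chainIco_iff]
        intro r h1 h2 h3 h4
        have hi' := hab i hi
        have hj' := hab j hj
        rcases hi'.eq_or_lt with he | hlt
        · rw [he] at h1
          omega
        rcases hj'.eq_or_lt with he | hlt'
        · rw [he] at h3
          omega
        rcases le_or_gt (b i) (a j) with h5 | h5
        · have := hmono _ _ h5 (hlt'.trans (hbN j hj))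
          omega
        rcases le_or_gt (b j) (a i) with h6 | h6
        · have := hmono _ _ h6 (hlt.trans (hbN i hi))
          omega
        exact hdij (max (a i) (a j)) (by omega) (by omega) (by omega) (by omega)
    refine le_trans (le_of_eq (Finset.sum_congr rfl fun i hi => ?_)) hmain
    rw [(hk' _ (hbN i hi)).2, (hk' _ ((hab i hi).trans_lt (hbN i hi))).2,
      JT.segSum_chainIco_sub β (hmono _ _ (hab i hi) (hbN i hi)), JT.segSum_apply]
  have hmem : (fun j : Fin N => avgSum β (K j) x) ∈ C := by
    -- A tuple with each entry in a convex hull lies in the convex hull of the product.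
    refine convexHull_min hPC hC (mem_convexHull_pi fun j _ => ?_)
    rw [avgSum_apply, Finset.mul_sum]
    refine (convex_convexHull ℝ (P j)).sum_mem (w := fun _ => ((K j).card : ℝ)⁻¹)
      (fun _ _ => by positivity) ?_ fun k hk => subset_convexHull ℝ _ ⟨k, hk, rfl⟩
    rw [Finset.sum_const, nsmul_eq_mul]
    exact mul_inv_cancel₀ (by exact_mod_cast (hK.nonempty j).card_pos.ne')
  refine le_trans (le_of_eq (Finset.sum_congr rfl fun i hi => ?_)) hmem
  simp only [ext]
  rw [dif_pos (hbN i hi), dif_pos ((hab i hi).trans_lt (hbN i hi))]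

lemma avgSum_restr_chain {β : Node} (hβ : start β = β) (K : Finset ℕ) (x : JT) :
    avgSum β K (JT.restr (chain β) (orderConvex_chain β) x) = avgSum β K x := by
  rw [avgSum_apply, avgSum_apply]
  congr 1
  refine Finset.sum_congr rfl fun k _ => segSum_restr _ _ (fun γ hγ => ?_) _
  obtain ⟨i, -, rfl⟩ := mem_chainIco.1 (Finset.mem_coe.1 hγ)
  exact JT.mem_chain_leftExt hβ i

/-- Each segment meets the chain in an interval, over which the averaged differences telescope;
averaging therefore does not increase the norm on a single chain. -/
lemma sum_sq_avgDiff_chain_le {K : Node → ℕ → Finset ℕ} (hK : ∀ β, IsSuccessive (K β)) (x : JT)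
    (β : Node) {F : Finset (Finset Node)} (hF : IsDisjointFamily F) :
    ∑ S ∈ F, (∑ γ ∈ S, (chain β).indicator (avgDiff K x) γ) ^ 2 ≤
      ‖JT.restr (chain β) (orderConvex_chain β) x‖ ^ 2 := by
  classical
  by_cases hβ : start β = β
  · have hex : ∀ S ∈ F, ∃ ab : ℕ × ℕ, ab.1 ≤ ab.2 ∧
        S.filter (· ∈ chain β) = chainIco β ab.1 ab.2 := fun S hS => by
      obtain ⟨a, b, hab, h⟩ := ((hF.1 S hS).isPiece.filter (orderConvex_chain β)).exists_eq_chainIco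
        (β := β) fun γ hγ => (Finset.mem_filter.1 (Finset.mem_coe.1 hγ)).2
      exact ⟨(a, b), hab, h⟩
    choose! ab hab hS using hex
    refine le_trans (le_of_eq (Finset.sum_congr rfl fun S hSF => ?_))
      (sum_sq_avgSum_sub_le (β := β) (hK β) (JT.restr (chain β) (orderConvex_chain β) x) F
        (fun S => (ab S).1) (fun S => (ab S).2) hab fun S hSF T hTF h => ?_)
    · rw [JT.sum_indicator_eq, hS S hSF, sum_chainIco_avgDiff K x hβ (hab S hSF),
        avgSum_restr_chain hβ, avgSum_restr_chain hβ]
    · rw [← hS S hSF, ← hS T hTF]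
      exact (hF.2 S hSF T hTF h).mono (Finset.filter_subset _ _) (Finset.filter_subset _ _)
  · have h0 : ∀ γ, (chain β).indicator (avgDiff K x) γ = 0 := fun γ => by
      refine Set.indicator_of_notMem ?_ _
      rintro rfl
      exact hβ (start_start γ)
    simp only [h0, Finset.sum_const_zero]
    simp

lemma avgDiff_eq_zero {n : ℕ} (K : Node → ℕ → Finset ℕ) {x : JT}
    (hx : ∀ α, n < rightTurns α → x.toFun α = 0) {α : Node} (hα : n < rightTurns α) :
    avgDiff K x α = 0 := by
  have h0 : ∀ L, avgSum (start α) L x = 0 := fun L => by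
    rw [avgSum_apply, Finset.sum_eq_zero, mul_zero]
    intro k _
    rw [JT.segSum_chainIco]
    exact Finset.sum_eq_zero fun i _ => hx _ (by simpa using hα)
  rw [avgDiff, h0, h0, sub_zero]

lemma sum_norm_restr_chain_sq_le (x : JT) (s : Finset Node) :
    ∑ β ∈ s, ‖JT.restr (chain β) (orderConvex_chain β) x‖ ^ 2 ≤ ‖x‖ ^ 2 :=
  JT.sum_norm_restr_sq_le x s chain orderConvex_chain fun _ _ _ _ hij => disjoint_chain hij

/-- The operator `x ↦ avgDiff K x` on `X n`. -/
noncomputable def avgOp (n : ℕ) (K : Node → ℕ → Finset ℕ) (hK : ∀ β, IsSuccessive (K β)) :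
    X n →ₗ[ℝ] X n where
  toFun x := ⟨JT.mk (avgDiff K x) ((n + 1) * ‖(x : JT)‖ ^ 2) fun F hF =>
    sum_sq_le_of_chains (fun α hα => avgDiff_eq_zero K
      (fun _ h => toFun_eq_zero_of_mem x.2 h) hα)
      (fun β F hF => sum_sq_avgDiff_chain_le hK x β hF) (sum_norm_restr_chain_sq_le _) hF,
    mem_X fun α hα => avgDiff_eq_zero K (fun _ h => toFun_eq_zero_of_mem x.2 h) hα⟩
  map_add' x y := Subtype.ext <| JT.ext fun α => by
    simp only [JT.toFun_mk, avgDiff, Submodule.coe_add, map_add, JT.toFun_add, Pi.add_apply]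
    ring
  map_smul' c x := Subtype.ext <| JT.ext fun α => by
    simp only [JT.toFun_mk, avgDiff, Submodule.coe_smul, map_smul, JT.toFun_smul, Pi.smul_apply,
      smul_eq_mul, RingHom.id_apply]
    ring

lemma toFun_avgOp {n : ℕ} {K : Node → ℕ → Finset ℕ} (hK : ∀ β, IsSuccessive (K β)) (x : X n) :
    (avgOp n K hK x).1.toFun = avgDiff K x := rfl

/-- On each chain both x and its averaged version are bounded by the part of x there; (a - b)² ≤ 2a²
+ 2b² gives the factor 4, and combining the chains of T_n gives n + 1. -/
lemma norm_sub_avgOp_le {n : ℕ} {K : Node → ℕ → Finset ℕ} (hK : ∀ β, IsSuccessive (K β))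
    (x : X n) : ‖x - avgOp n K hK x‖ ≤ 2 * √(n + 1) * ‖x‖ := by
  have h4 : ∀ s : Finset Node, ∑ β ∈ s, 4 * ‖JT.restr (chain β) (orderConvex_chain β) x.1‖ ^ 2 ≤
      4 * ‖x‖ ^ 2 := fun s => by
    rw [← Finset.mul_sum]
    exact mul_le_mul_of_nonneg_left (sum_norm_restr_chain_sq_le _ s) (by norm_num)
  rw [← sq_le_sq₀ (norm_nonneg _) (by positivity), mul_pow, mul_pow,
    Real.sq_sqrt (by positivity)]
  refine le_trans (JT.norm_sq_le fun F hF => sum_sq_le_of_chains (n := n) (fun α hα =>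
    toFun_eq_zero_of_mem (x - avgOp n K hK x).2 hα) (fun β F hF => ?_) h4 hF) (le_of_eq (by ring))
  calc ∑ S ∈ F, (∑ γ ∈ S, (chain β).indicator (x - avgOp n K hK x : X n).1.toFun γ) ^ 2
      ≤ ∑ S ∈ F, (2 * (∑ γ ∈ S, (chain β).indicator x.1.toFun γ) ^ 2 +
          2 * (∑ γ ∈ S, (chain β).indicator (avgDiff K x) γ) ^ 2) := by
        refine Finset.sum_le_sum fun S _ => ?_
        have : ∀ γ, (chain β).indicator (x - avgOp n K hK x : X n).1.toFun γ =
            (chain β).indicator x.1.toFun γ - (chain β).indicator (avgDiff K x) γ := fun γ => by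
          by_cases h : γ ∈ chain β
          · simp only [Set.indicator_of_mem h]
            rfl
          · simp only [Set.indicator_of_notMem h, sub_zero]
        simp only [this, Finset.sum_sub_distrib]
        nlinarith [sq_nonneg ((∑ γ ∈ S, (chain β).indicator x.1.toFun γ) +
          ∑ γ ∈ S, (chain β).indicator (avgDiff K x) γ)]
    _ ≤ 4 * ‖JT.restr (chain β) (orderConvex_chain β) x.1‖ ^ 2 := by
        rw [Finset.sum_add_distrib, ← Finset.mul_sum, ← Finset.mul_sum]
        have h1 := JT.sum_family_le (JT.restr (chain β) (orderConvex_chain β) x.1) hF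
        have h2 := sum_sq_avgDiff_chain_le hK x.1 β hF
        rw [JT.toFun_restr] at h1
        linarith

/-- The operator `id - avgOp`. -/
noncomputable def idSubAvgOp (n : ℕ) (K : Node → ℕ → Finset ℕ) (hK : ∀ β, IsSuccessive (K β)) :
    X n →L[ℝ] X n :=
  (LinearMap.id - avgOp n K hK).mkContinuous (2 * √(n + 1)) (norm_sub_avgOp_le hK)

lemma idSubAvgOp_apply {n : ℕ} {K : Node → ℕ → Finset ℕ} (hK : ∀ β, IsSuccessive (K β)) (x : X n) :
    idSubAvgOp n K hK x = x - avgOp n K hK x := rfl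

/-- Telescoping with the limit of the averages: subtracting from the identity cancels the infinite
chain sum and leaves only the finite average over `K β 0`. This is the source of weak compactness.
-/
lemma chainSum_avgOp {n : ℕ} {K : Node → ℕ → Finset ℕ} (hK : ∀ β, IsSuccessive (K β)) {β : Node}
    (hβ : start β = β) (x : X n) : JT.chainSum β (avgOp n K hK x).1 =
      JT.chainSum β x.1 - avgSum β (K β 0) x.1 := by
  refine tendsto_nhds_unique (JT.tendsto_chainSum β _) ?_
  simp only [JT.segSum_apply, toFun_avgOp, sum_chainIco_avgDiff K x.1 hβ (Nat.zero_le _)]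
  exact (tendsto_avgSum β (hK β) x.1).sub_const _

lemma continuous_avgSum_ofBall {n : ℕ} (β : Node) (K : Finset ℕ) :
    Continuous fun g : ballFunctions n => avgSum β K (ofBall g).1 := by
  have hc : ∀ γ, Continuous fun g : ballFunctions n => (ofBall g).1.toFun γ := fun γ =>
    (continuous_apply γ).comp continuous_subtype_val
  simp only [avgSum_apply, JT.segSum_apply]
  fun_prop

lemma isWeaklyCompactOperator_idSubAvgOp {n : ℕ} {K : Node → ℕ → Finset ℕ}
    (hK : ∀ β, IsSuccessive (K β)) : IsWeaklyCompactOperator (idSubAvgOp n K hK) := by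
  have hc : ∀ γ, Continuous fun g : ballFunctions n => (ofBall g).1.toFun γ := fun γ =>
    (continuous_apply γ).comp continuous_subtype_val
  refine isWeaklyCompactOperator_X (fun α => ?_) fun β hβ => ?_
  · exact (hc α).sub ((continuous_avgSum_ofBall _ _).sub (continuous_avgSum_ofBall _ _))
  · refine (continuous_avgSum_ofBall β (K β 0)).congr fun g => ?_
    rw [idSubAvgOp_apply]
    change _ = JT.chainSum β ((ofBall g).1 - (avgOp n K hK (ofBall g)).1)
    rw [map_sub, chainSum_avgOp hK hβ, sub_sub_cancel]

/-- The averaging result is applied to tails of the chain sum: their differences are sums over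
intervals of the chain, so their quadratic variation is bounded by the norm. -/
lemma exists_isSuccessive {n : ℕ} {D : Set (X n)} (hD : IsWeaklyCompact D) (β : Node) {e : ℕ → ℝ}
    (he : ∀ j, 0 < e j) : ∃ K : ℕ → Finset ℕ, IsSuccessive K ∧
      ∀ j, ∀ x ∈ D, |avgSum β (K j) x.1 - JT.chainSum β x.1| ≤ e j := by
  have hex : ∀ a j : ℕ, ∃ K : Finset ℕ, K.Nonempty ∧ (∀ k ∈ K, a ≤ k) ∧
      ∀ x ∈ D, |avgSum β K x.1 - JT.chainSum β x.1| ≤ e j := by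
    intro a j
    obtain ⟨K, hK, hKa, hKD⟩ := hD.exists_average_le
      (fun k => (JT.chainSum (leftExt β k)).comp (X n).subtypeL)
      (fun x => JT.tendsto_chainSum_leftExt β x.1)
      (fun x N p q hpq => by
        have hp : Monotone p := monotone_nat_of_le_succ fun r => (hpq r).1.trans (hpq r).2
        refine le_trans (le_of_eq (Finset.sum_congr rfl fun r _ => ?_))
          (JT.sum_sq_le x.1 (Finset.range N) (fun r => chainIco β (p r) (q r))
            (fun r _ => isPiece_chainIco _ _ _) fun r _ r' _ hne => ?_)
        · simp only [ContinuousLinearMap.comp_apply, Submodule.subtypeL_apply, JT.chainSum_leftExt,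
            sum_chainIco, Finset.sum_Ico_eq_sub _ (hpq r).1]
          ring
        · rw [disjoint_chainIco_iff]
          intro i h1 h2 h3 h4
          rcases lt_or_gt_of_ne hne with h | h
          · have h5 : p (r + 1) ≤ p r' := hp h
            have := (hpq r).2
            omega
          · have h5 : p (r' + 1) ≤ p r := hp h
            have := (hpq r').2
            omega) a (he j)
    refine ⟨K, hK, hKa, fun x hx => ?_⟩
    have hcard : (K.card : ℝ) ≠ 0 := by exact_mod_cast hK.card_pos.ne'
    have h1 := hKD x hx
    simp only [ContinuousLinearMap.comp_apply, Submodule.subtypeL_apply, JT.chainSum_leftExt,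
      Finset.sum_sub_distrib, Finset.sum_const, nsmul_eq_mul] at h1
    rw [mul_sub, inv_mul_cancel_left₀ hcard] at h1
    rw [abs_sub_comm, avgSum_apply]
    simpa only [JT.segSum_chainIco, Nat.Ico_zero_eq_range] using h1
  choose Kf hne hge hD' using hex
  -- The threshold for the next set exceeds all positions in the current one, and is at least the
  -- next index.
  let a : ℕ → ℕ := fun j => Nat.rec 0 (fun j a => max ((Kf a j).sup id + 1) (j + 1)) j
  have ha : ∀ j, a (j + 1) = max ((Kf (a j) j).sup id + 1) (j + 1) := fun _ => rfl
  refine ⟨fun j => Kf (a j) j, ⟨fun j => hne _ _, fun j k hk l hl => ?_, fun j k hk => ?_⟩,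
    fun j => hD' _ _⟩
  · have h1 := hge _ _ l hl
    have h2 : k ≤ (Kf (a j) j).sup id := Finset.le_sup (f := id) hk
    rw [ha] at h1
    omega
  · have h1 := hge _ _ k hk
    cases j with
    | zero => exact Nat.zero_le _
    | succ j =>
      rw [ha] at h1
      omega

theorem hasWAPWith_X {n : ℕ} (hn : 1 ≤ n) : HasWAPWith (X n) (3 * √(n : ℝ)) := by
  intro D hD ε hε
  obtain ⟨e, he, c, hc, hcε⟩ := posSumOfEncodable (half_pos (half_pos hε)) Node
  -- The average with index j enters the new coordinates at positions j and j - 1, hence the minimum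
  -- of two tolerances; at j = 0 truncated subtraction makes them equal. The tolerances sum to at
  -- most ε/4, and each coordinate error is at most twice its tolerance.
  choose K hK hKD using fun β => exists_isSuccessive hD β
    (e := fun j => min (e (leftExt β j)) (e (leftExt β (j - 1)))) fun j => lt_min (he _) (he _)
  refine ⟨idSubAvgOp n K hK, isWeaklyCompactOperator_idSubAvgOp hK,
    ⟨ε / 2, half_lt_self hε, fun x hx => ?_⟩, ?_⟩
  · rw [idSubAvgOp_apply, sub_sub_cancel]
    refine (JT.norm_le_of_hasSum (hc.mul_left 2) fun α => ?_).trans (by linarith)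
    change |avgDiff K x α| ≤ 2 * e α
    rw [avgDiff]
    have h1 := hKD (start α) (trail α + 1) x hx
    have h2 := hKD (start α) (trail α) x hx
    have h3 := h1.trans (min_le_right _ _)
    have h4 := h2.trans (min_le_left _ _)
    rw [Nat.add_sub_cancel, leftExt_start_trail] at h3
    rw [leftExt_start_trail] at h4
    rw [abs_le] at *
    constructor <;> linarith
  · refine (LinearMap.mkContinuous_norm_le _ (by positivity) _).trans ?_
    -- Squared, the claim is 4(n + 1) ≤ 9n, true from n = 1 on; this is where the constant 3 comes
    -- from.
    rw [← sq_le_sq₀ (by positivity) (by positivity), mul_pow, mul_pow, Real.sq_sqrt (by positivity),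
      Real.sq_sqrt (by positivity)]
    have : (1 : ℝ) ≤ n := by exact_mod_cast hn
    linarith

end JamesTree
open Filter Topology

/-! ### Passing to 1-complemented subspaces -/

section Retracts

variable {E F : Type*} [NormedAddCommGroup E] [NormedSpace ℝ E]
  [NormedAddCommGroup F] [NormedSpace ℝ F]

lemma continuous_weakSpace_map (L : E →L[ℝ] F) :
    Continuous fun x : WeakSpace ℝ E => toWeakSpace ℝ F (L ((toWeakSpace ℝ E).symm x)) :=
  continuous_toWeakSpace_of_forall fun φ => continuous_toWeakSpace_eval (φ.comp L)

lemma IsWeaklyCompact.image {D : Set E} (hD : IsWeaklyCompact D) (L : E →L[ℝ] F) :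
    IsWeaklyCompact (L '' D) := by
  have := IsCompact.image hD (continuous_weakSpace_map L)
  rw [Set.image_image] at this
  rw [IsWeaklyCompact, Set.image_image]
  simpa using this

lemma IsWeaklyCompactOperator.comp_comp {V : E →L[ℝ] E} (hV : IsWeaklyCompactOperator V)
    (P : E →L[ℝ] F) (J : F →L[ℝ] E) (hJ : ∀ x, ‖J x‖ ≤ ‖x‖) :
    IsWeaklyCompactOperator (P.comp (V.comp J)) := by
  refine (IsCompact.image hV (continuous_weakSpace_map P)).closure_of_subset ?_
  rintro _ ⟨_, ⟨x, hx, rfl⟩, rfl⟩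
  refine ⟨toWeakSpace ℝ E (V (J x)), subset_closure ⟨_, ⟨J x, ?_, rfl⟩, rfl⟩, by simp⟩
  rw [mem_closedBall_zero_iff] at hx ⊢
  exact (hJ x).trans hx

/-- The weakly compact approximation property passes to `1`-complemented subspaces. -/
lemma HasWAPWith.of_retract {C : ℝ} (hE : HasWAPWith E C) (P : E →L[ℝ] F) (J : F →L[ℝ] E)
    (hPJ : ∀ x, P (J x) = x) (hP : ∀ x, ‖P x‖ ≤ ‖x‖) (hJ : ∀ x, ‖J x‖ ≤ ‖x‖) :
    HasWAPWith F C := by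
  intro D hD ε hε
  obtain ⟨V, hV, ⟨r, hr, hVr⟩, hVC⟩ := hE _ (hD.image J) ε hε
  refine ⟨P.comp (V.comp J), hV.comp_comp P J hJ, ⟨r, hr, fun x hx => ?_⟩, ?_⟩
  · refine le_trans ?_ (hVr (J x) ⟨x, hx, rfl⟩)
    refine le_trans (le_of_eq ?_) (hP _)
    rw [map_sub, hPJ]
    rfl
  · refine le_trans (ContinuousLinearMap.opNorm_le_bound _ (norm_nonneg V) fun x => ?_) hVC
    exact (hP _).trans ((V.le_opNorm _).trans (mul_le_mul_of_nonneg_left (hJ x) (norm_nonneg _)))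

end Retracts

namespace JamesTree

/-! ### The lower bound in `X n` -/

lemma path_concat (α : Node) (c : Bool) : path (α ++ [c]) = insert (α ++ [c]) (path α) := by
  ext γ
  simp [List.prefix_concat_iff]

lemma segSum_path_leftExt (β : Node) (m : ℕ) (x : JT) :
    JT.segSum (path (leftExt β m)) x =
      JT.segSum (path β) x - x.toFun β + ∑ i ∈ Finset.range (m + 1), x.toFun (leftExt β i) := by
  induction m with
  | zero => simp
  | succ m ih =>
    have h1 : leftExt β (m + 1) = leftExt β m ++ [false] := by
      rw [← leftExt_leftExt]
      rfl
    have h2 : leftExt β (m + 1) ∉ path (leftExt β m) := by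
      rw [mem_path, leftExt_prefix_leftExt]
      omega
    have h3 : path (leftExt β (m + 1)) = insert (leftExt β (m + 1)) (path (leftExt β m)) := by
      rw [h1, path_concat]
    rw [h3, JT.segSum_apply, Finset.sum_insert h2, ← JT.segSum_apply, ih, Finset.sum_range_succ _ (m + 1)]
    ring

lemma isPiece_path_sdiff (a b : Node) : IsPiece (path b \ path a) := by
  refine ⟨fun x hx y hy => (isPiece_path b).1 x (Finset.mem_sdiff.1 hx).1 y (Finset.mem_sdiff.1 hy).1,
    fun x hx y hy z h1 h2 => ?_⟩
  rw [Finset.mem_coe, Finset.mem_sdiff, mem_path, mem_path] at *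
  exact ⟨h2.trans hy.1, fun h => hx.2 (h1.trans h)⟩

/-- The sum along the infinite branch that passes through `β` and then only turns left. -/
noncomputable def branchSum (β : Node) : StrongDual ℝ JT :=
  JT.segSum (path β) - JT.coord β + JT.chainSum β

/-- Sums along branches that agree long enough are close. -/
lemma exists_abs_segSum_path_sub_le (w : JT) (β : Node) {ε : ℝ} (hε : 0 < ε) :
    ∃ N, ∀ m ≥ N, ∀ b, leftExt β m <+: b → |JT.segSum (path b) w - branchSum β w| ≤ ε := by
  obtain ⟨N, hN⟩ := JT.exists_abs_segSum_le_of_length w (half_pos hε)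
  refine ⟨N, fun m hm b hb => ?_⟩
  have hsub : path (leftExt β m) ⊆ path b := fun γ hγ => mem_path.2 ((mem_path.1 hγ).trans hb)
  -- After cancelling the common initial part, what differs is a deep piece of the path and a deep
  -- tail of the left branch, each at most ε/2.
  have h1 : JT.segSum (path b) w - branchSum β w =
      JT.segSum (path b \ path (leftExt β m)) w - JT.chainSum (leftExt β (m + 1)) w := by
    have h2 : JT.segSum (path b \ path (leftExt β m)) w + JT.segSum (path (leftExt β m)) w =
        JT.segSum (path b) w := by
      simp only [JT.segSum_apply]
      exact Finset.sum_sdiff hsub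
    rw [JT.chainSum_leftExt, ← h2, segSum_path_leftExt]
    simp only [branchSum, add_apply, sub_apply, JT.coord_apply]
    ring
  have h3 : |JT.segSum (path b \ path (leftExt β m)) w| ≤ ε / 2 := by
    refine hN _ (isPiece_path_sdiff _ _) fun γ hγ => ?_
    rw [Finset.mem_sdiff, mem_path, mem_path] at hγ
    have := ((prefix_total hb hγ.1).resolve_right hγ.2).length_le
    rw [length_leftExt] at this
    omega
  have h4 : |JT.chainSum (leftExt β (m + 1)) w| ≤ ε / 2 := by
    refine le_of_tendsto (JT.tendsto_chainSum _ w).abs (Eventually.of_forall fun k => ?_)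
    refine hN _ (isPiece_chainIco _ _ _) fun γ hγ => ?_
    obtain ⟨i, -, rfl⟩ := mem_chainIco.1 hγ
    simp only [length_leftExt]
    omega
  rw [h1]
  exact (abs_sub _ _).trans (by linarith)

/-- The node vector `f_α` as an element of `X n` (zero if `α` is not in `T_n`). -/
noncomputable def nodeVecX (n : ℕ) (α : Node) : X n := proj n (nodeVec α)

lemma coe_nodeVecX {n : ℕ} {α : Node} (h : rightTurns α ≤ n) : (nodeVecX n α : JT) = nodeVec α :=
  congrArg Subtype.val (proj_coe (⟨nodeVec α, nodeVec_mem h⟩ : X n))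

lemma norm_nodeVecX_le (n : ℕ) (α : Node) : ‖nodeVecX n α‖ ≤ 1 :=
  (norm_proj_le n _).trans (norm_nodeVec_le α)

/-- A weakly compact operator that almost fixes `f_β` maps some test vector, supported on the chain
of `β`, to a vector with large sum along any path leaving the chain at a certain position. -/
lemma exists_test_vector {n : ℕ} {V : X n →L[ℝ] X n} (hV : IsWeaklyCompactOperator V) {β : Node}
    (hβn : rightTurns β ≤ n) (hβV : ‖nodeVecX n β - V (nodeVecX n β)‖ ≤ 1 / 10) :
    ∃ m, ∀ b, leftExt β m ++ [true] <+: b → ∃ z : X n, 3 / 10 ≤ JT.segSum (path b) (V z) ∧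
      ∃ p, p ≤ m ∧ (z : JT) = nodeVec β - nodeVec (leftExt β p) ∨
        m < p ∧ (z : JT) = nodeVec (leftExt β p) := by
  have hv : ∀ p, (nodeVecX n (leftExt β p) : JT) = nodeVec (leftExt β p) := fun p =>
    coe_nodeVecX (by simpa using hβn)
  have hpre : ∀ m b, leftExt β m ++ [true] <+: b → leftExt β m <+: b := fun m b h =>
    (List.prefix_append _ _).trans h
  -- If some image has branch sum at most 1/2, then f_β - f_{β0ᵖ} works: nearby paths give at least
  -- 9/10 - 1/2 - 1/20. The exit position is taken beyond p, so the two terms cancel along the path.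
  by_cases hcase : ∃ p, branchSum β (V (nodeVecX n (leftExt β p))) ≤ 1 / 2
  · obtain ⟨p, hp⟩ := hcase
    set z : X n := nodeVecX n β - nodeVecX n (leftExt β p)
    obtain ⟨N, hN⟩ := exists_abs_segSum_path_sub_le (V (nodeVecX n (leftExt β p)) : JT) β
      (ε := 1 / 20) (by norm_num)
    refine ⟨max N p, fun b hb => ⟨z, ?_, p, Or.inl ⟨le_max_right _ _, ?_⟩⟩⟩
    · have h1 := hN _ (le_max_left N p) b (hpre _ _ hb)
      have h2 : |JT.segSum (path b) (nodeVecX n β - V (nodeVecX n β) : X n)| ≤ 1 / 10 :=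
        (JT.abs_segSum_le (isPiece_path b) _).trans hβV
      have hβb : β <+: b := (prefix_leftExt _ _).trans (hpre _ _ hb)
      have h3 : JT.segSum (path b) (nodeVecX n β : JT) = 1 := by
        rw [coe_nodeVecX hβn, sum_single_eq, if_pos (mem_path.2 hβb)]
      rw [Submodule.coe_sub, map_sub, h3] at h2
      have h4 : JT.segSum (path b) (V z : JT) = JT.segSum (path b) (V (nodeVecX n β) : JT) -
          JT.segSum (path b) (V (nodeVecX n (leftExt β p)) : JT) := by
        rw [map_sub, Submodule.coe_sub, map_sub]
      rw [h4]
      rw [abs_le] at h1 h2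
      linarith
    · rw [Submodule.coe_sub, hv, coe_nodeVecX hβn]
  -- Otherwise weak compactness gives a cluster point v of the images with branch sum at least 1/2.
  -- Paths leaving late see at least 1/2 - 1/10 of v, hence more than 3/10 of images of arbitrarily
  -- late nodes, which lie off the path.
  · push Not at hcase
    let u : ℕ → WeakSpace ℝ (X n) := fun p => toWeakSpace ℝ (X n) (V (nodeVecX n (leftExt β p)))
    obtain ⟨v', -, hv'⟩ := hV.exists_mapClusterPt (f := atTop) (u := u) (by
      refine tendsto_principal.2 (Eventually.of_forall fun p => subset_closure ?_)
      exact ⟨_, ⟨nodeVecX n (leftExt β p), by simpa using norm_nodeVecX_le _ _, rfl⟩, rfl⟩)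
    set v : X n := (toWeakSpace ℝ (X n)).symm v'
    have hfreq : ∀ (φ : StrongDual ℝ JT) (U : Set ℝ), IsOpen U → φ v ∈ U →
        ∃ᶠ p in atTop, φ (V (nodeVecX n (leftExt β p))) ∈ U := by
      intro φ U hU hvU
      exact mapClusterPt_iff_frequently.1 hv' _
        ((continuous_toWeakSpace_eval (φ.comp (X n).subtypeL)).continuousAt.preimage_mem_nhds
          (hU.mem_nhds hvU))
    have hv2 : 1 / 2 ≤ branchSum β v := by
      by_contra! hlt
      obtain ⟨p, hp⟩ := (hfreq (branchSum β) (Set.Iio (1 / 2)) isOpen_Iio hlt).exists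
      exact absurd hp (not_lt.2 (hcase p).le)
    obtain ⟨N, hN⟩ := exists_abs_segSum_path_sub_le (v : JT) β (ε := 1 / 10) (by norm_num)
    refine ⟨N, fun b hb => ?_⟩
    have h1 := hN N le_rfl b (hpre _ _ hb)
    have h2 : 3 / 10 < JT.segSum (path b) (v : JT) := by
      rw [abs_le] at h1
      linarith
    obtain ⟨p, hp, hpN⟩ := ((hfreq (JT.segSum (path b)) (Set.Ioi (3 / 10)) isOpen_Ioi h2).and_eventually
      (eventually_gt_atTop N)).exists
    exact ⟨_, le_of_lt hp, p, Or.inr ⟨hpN, hv p⟩⟩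

/-- The weakly compact set `{0} ∪ {f_β}`, `β` running through the starts of the chains of `T_n`. -/
noncomputable def startSet (n : ℕ) : Set (X n) :=
  insert 0 (Set.range fun β : {β : Node // start β = β ∧ rightTurns β ≤ n} => nodeVecX n β)

/-- A segment contains at most n + 1 starts lying in T_n, one for each chain it meets there. -/
lemma norm_sum_smul_nodeVecX_sq_le {n : ℕ} (s : Finset {β : Node // start β = β ∧ rightTurns β ≤ n})
    (c : {β : Node // start β = β ∧ rightTurns β ≤ n} → ℝ) :
    ‖∑ β ∈ s, c β • nodeVecX n β‖ ^ 2 ≤ (n + 1) * ∑ β ∈ s, c β ^ 2 := by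
  classical
  have h := norm_sum_sq_le (K := n + 1) s (fun β => c β • nodeVec β.1) fun S hS => by
    refine ⟨s.filter fun β => β.1 ∈ S, Finset.filter_subset _ _, ?_, fun β hβ hβS => ?_⟩
    · rw [← Finset.card_image_of_injective _ Subtype.val_injective]
      refine (Finset.card_le_card fun γ hγ => ?_).trans
        (card_image_start_le (hS.isPiece.filter (orderConvex_subtree n)) (n := n)
          fun α hα => (Finset.mem_filter.1 hα).2)
      obtain ⟨β, hβ, rfl⟩ := Finset.mem_image.1 hγ
      exact Finset.mem_image.2 ⟨β, Finset.mem_filter.2 ⟨(Finset.mem_filter.1 hβ).2, β.2.2⟩, β.2.1⟩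
    · have : β.1 ∉ S := fun h => hβS (Finset.mem_filter.2 ⟨hβ, h⟩)
      rw [map_smul, sum_single_eq, if_neg this, smul_zero]
  have hle : ∑ β ∈ s, ‖c β • nodeVec β.1‖ ^ 2 ≤ ∑ β ∈ s, c β ^ 2 := by
    refine Finset.sum_le_sum fun β _ => ?_
    rw [norm_smul, mul_pow, Real.norm_eq_abs, sq_abs]
    exact mul_le_of_le_one_right (sq_nonneg _) (pow_le_one₀ (norm_nonneg _) (norm_nodeVec_le _))
  have hcoe : ((∑ β ∈ s, c β • nodeVecX n β : X n) : JT) = ∑ β ∈ s, c β • nodeVec β.1 := by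
    rw [Submodule.coe_sum]
    exact Finset.sum_congr rfl fun β _ => by rw [Submodule.coe_smul, coe_nodeVecX β.2.2]
  change ‖((∑ β ∈ s, c β • nodeVecX n β : X n) : JT)‖ ^ 2 ≤ _
  rw [hcoe]
  push_cast at h
  exact h.trans (mul_le_mul_of_nonneg_left hle (by positivity))

/-- The upper 2-estimate makes every functional square-summable on the starts, so they tend weakly
to 0 along the cofinite filter. -/
lemma isWeaklyCompact_startSet (n : ℕ) : IsWeaklyCompact (startSet n) := by
  rw [IsWeaklyCompact, startSet, Set.image_insert_eq, ← Set.range_comp]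
  refine Tendsto.isCompact_insert_range_of_cofinite
    (tendsto_toWeakSpace_of_forall fun ψ => ?_)
  have h1 : Summable fun β : {β : Node // start β = β ∧ rightTurns β ≤ n} =>
      ψ (nodeVecX n β) ^ 2 :=
    summable_of_sum_le (fun _ => sq_nonneg _) fun s => sum_sq_apply_le (K := n + 1) (by positivity)
      ψ s (fun β => nodeVecX n β.1) (norm_sum_smul_nodeVecX_sq_le s)
  have h2 := h1.tendsto_cofinite_zero.sqrt
  simp only [Real.sqrt_sq_eq_abs, Real.sqrt_zero] at h2
  rw [map_zero]
  exact (tendsto_zero_iff_abs_tendsto_zero _).2 h2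

/-- A vector on the chain from `β` as in `exists_test_vector` is seen by a segment `[a, c]` only if
`a` or `c` separates `β` from the node `β'` where the path leaves the chain. -/
lemma separates_of_segSum_ne_zero {β : Node} {m p : ℕ} {z : JT}
    (hz : p ≤ m ∧ z = nodeVec β - nodeVec (leftExt β p) ∨ m < p ∧ z = nodeVec (leftExt β p))
    {S : Finset Node} {a c : Node} (hS : ∀ γ, γ ∈ S ↔ a <+: γ ∧ γ <+: c)
    (h : JT.segSum S z ≠ 0) :
    (¬ a <+: β ∧ a <+: leftExt β m ++ [true]) ∨ (β <+: c ∧ ¬ leftExt β m ++ [true] <+: c) := by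
  have hpm : p ≤ m → leftExt β p <+: leftExt β m ++ [true] := fun hp =>
    (leftExt_prefix_leftExt.2 hp).trans (List.prefix_append _ _)
  have hβp := prefix_leftExt β p
  rcases hz with ⟨hp, rfl⟩ | ⟨hp, rfl⟩
  · rw [map_sub, sum_single_eq, sum_single_eq] at h
    by_cases h1 : β ∈ S
    · right
      have h1' := (hS _).1 h1
      refine ⟨h1'.2, fun h2 => h ?_⟩
      rw [if_pos h1, if_pos ((hS _).2 ⟨h1'.1.trans hβp, (hpm hp).trans h2⟩), sub_self]
    · by_cases h2 : leftExt β p ∈ S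
      · left
        have h2' := (hS _).1 h2
        exact ⟨fun h3 => h1 ((hS _).2 ⟨h3, hβp.trans h2'.2⟩), h2'.1.trans (hpm hp)⟩
      · rw [if_neg h1, if_neg h2, sub_self] at h
        exact absurd rfl h
  · rw [sum_single_eq] at h
    have h2 : a <+: leftExt β p ∧ leftExt β p <+: c := by
      by_contra h2
      exact h (if_neg fun h3 => h2 ((hS _).1 h3))
    right
    -- Beyond the exit position the vector sits on the left branch, while the path turns right: c
    -- cannot extend both.
    refine ⟨hβp.trans h2.2, fun h3 => ?_⟩
    have h4 : leftExt β (m + 1) <+: c := (leftExt_prefix_leftExt.2 hp).trans h2.2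
    have h5 : leftExt β (m + 1) = leftExt β m ++ [false] := by
      rw [← leftExt_leftExt]
      rfl
    rw [h5] at h4
    have h6 := (List.prefix_of_prefix_length_le h3 h4 (by simp)).eq_of_length (by simp)
    simp at h6

/-- The n test vectors lie on consecutive chains along one path, so their images add up along it,
while their own norms add only in the ℓ² sense. -/
lemma exists_test_sum {n : ℕ} {V : X n →L[ℝ] X n} (hV : IsWeaklyCompactOperator V)
    (hVD : ∀ x ∈ startSet n, ‖x - V x‖ ≤ 1 / 10) :
    ∃ x : X n, ‖x‖ ^ 2 ≤ 8 * n ∧ 3 / 10 * n ≤ ‖V x‖ := by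
  classical
  have hstep : ∀ β, start β = β → rightTurns β ≤ n → ∃ m, ∀ b, leftExt β m ++ [true] <+: b →
      ∃ z : X n, 3 / 10 ≤ JT.segSum (path b) (V z) ∧
        ∃ p, p ≤ m ∧ (z : JT) = nodeVec β - nodeVec (leftExt β p) ∨
          m < p ∧ (z : JT) = nodeVec (leftExt β p) := fun β h1 h2 =>
    exists_test_vector hV h2 (hVD _ (Or.inr ⟨⟨β, h1, h2⟩, rfl⟩))
  choose! m hm using hstep
  -- From each start, go left to the exit position and turn right; `B k` has exactly k right turns,
  -- so the path stays in T_n up to `B n`.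
  let B : ℕ → Node := fun k => Nat.rec [] (fun _ β => leftExt β (m β) ++ [true]) k
  have hB : ∀ k, B (k + 1) = leftExt (B k) (m (B k)) ++ [true] := fun _ => rfl
  have hBs : ∀ k, start (B k) = B k := fun k => by
    cases k with
    | zero => rfl
    | succ k => rw [hB, start_concat_true]
  have hBr : ∀ k, rightTurns (B k) = k := fun k => by
    induction k with
    | zero => rfl
    | succ k ih => rw [hB, rightTurns_concat_true, rightTurns_leftExt, ih]
  have hBmono : ∀ i j, i ≤ j → B i <+: B j := fun i j hij => by
    induction j, hij using Nat.le_induction with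
    | base => exact List.prefix_rfl
    | succ j _ ih => exact ih.trans ((prefix_leftExt _ _).trans (List.prefix_append _ _))
  have hz : ∀ k, ∃ z : X n, k < n → 3 / 10 ≤ JT.segSum (path (B n)) (V z) ∧
      ∃ p, p ≤ m (B k) ∧ (z : JT) = nodeVec (B k) - nodeVec (leftExt (B k) p) ∨
        m (B k) < p ∧ (z : JT) = nodeVec (leftExt (B k) p) := fun k => by
    by_cases hk : k < n
    · obtain ⟨z, hz⟩ := hm (B k) (hBs k) (by rw [hBr]; exact hk.le) (B n) (by
        rw [← hB]
        exact hBmono _ _ hk)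
      exact ⟨z, fun _ => hz⟩
    · exact ⟨0, fun h => absurd h hk⟩
  choose z hz using hz
  refine ⟨∑ k ∈ Finset.range n, z k, ?_, ?_⟩
  · have hz2 : ∀ k ∈ Finset.range n, ‖(z k : JT)‖ ^ 2 ≤ 4 := by
      intro k hk
      obtain ⟨-, p, ⟨-, h⟩ | ⟨-, h⟩⟩ := hz k (Finset.mem_range.1 hk)
      · have h1 : ‖(z k : JT)‖ ≤ 2 := by
          rw [h]
          refine (norm_sub_le _ _).trans ?_
          have := norm_nodeVec_le (B k)
          have := norm_nodeVec_le (leftExt (B k) p)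
          linarith
        have := norm_nonneg (z k : JT)
        nlinarith
      · have h1 : ‖(z k : JT)‖ ≤ 1 := by
          rw [h]
          exact norm_nodeVec_le _
        have := norm_nonneg (z k : JT)
        nlinarith
    have hmain := norm_sum_sq_le (K := 2) (Finset.range n) (fun k => (z k : JT)) fun S hS => by
      obtain ⟨a, c, -, hac⟩ := hS
      refine ⟨(Finset.range n).filter fun k => JT.segSum S (z k : JT) ≠ 0, Finset.filter_subset _ _,
        Finset.card_le_two_of_no_middle ?_, fun j hj hj' => ?_⟩
      · have hsep : ∀ k ∈ (Finset.range n).filter fun k => JT.segSum S (z k : JT) ≠ 0,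
            (¬ a <+: B k ∧ a <+: B (k + 1)) ∨ (B k <+: c ∧ ¬ B (k + 1) <+: c) := by
          intro k hk
          rw [Finset.mem_filter, Finset.mem_range] at hk
          obtain ⟨-, p, hp⟩ := hz k hk.1
          exact separates_of_segSum_ne_zero hp hac hk.2
        intro i hi j hj k hk hij hjk
        -- Each end of the segment separates at most one pair of consecutive starts; among three
        -- visible indices, two would use the same end.
        have hP : ∀ i j, i < j → a <+: B (i + 1) → ¬ ¬ a <+: B j := fun i j hij h h' =>
          h' (h.trans (hBmono _ _ hij))
        have hQ : ∀ i j, i < j → ¬ B (i + 1) <+: c → ¬ B j <+: c := fun i j hij h h' =>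
          h ((hBmono _ _ hij).trans h')
        rcases hsep i hi with h1 | h1 <;> rcases hsep j hj with h2 | h2
        · exact hP i j hij h1.2 h2.1
        · rcases hsep k hk with h3 | h3
          · exact hP i k (hij.trans hjk) h1.2 h3.1
          · exact hQ j k hjk h2.2 h3.1
        · rcases hsep k hk with h3 | h3
          · exact hP j k hjk h2.2 h3.1
          · exact hQ i k (hij.trans hjk) h1.2 h3.1
        · exact hQ i j hij h1.2 h2.1
      · by_contra hne
        exact hj' (Finset.mem_filter.2 ⟨hj, hne⟩)
    change ‖((∑ k ∈ Finset.range n, z k : X n) : JT)‖ ^ 2 ≤ _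
    rw [Submodule.coe_sum]
    refine hmain.trans ?_
    have := Finset.sum_le_card_nsmul _ _ 4 hz2
    rw [Finset.card_range, nsmul_eq_mul] at this
    push_cast
    linarith
  · have h1 : 3 / 10 * (n : ℝ) ≤ JT.segSum (path (B n)) (V (∑ k ∈ Finset.range n, z k) : JT) := by
      rw [map_sum, Submodule.coe_sum, map_sum]
      refine le_trans (by simp [mul_comm]) (Finset.card_nsmul_le_sum _ _ (3 / 10) fun k hk => ?_)
      exact (hz k (Finset.mem_range.1 hk)).1
    exact h1.trans ((le_abs_self _).trans (JT.abs_segSum_le (isPiece_path _) _))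

theorem sqrt_le_norm_of_approximates {n : ℕ} {V : X n →L[ℝ] X n}
    (hV : IsWeaklyCompactOperator V) (hVD : ApproximatesIdOn V (startSet n) (1 / 10)) :
    1 / 10 * √(n : ℝ) ≤ ‖V‖ := by
  obtain ⟨r, hr, hVr⟩ := hVD
  obtain ⟨x, hx, hVx⟩ := exists_test_sum hV fun x hx => (hVr x hx).trans hr.le
  rw [← sq_le_sq₀ (by positivity) (norm_nonneg _), mul_pow, Real.sq_sqrt (Nat.cast_nonneg n)]
  rcases Nat.eq_zero_or_pos n with rfl | hn
  · simp
  · have hn0 : (0 : ℝ) < n := by exact_mod_cast hn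
    have h1 : (3 / 10 * (n : ℝ)) ^ 2 ≤ ‖V‖ ^ 2 * (8 * n) := by
      calc (3 / 10 * (n : ℝ)) ^ 2 ≤ (‖V‖ * ‖x‖) ^ 2 :=
            pow_le_pow_left₀ (by positivity) (hVx.trans (V.le_opNorm x)) 2
        _ ≤ ‖V‖ ^ 2 * (8 * n) := by
            rw [mul_pow]
            exact mul_le_mul_of_nonneg_left hx (sq_nonneg _)
    -- Cancelling n leaves ‖V‖² ≥ 9n/800, which exceeds n/100.
    nlinarith

lemma not_forall_hasWAPWith_X (C : ℝ) : ¬ ∀ n, 1 ≤ n → HasWAPWith (X n) C := by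
  intro h
  obtain ⟨N, hN⟩ := exists_nat_gt ((10 * |C|) ^ 2)
  have hN1 : 1 ≤ N := by
    rcases Nat.eq_zero_or_pos N with rfl | h
    · exact absurd hN (not_lt.2 (by simp))
    · exact h
  obtain ⟨V, hV, hVD, hVC⟩ := h N hN1 _ (isWeaklyCompact_startSet N) (1 / 10) (by norm_num)
  have h1 := sqrt_le_norm_of_approximates hV hVD
  have h2 : 10 * |C| < √(N : ℝ) := (Real.lt_sqrt (by positivity)).2 hN
  have h3 := le_abs_self C
  linarith

theorem not_hasWAP_JT : ¬ HasWAP JT := fun ⟨C, hC⟩ =>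
  not_forall_hasWAPWith_X C fun n _ =>
    hC.of_retract (proj n) (X n).subtypeL proj_coe (norm_proj_le n) fun _ => le_rfl

end JamesTree
open Filter Topology

/-! ### Finite-sum bounds for ℓ²-sums -/

section LpTwo

variable {ι : Type*} {E : ι → Type*} [∀ i, NormedAddCommGroup (E i)]

lemma lp.sum_sq_le_norm_sq (f : lp E 2) (s : Finset ι) : ∑ i ∈ s, ‖f i‖ ^ 2 ≤ ‖f‖ ^ 2 := by
  simpa using lp.sum_rpow_le_norm_rpow (by norm_num) f s

lemma lp.norm_sq_le_of_sum_le {f : lp E 2} {M : ℝ} (h : ∀ s : Finset ι, ∑ i ∈ s, ‖f i‖ ^ 2 ≤ M) :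
    ‖f‖ ^ 2 ≤ M := by
  have hM : 0 ≤ M := by simpa using h ∅
  rw [← Real.sq_sqrt hM, sq_le_sq₀ (norm_nonneg _) (Real.sqrt_nonneg _)]
  refine lp.norm_le_of_forall_sum_le (by norm_num) (Real.sqrt_nonneg _) fun s => ?_
  simpa [Real.sq_sqrt hM] using h s

lemma memℓp_two_of_sum_le {f : ∀ i, E i} {M : ℝ} (h : ∀ s : Finset ι, ∑ i ∈ s, ‖f i‖ ^ 2 ≤ M) :
    Memℓp f 2 :=
  memℓp_gen' (C := M) fun s => by simpa using h s

end LpTwo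

namespace JamesTree

/-! ### The space `Y` -/

/-- The inclusion of the `n`-th summand of `Y`. -/
noncomputable def embY (n : ℕ) : X (n + 1) →L[ℝ] Y :=
  lp.singleContinuousLinearMap ℝ (fun n : ℕ => X (n + 1)) 2 n

/-- The projection of `Y` onto its `n`-th summand. -/
noncomputable def evalY (n : ℕ) : Y →L[ℝ] X (n + 1) :=
  lp.evalCLM ℝ (fun n : ℕ => X (n + 1)) 2 n

lemma evalY_embY (n m : ℕ) (x : X (m + 1)) :
    (evalY n (embY m x) : JT) = if n = m then (x : JT) else 0 := by
  split_ifs with h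
  · subst h
    exact congrArg Subtype.val (lp.single_apply_self (E := fun n : ℕ => X (n + 1)) 2 n x)
  · exact congrArg Subtype.val (lp.single_apply_ne (E := fun n : ℕ => X (n + 1)) 2 m x h)

lemma evalY_embY_self (n : ℕ) (x : X (n + 1)) : evalY n (embY n x) = x :=
  lp.single_apply_self (E := fun n : ℕ => X (n + 1)) 2 n x

lemma norm_embY (n : ℕ) (x : X (n + 1)) : ‖embY n x‖ = ‖x‖ :=
  lp.norm_single (E := fun n : ℕ => X (n + 1)) (p := 2) (by norm_num) n x

lemma sum_norm_evalY_sq_le (y : Y) (s : Finset ℕ) : ∑ n ∈ s, ‖evalY n y‖ ^ 2 ≤ ‖y‖ ^ 2 :=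
  lp.sum_sq_le_norm_sq y s

lemma norm_evalY_le (n : ℕ) (y : Y) : ‖evalY n y‖ ≤ ‖y‖ :=
  lp.norm_apply_le_norm (by norm_num) y n

theorem not_hasWAP_Y : ¬ HasWAP Y := fun ⟨C, hC⟩ =>
  not_forall_hasWAPWith_X C fun n hn => by
    obtain ⟨m, rfl⟩ := Nat.exists_eq_add_of_le' hn
    exact hC.of_retract (evalY m) (embY m) (evalY_embY_self m) (norm_evalY_le m)
      fun x => (norm_embY m x).le

/-- The coordinate functionals and the sums along the chains, on `Y`. -/
def basicFunctionalsY : Set (StrongDual ℝ Y) :=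
  ⋃ n, (fun φ : StrongDual ℝ JT => φ.comp ((X (n + 1)).subtypeL.comp (evalY n))) ''
    basicFunctionals

/-- The summands of Y form a decomposition with constant 1, and the dual of each X_n is already
known to be spanned. -/
lemma closure_span_basicFunctionalsY :
    (Submodule.span ℝ basicFunctionalsY).topologicalClosure = ⊤ := by
  refine eq_top_iff.2 fun ψ _ => ?_
  have hψ := mem_closure_span_comp_of_decomposition (fun n => (embY n).comp (evalY n)) (K := 1)
    zero_le_one
    (fun n y => by simp only [ContinuousLinearMap.comp_apply, evalY_embY_self])
    (fun s y => by
      simp only [ContinuousLinearMap.comp_apply, norm_embY, one_mul]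
      have := lp.norm_sum_single (E := fun n : ℕ => X (n + 1)) (p := 2) (by norm_num)
        (fun n => evalY n (y n)) s
      simp only [ENNReal.toReal_ofNat, Real.rpow_ofNat] at this
      exact this.le)
    (fun s y => by
      simp only [ContinuousLinearMap.comp_apply, norm_embY]
      exact sum_norm_evalY_sq_le y s)
    (fun y => lp.hasSum_single (by norm_num) y) ψ
  refine Submodule.topologicalClosure_minimal _ (Submodule.span_le.2 ?_)
    (Submodule.isClosed_topologicalClosure _) hψ
  rintro _ ⟨n, rfl⟩
  have h1 : ψ.comp (embY n) ∈ (Submodule.span ℝ (basicFunctionalsX (n + 1))).topologicalClosure := by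
    rw [closure_span_basicFunctionalsX]
    exact Submodule.mem_top
  have h2 := comp_mem_closure_span (evalY n) h1
  refine closure_mono (Submodule.span_mono ?_) h2
  rintro _ ⟨_, ⟨φ, hφ, rfl⟩, rfl⟩
  exact Set.mem_iUnion.2 ⟨n, φ, hφ, rfl⟩

/-- The coordinate functional at the node `α` of the `n`-th summand. -/
noncomputable def coordY (n : ℕ) (α : Node) : StrongDual ℝ Y :=
  (JT.coord α).comp ((X (n + 1)).subtypeL.comp (evalY n))

/-- The sum along the chain of left turns from `β` in the `n`-th summand. -/
noncomputable def chainSumY (n : ℕ) (β : Node) : StrongDual ℝ Y :=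
  (JT.chainSum β).comp ((X (n + 1)).subtypeL.comp (evalY n))

lemma coordY_apply (n : ℕ) (α : Node) (y : Y) : coordY n α y = (evalY n y).1.toFun α := rfl

lemma chainSumY_apply (n : ℕ) (β : Node) (y : Y) :
    chainSumY n β y = JT.chainSum β (evalY n y).1 := rfl

lemma mem_basicFunctionalsY {ψ : StrongDual ℝ Y} (h : ψ ∈ basicFunctionalsY) :
    (∃ n α, ψ = coordY n α) ∨ ∃ n β, start β = β ∧ ψ = chainSumY n β := by
  obtain ⟨n, _, ⟨α, rfl⟩ | ⟨β, hβ, rfl⟩, rfl⟩ := Set.mem_iUnion.1 h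
  · exact Or.inl ⟨n, α, rfl⟩
  · exact Or.inr ⟨n, β, hβ, rfl⟩

lemma coordY_eq_zero {n : ℕ} {α : Node} (h : n + 1 < rightTurns α) : coordY n α = 0 :=
  ContinuousLinearMap.ext fun y => toFun_eq_zero_of_mem (evalY n y).2 h

lemma chainSumY_eq_zero {n : ℕ} {β : Node} (h : n + 1 < rightTurns β) : chainSumY n β = 0 :=
  ContinuousLinearMap.ext fun y => by
    rw [chainSumY_apply, JT.chainSum_congr (y := 0) fun i => ?_, map_zero]
    · rfl
    · exact toFun_eq_zero_of_mem (evalY n y).2 (by simpa using h)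

lemma chainSumY_leftExt (n : ℕ) (β : Node) (k : ℕ) :
    chainSumY n (leftExt β k) = chainSumY n β - ∑ i ∈ Finset.range k, coordY n (leftExt β i) :=
  ContinuousLinearMap.ext fun y => by
    simp [chainSumY_apply, JT.chainSum_leftExt, coordY_apply]

/-- An enumeration of the chains of the summands of `Y`. -/
structure IsChainEnumeration (q : ℕ → ℕ × Node) : Prop where
  injective : Function.Injective q
  start_eq : ∀ i, start (q i).2 = (q i).2
  rightTurns_le : ∀ i, rightTurns (q i).2 ≤ (q i).1 + 1
  surjective : ∀ n β, start β = β → rightTurns β ≤ n + 1 → ∃ i, q i = (n, β)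

lemma exists_isChainEnumeration : ∃ q, IsChainEnumeration q := by
  let Γ := {p : ℕ × Node // start p.2 = p.2 ∧ rightTurns p.2 ≤ p.1 + 1}
  -- The root chains of the different summands are infinitely many, so the chains can be indexed
  -- bijectively by ℕ.
  have : Infinite Γ := Infinite.of_injective
    (fun n : ℕ => (⟨(n, []), rfl, by simp [rightTurns]⟩ : Γ)) fun m n h =>
      congrArg (fun p : Γ => p.1.1) h
  obtain ⟨e⟩ := nonempty_equiv_of_countable (α := ℕ) (β := Γ)
  exact ⟨fun i => (e i).1, fun i j h => e.injective (Subtype.ext h), fun i => (e i).2.1,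
    fun i => (e i).2.2, fun n β h1 h2 => ⟨e.symm ⟨(n, β), h1, h2⟩, by simp⟩⟩


end JamesTree
open Filter Topology

/-! ### Weak-star limits and copies of ℓ² in a bidual -/

section LimitFunctional

variable {E : Type*} [NormedAddCommGroup E] [NormedSpace ℝ E]

lemma exists_tendsto_of_total {B : Set (StrongDual ℝ E)}
    (hB : (Submodule.span ℝ B).topologicalClosure = ⊤) {v : ℕ → E} (hv : ∀ k, ‖v k‖ ≤ 1)
    (h : ∀ φ ∈ B, ∃ l, Tendsto (fun k => φ (v k)) atTop (𝓝 l)) (ψ : StrongDual ℝ E) :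
    ∃ l, Tendsto (fun k => ψ (v k)) atTop (𝓝 l) := by
  have hspan : ∀ φ ∈ Submodule.span ℝ B, ∃ l, Tendsto (fun k => φ (v k)) atTop (𝓝 l) := by
    intro φ hφ
    induction hφ using Submodule.span_induction with
    | mem φ hφ => exact h φ hφ
    | zero => exact ⟨0, tendsto_const_nhds⟩
    | add φ ψ _ _ h1 h2 => exact ⟨_, h1.choose_spec.add h2.choose_spec⟩
    | smul a φ _ h => exact ⟨_, h.choose_spec.const_mul a⟩
  have hψ : ψ ∈ (Submodule.span ℝ B).topologicalClosure := hB ▸ Submodule.mem_top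
  refine cauchySeq_tendsto_of_complete (Metric.cauchySeq_iff'.2 fun ε hε => ?_)
  obtain ⟨φ, hφ, hd⟩ := Metric.mem_closure_iff.1 hψ (ε / 3) (by positivity)
  obtain ⟨l, hl⟩ := hspan φ hφ
  obtain ⟨N, hN⟩ := Metric.cauchySeq_iff'.1 hl.cauchySeq (ε / 3) (by positivity)
  have hclose : ∀ k, |ψ (v k) - φ (v k)| < ε / 3 := fun k => by
    rw [dist_eq_norm] at hd
    refine lt_of_le_of_lt ?_ hd
    exact ((ψ - φ).le_opNorm (v k)).trans (mul_le_of_le_one_right (norm_nonneg _) (hv k))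
  refine ⟨N, fun k hk => ?_⟩
  have h1 := hN k hk
  have h2 := hclose k
  have h3 := hclose N
  rw [Real.dist_eq] at h1 ⊢
  rw [abs_lt] at *
  constructor <;> linarith

/-- The weak-star limit in the bidual of a bounded sequence on which all functionals converge. -/
noncomputable def limitFunctional (v : ℕ → E) (hv : ∀ k, ‖v k‖ ≤ 1)
    (h : ∀ ψ : StrongDual ℝ E, ∃ l, Tendsto (fun k => ψ (v k)) atTop (𝓝 l)) :
    StrongDual ℝ (StrongDual ℝ E) :=
  LinearMap.mkContinuous
    (linearMapOfTendsto (fun ψ => (h ψ).choose)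
      (fun k => (NormedSpace.inclusionInDoubleDual ℝ E (v k)).toLinearMap)
      (tendsto_pi_nhds.2 fun ψ => (h ψ).choose_spec)) 1 fun ψ => by
    rw [one_mul]
    exact le_of_tendsto (h ψ).choose_spec.norm (Eventually.of_forall fun k =>
      (ψ.le_opNorm _).trans (mul_le_of_le_one_right (norm_nonneg _) (hv k)))

lemma tendsto_limitFunctional (v : ℕ → E) (hv : ∀ k, ‖v k‖ ≤ 1)
    (h : ∀ ψ : StrongDual ℝ E, ∃ l, Tendsto (fun k => ψ (v k)) atTop (𝓝 l))
    (ψ : StrongDual ℝ E) :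
    Tendsto (fun k => ψ (v k)) atTop (𝓝 (limitFunctional v hv h ψ)) :=
  (h ψ).choose_spec

/-- Bidual functionals that agree on a total set are equal. -/
lemma bidual_ext_of_total {B : Set (StrongDual ℝ E)}
    (hB : (Submodule.span ℝ B).topologicalClosure = ⊤) {Φ Ψ : StrongDual ℝ (StrongDual ℝ E)}
    (h : ∀ φ ∈ B, Φ φ = Ψ φ) : Φ = Ψ := by
  have hle : (Submodule.span ℝ B).topologicalClosure ≤ LinearMap.ker (Φ - Ψ).toLinearMap := by
    refine Submodule.topologicalClosure_minimal _ (Submodule.span_le.2 fun φ hφ => ?_)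
      (Φ - Ψ).isClosed_ker
    simp [h φ hφ]
  ext ψ
  have : ψ ∈ LinearMap.ker (Φ - Ψ).toLinearMap := hle (hB ▸ Submodule.mem_top)
  simpa [sub_eq_zero] using this

/-- Square-summable families in the bidual give a bounded operator from the dual to `ℓ²`. -/
noncomputable def toEllTwo (e : ℕ → StrongDual ℝ (StrongDual ℝ E))
    (he : ∀ (s : Finset ℕ) ψ, ∑ i ∈ s, e i ψ ^ 2 ≤ ‖ψ‖ ^ 2) :
    StrongDual ℝ E →L[ℝ] lp (fun _ : ℕ => ℝ) 2 :=
  LinearMap.mkContinuous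
    { toFun := fun ψ => ⟨fun i => e i ψ, memℓp_two_of_sum_le (M := ‖ψ‖ ^ 2) fun s => by
        simpa using he s ψ⟩
      map_add' := fun φ ψ => lp.ext (funext fun i => map_add (e i) φ ψ)
      map_smul' := fun c ψ => lp.ext (funext fun i => map_smul (e i) c ψ) } 1 fun ψ => by
    rw [one_mul, ← sq_le_sq₀ (norm_nonneg _) (norm_nonneg _)]
    exact lp.norm_sq_le_of_sum_le fun s => by simpa using he s ψ

lemma toEllTwo_apply (e : ℕ → StrongDual ℝ (StrongDual ℝ E))
    (he : ∀ (s : Finset ℕ) ψ, ∑ i ∈ s, e i ψ ^ 2 ≤ ‖ψ‖ ^ 2) (ψ : StrongDual ℝ E) (i : ℕ) :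
    toEllTwo e he ψ i = e i ψ := rfl

lemma norm_toEllTwo_le (e : ℕ → StrongDual ℝ (StrongDual ℝ E))
    (he : ∀ (s : Finset ℕ) ψ, ∑ i ∈ s, e i ψ ^ 2 ≤ ‖ψ‖ ^ 2) : ‖toEllTwo e he‖ ≤ 1 :=
  LinearMap.mkContinuous_norm_le _ zero_le_one _

/-- The transpose of `toEllTwo`, from `ℓ²` to the bidual. -/
noncomputable def ofEllTwo (e : ℕ → StrongDual ℝ (StrongDual ℝ E))
    (he : ∀ (s : Finset ℕ) ψ, ∑ i ∈ s, e i ψ ^ 2 ≤ ‖ψ‖ ^ 2) :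
    lp (fun _ : ℕ => ℝ) 2 →ₗ[ℝ] StrongDual ℝ (StrongDual ℝ E) where
  toFun a := (innerSL ℝ a).comp (toEllTwo e he)
  map_add' a b := by
    ext ψ
    simp
  map_smul' c a := by
    ext ψ
    simp

lemma ofEllTwo_apply (e : ℕ → StrongDual ℝ (StrongDual ℝ E))
    (he : ∀ (s : Finset ℕ) ψ, ∑ i ∈ s, e i ψ ^ 2 ≤ ‖ψ‖ ^ 2) (a : lp (fun _ : ℕ => ℝ) 2)
    (ψ : StrongDual ℝ E) : HasSum (fun i => a i * e i ψ) (ofEllTwo e he a ψ) := by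
  have h := lp.hasSum_inner (𝕜 := ℝ) a (toEllTwo e he ψ)
  have h' : (fun i => inner ℝ (a i) (toEllTwo e he ψ i)) = fun i => a i * e i ψ :=
    funext fun i => by rw [toEllTwo_apply, RCLike.inner_apply, conj_trivial, mul_comm]
  rwa [h'] at h

lemma norm_ofEllTwo_le (e : ℕ → StrongDual ℝ (StrongDual ℝ E))
    (he : ∀ (s : Finset ℕ) ψ, ∑ i ∈ s, e i ψ ^ 2 ≤ ‖ψ‖ ^ 2) (a : lp (fun _ : ℕ => ℝ) 2) :
    ‖ofEllTwo e he a‖ ≤ ‖a‖ := by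
  refine (ContinuousLinearMap.opNorm_comp_le _ _).trans ?_
  rw [innerSL_apply_norm]
  exact mul_le_of_le_one_right (norm_nonneg _) (norm_toEllTwo_le e he)

/-- If `ℓ²` maps into the bidual isometrically modulo `E` and onto a complement of `E`, then it is
isometric to the quotient of the bidual by `E`. -/
lemma nonempty_bidualQuotient_equiv (T : lp (fun _ : ℕ => ℝ) 2 →ₗ[ℝ] StrongDual ℝ (StrongDual ℝ E))
    (hT : ∀ a, ‖T a‖ ≤ ‖a‖)
    (hT' : ∀ a y, ‖a‖ ≤ ‖T a + NormedSpace.inclusionInDoubleDual ℝ E y‖)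
    (hsurj : ∀ Φ, ∃ y a, Φ = NormedSpace.inclusionInDoubleDual ℝ E y + T a) :
    Nonempty (BidualQuotient E ≃ₗᵢ[ℝ] lp (fun _ : ℕ => ℝ) 2) := by
  set J := LinearMap.range (NormedSpace.inclusionInDoubleDual ℝ E).toLinearMap
  let Q : lp (fun _ : ℕ => ℝ) 2 →ₗᵢ[ℝ] BidualQuotient E :=
    { toLinearMap := J.mkQ.comp T
      norm_map' := fun a => by
        refine le_antisymm ((Submodule.Quotient.norm_mk_le J _).trans (hT a)) ?_
        refine le_of_forall_pos_le_add fun ε hε => ?_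
        obtain ⟨m, hm, hm'⟩ := Submodule.Quotient.norm_mk_lt (S := J) (J.mkQ (T a)) hε
        obtain ⟨y, hy⟩ := (Submodule.Quotient.eq J).1 hm
        have hy' : m = T a + NormedSpace.inclusionInDoubleDual ℝ E y :=
          (sub_eq_iff_eq_add'.1 hy.symm)
        rw [hy'] at hm'
        exact (hT' a y).trans hm'.le }
  refine ⟨(LinearIsometryEquiv.ofSurjective Q fun z => ?_).symm⟩
  obtain ⟨Φ, rfl⟩ := J.mkQ_surjective z
  obtain ⟨y, a, rfl⟩ := hsurj Φ
  refine ⟨a, ?_⟩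
  change J.mkQ (T a) = J.mkQ (_ + T a)
  rw [map_add, right_eq_add, Submodule.mkQ_apply, Submodule.Quotient.mk_eq_zero]
  exact ⟨y, rfl⟩

end LimitFunctional

namespace JamesTree

/-! ### The bidual of `Y` -/

/-- The node vector at `β0ᵏ` in the `n`-th summand of `Y`. -/
noncomputable def nodeY (n : ℕ) (β : Node) (k : ℕ) : Y := embY n (nodeVecX (n + 1) (leftExt β k))

lemma norm_nodeY_le (n : ℕ) (β : Node) (k : ℕ) : ‖nodeY n β k‖ ≤ 1 :=
  (norm_embY n _).trans_le (norm_nodeVecX_le _ _)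

lemma evalY_nodeY {m : ℕ} {β : Node} (hβ : rightTurns β ≤ m + 1) (n k : ℕ) :
    (evalY n (nodeY m β k) : JT) = if n = m then nodeVec (leftExt β k) else 0 := by
  rw [nodeY, evalY_embY, coe_nodeVecX (by simpa using hβ)]

lemma tendsto_coordY_nodeY {m : ℕ} {β : Node} (hβ : rightTurns β ≤ m + 1) (n : ℕ) (α : Node) :
    Tendsto (fun k => coordY n α (nodeY m β k)) atTop (𝓝 0) := by
  refine tendsto_const_nhds.congr' ?_
  filter_upwards [eventually_gt_atTop α.length] with k hk
  rw [coordY_apply, evalY_nodeY hβ]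
  split_ifs
  · have : α ≠ leftExt β k := by
      rintro rfl
      simp at hk
    simp [this]
  · rfl

lemma chainSumY_nodeY {m : ℕ} {β : Node} (hβ : rightTurns β ≤ m + 1) (hβ' : start β = β) (n : ℕ)
    {β' : Node} (h : start β' = β') (k : ℕ) :
    chainSumY n β' (nodeY m β k) = if (n, β') = (m, β) then 1 else 0 := by
  rw [chainSumY_apply, evalY_nodeY hβ]
  by_cases h1 : n = m
  · subst h1
    simp [chainSum_nodeVec h hβ']
  · simp [h1]

lemma exists_tendsto_nodeY {m : ℕ} {β : Node} (hβ : rightTurns β ≤ m + 1) (hβ' : start β = β)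
    (ψ : StrongDual ℝ Y) : ∃ l, Tendsto (fun k => ψ (nodeY m β k)) atTop (𝓝 l) := by
  refine exists_tendsto_of_total closure_span_basicFunctionalsY (norm_nodeY_le m β)
    (fun φ hφ => ?_) ψ
  rcases mem_basicFunctionalsY hφ with ⟨n, α, rfl⟩ | ⟨n, β', h, rfl⟩
  · exact ⟨0, tendsto_coordY_nodeY hβ n α⟩
  · simp only [chainSumY_nodeY hβ hβ' n h]
    exact ⟨_, tendsto_const_nhds⟩

lemma abs_chainSum_leftExt_le {β : Node} (hβ : start β = β) (k : ℕ) (x : JT) :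
    |JT.chainSum (leftExt β k) x| ≤ ‖JT.restr (chain β) (orderConvex_chain β) x‖ := by
  rw [JT.chainSum_congr (y := JT.restr (chain β) (orderConvex_chain β) x) fun i => ?_]
  · exact JT.abs_chainSum_le _ _
  · rw [leftExt_leftExt, JT.toFun_restr, Set.indicator_of_mem (JT.mem_chain_leftExt hβ _)]

namespace IsChainEnumeration

variable {q : ℕ → ℕ × Node}

/-- Each tail sum is bounded by the part of y on its own chain, and chains are disjoint. The bound
is uniform in k: k = 0 makes the masses square-summable, k → ∞ gives the lower bound modulo Y. -/
lemma sum_sq_chainSumY_le (hq : IsChainEnumeration q) (s : Finset ℕ) (k : ℕ) (y : Y) :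
    ∑ i ∈ s, chainSumY (q i).1 (leftExt (q i).2 k) y ^ 2 ≤ ‖y‖ ^ 2 := by
  classical
  let h : ℕ × Node → ℝ := fun p =>
    ‖JT.restr (chain p.2) (orderConvex_chain p.2) (evalY p.1 y)‖ ^ 2
  calc ∑ i ∈ s, chainSumY (q i).1 (leftExt (q i).2 k) y ^ 2 ≤ ∑ i ∈ s, h (q i) := by
        refine Finset.sum_le_sum fun i _ => ?_
        rw [chainSumY_apply, ← sq_abs]
        exact pow_le_pow_left₀ (abs_nonneg _) (abs_chainSum_leftExt_le (hq.start_eq i) k _) 2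
    _ = ∑ p ∈ s.image q, h p := (Finset.sum_image fun _ _ _ _ h => hq.injective h).symm
    -- Enlarging to a product allows summing over chains first, then over summands.
    _ ≤ ∑ p ∈ (s.image q).image Prod.fst ×ˢ (s.image q).image Prod.snd, h p :=
        Finset.sum_le_sum_of_subset_of_nonneg Finset.subset_product fun _ _ _ => sq_nonneg _
    _ = ∑ n ∈ (s.image q).image Prod.fst, ∑ β ∈ (s.image q).image Prod.snd, h (n, β) :=
        Finset.sum_product _ _ _
    _ ≤ ∑ n ∈ (s.image q).image Prod.fst, ‖evalY n y‖ ^ 2 :=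
        Finset.sum_le_sum fun n _ =>
          sum_norm_restr_chain_sq_le (evalY n y : JT) ((s.image q).image Prod.snd)
    _ ≤ ‖y‖ ^ 2 := sum_norm_evalY_sq_le y _

/-- So far out, nodes of different chains of one summand are incomparable, so a segment contains at
most one of them. The resulting constant 1, instead of n + 1, is what makes the quotient isometric
to ℓ². -/
lemma norm_sum_smul_nodeY_sq_le (hq : IsChainEnumeration q) (s : Finset ℕ) {k : ℕ}
    (hk : ∀ i ∈ s, (q i).2.length ≤ k) (c : ℕ → ℝ) :
    ‖∑ i ∈ s, c i • nodeY (q i).1 (q i).2 k‖ ^ 2 ≤ ∑ i ∈ s, c i ^ 2 := by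
  classical
  have hn : ∀ n, ‖evalY n (∑ i ∈ s, c i • nodeY (q i).1 (q i).2 k)‖ ^ 2 ≤
      ∑ i ∈ s with (q i).1 = n, c i ^ 2 := by
    intro n
    have heval : (evalY n (∑ i ∈ s, c i • nodeY (q i).1 (q i).2 k) : JT) =
        ∑ i ∈ s with (q i).1 = n, c i • nodeVec (leftExt (q i).2 k) := by
      rw [map_sum, Submodule.coe_sum, Finset.sum_filter]
      refine Finset.sum_congr rfl fun i _ => ?_
      rw [map_smul, Submodule.coe_smul, evalY_nodeY (hq.rightTurns_le i)]
      by_cases h : (q i).1 = n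
      · rw [if_pos h, if_pos h.symm]
      · rw [if_neg h, if_neg fun h' => h h'.symm, smul_zero]
    have hmain := norm_sum_sq_le (K := 1) (s.filter fun i => (q i).1 = n)
      (fun i => c i • nodeVec (leftExt (q i).2 k)) fun S hS => by
        refine ⟨(s.filter fun i => (q i).1 = n).filter fun i => leftExt (q i).2 k ∈ S,
          Finset.filter_subset _ _, Finset.card_le_one.2 fun i hi j hj => ?_, fun i hi hi' => ?_⟩
        · simp only [Finset.mem_filter] at hi hj
          by_contra hne
          have hne' : (q i).2 ≠ (q j).2 := fun h => hne (hq.injective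
            (Prod.ext (hi.1.2.trans hj.1.2.symm) h))
          rcases hS.isPiece.1 _ hi.2 _ hj.2 with h | h
          · exact not_leftExt_prefix (hq.start_eq i) (hq.start_eq j) hne' (hk j hj.1.1) h
          · exact not_leftExt_prefix (hq.start_eq j) (hq.start_eq i) hne'.symm (hk i hi.1.1) h
        · have : leftExt (q i).2 k ∉ S := fun h => hi' (Finset.mem_filter.2 ⟨hi, h⟩)
          rw [map_smul, sum_single_eq, if_neg this, smul_zero]
    change ‖(evalY n (∑ i ∈ s, c i • nodeY (q i).1 (q i).2 k) : JT)‖ ^ 2 ≤ _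
    rw [heval]
    refine hmain.trans ?_
    rw [Nat.cast_one, one_mul]
    refine Finset.sum_le_sum fun i _ => ?_
    rw [norm_smul, mul_pow, Real.norm_eq_abs, sq_abs]
    exact mul_le_of_le_one_right (sq_nonneg _) (pow_le_one₀ (norm_nonneg _) (norm_nodeVec_le _))
  refine lp.norm_sq_le_of_sum_le fun N => (Finset.sum_le_sum fun n _ => hn n).trans ?_
  simp only [Finset.sum_filter]
  rw [Finset.sum_comm]
  refine Finset.sum_le_sum fun i _ => ?_
  rw [Finset.sum_ite_eq]
  split_ifs
  · exact le_rfl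
  · exact sq_nonneg _

/-- The weak-star limits of the node vectors along the chains. -/
noncomputable def chainEnd (hq : IsChainEnumeration q) (i : ℕ) :
    StrongDual ℝ (StrongDual ℝ Y) :=
  limitFunctional (nodeY (q i).1 (q i).2) (norm_nodeY_le _ _)
    (exists_tendsto_nodeY (hq.rightTurns_le i) (hq.start_eq i))

lemma tendsto_chainEnd (hq : IsChainEnumeration q) (i : ℕ) (ψ : StrongDual ℝ Y) :
    Tendsto (fun k => ψ (nodeY (q i).1 (q i).2 k)) atTop (𝓝 (hq.chainEnd i ψ)) :=
  tendsto_limitFunctional _ _ _ ψ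

/-- For finitely many chains the far out upper estimate eventually applies; it is dualized and
passed to the limit. -/
lemma sum_sq_chainEnd_le (hq : IsChainEnumeration q) (s : Finset ℕ) (ψ : StrongDual ℝ Y) :
    ∑ i ∈ s, hq.chainEnd i ψ ^ 2 ≤ ‖ψ‖ ^ 2 := by
  refine le_of_tendsto (tendsto_finsetSum _ fun i _ => (hq.tendsto_chainEnd i ψ).pow 2) ?_
  filter_upwards [eventually_ge_atTop (s.sup fun i => (q i).2.length)] with k hk
  simpa using sum_sq_apply_le zero_le_one ψ s (fun i => nodeY (q i).1 (q i).2 k) fun c => by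
    rw [one_mul]
    exact hq.norm_sum_smul_nodeY_sq_le s
      (fun i hi => (Finset.le_sup (f := fun i => (q i).2.length) hi).trans hk) c

lemma chainEnd_coordY (hq : IsChainEnumeration q) (i n : ℕ) (α : Node) :
    hq.chainEnd i (coordY n α) = 0 :=
  tendsto_nhds_unique (hq.tendsto_chainEnd i _) (tendsto_coordY_nodeY (hq.rightTurns_le i) n α)

lemma chainEnd_chainSumY (hq : IsChainEnumeration q) (i j : ℕ) :
    hq.chainEnd i (chainSumY (q j).1 (q j).2) = if i = j then 1 else 0 := by
  refine tendsto_nhds_unique (hq.tendsto_chainEnd i _) ?_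
  simp only [chainSumY_nodeY (hq.rightTurns_le i) (hq.start_eq i) _ (hq.start_eq j)]
  have : (q j = q i) ↔ i = j := hq.injective.eq_iff.trans eq_comm
  simp only [Prod.mk.eta, this]
  exact tendsto_const_nhds

/-- The element of the bidual with the given masses at the ends of the chains. -/
noncomputable def ofMasses (hq : IsChainEnumeration q) :
    lp (fun _ : ℕ => ℝ) 2 →ₗ[ℝ] StrongDual ℝ (StrongDual ℝ Y) :=
  ofEllTwo hq.chainEnd hq.sum_sq_chainEnd_le

lemma ofMasses_coordY (hq : IsChainEnumeration q) (a : lp (fun _ : ℕ => ℝ) 2) (n : ℕ) (α : Node) :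
    hq.ofMasses a (coordY n α) = 0 := by
  refine (ofEllTwo_apply hq.chainEnd hq.sum_sq_chainEnd_le a (coordY n α)).unique ?_
  simp only [hq.chainEnd_coordY, mul_zero]
  exact hasSum_zero

lemma ofMasses_chainSumY (hq : IsChainEnumeration q) (a : lp (fun _ : ℕ => ℝ) 2) (j : ℕ) :
    hq.ofMasses a (chainSumY (q j).1 (q j).2) = a j := by
  refine (ofEllTwo_apply hq.chainEnd hq.sum_sq_chainEnd_le a _).unique ?_
  have := hasSum_single (f := fun i => a i * hq.chainEnd i (chainSumY (q j).1 (q j).2)) j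
    fun i hi => by rw [hq.chainEnd_chainSumY, if_neg hi, mul_zero]
  simpa only [hq.chainEnd_chainSumY, if_true, mul_one] using this

/-- Tails of the chain sums do not change the masses, since these vanish on coordinates, but they
kill y in the limit. -/
lemma norm_le_norm_ofMasses_add (hq : IsChainEnumeration q) (a : lp (fun _ : ℕ => ℝ) 2) (y : Y) :
    ‖a‖ ≤ ‖hq.ofMasses a + NormedSpace.inclusionInDoubleDual ℝ Y y‖ := by
  rw [← sq_le_sq₀ (norm_nonneg _) (norm_nonneg _)]
  refine lp.norm_sq_le_of_sum_le fun s => ?_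
  have hval : ∀ i k, (hq.ofMasses a + NormedSpace.inclusionInDoubleDual ℝ Y y)
      (chainSumY (q i).1 (leftExt (q i).2 k)) =
        a i + JT.chainSum (leftExt (q i).2 k) (evalY (q i).1 y).1 := by
    intro i k
    have h1 : hq.ofMasses a (chainSumY (q i).1 (leftExt (q i).2 k)) = a i := by
      rw [chainSumY_leftExt, map_sub, map_sum, hq.ofMasses_chainSumY]
      simp [hq.ofMasses_coordY]
    rw [add_apply, h1]
    rfl
  have hlim : Tendsto (fun k => ∑ i ∈ s, (hq.ofMasses a + NormedSpace.inclusionInDoubleDual ℝ Y y)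
      (chainSumY (q i).1 (leftExt (q i).2 k)) ^ 2) atTop (𝓝 (∑ i ∈ s, ‖a i‖ ^ 2)) := by
    refine tendsto_finsetSum _ fun i _ => ?_
    simp only [hval, Real.norm_eq_abs, sq_abs]
    have h2 := (tendsto_const_nhds (x := a i)).add
      (JT.tendsto_chainSum_leftExt (q i).2 (evalY (q i).1 y).1)
    rw [add_zero] at h2
    exact h2.pow 2
  exact le_of_tendsto hlim (Eventually.of_forall fun k =>
    sum_sq_bidual_apply_le _ s _ fun z => hq.sum_sq_chainSumY_le s k z)

end IsChainEnumeration

lemma sum_sq_bidual_coordY_le (Φ : StrongDual ℝ (StrongDual ℝ Y)) (N : Finset ℕ)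
    {F : ℕ → Finset (Finset Node)} (hF : ∀ n, IsDisjointFamily (F n)) :
    ∑ n ∈ N, ∑ S ∈ F n, (∑ γ ∈ S, Φ (coordY n γ)) ^ 2 ≤ ‖Φ‖ ^ 2 := by
  have h := sum_sq_bidual_apply_le Φ (N.sigma F)
    (fun p : Σ _ : ℕ, Finset Node => ∑ γ ∈ p.2, coordY p.1 γ) fun y => by
      rw [Finset.sum_sigma]
      refine (Finset.sum_le_sum fun n _ => ?_).trans (sum_norm_evalY_sq_le y N)
      simpa [coordY_apply] using JT.sum_family_le (evalY n y : JT) (hF n)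
  rw [Finset.sum_sigma] at h
  simpa only [map_sum] using h

/-- Bounded completeness: the values of Φ on coordinates satisfy the finite inequalities defining
the norms, because the segment sums on Y satisfy a lower 2-estimate, and those inequalities are all
that membership in Y requires. -/
lemma exists_forall_coordY_eq (Φ : StrongDual ℝ (StrongDual ℝ Y)) :
    ∃ y : Y, ∀ n α, coordY n α y = Φ (coordY n α) := by
  let z : ∀ n, X (n + 1) := fun n => ⟨JT.mk (fun α => Φ (coordY n α)) (‖Φ‖ ^ 2) fun F hF => by
    simpa using sum_sq_bidual_coordY_le Φ {n} fun _ => hF, mem_X fun α hα => by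
      rw [JT.toFun_mk, coordY_eq_zero hα, map_zero]⟩
  have hz : ∀ N : Finset ℕ, ∑ n ∈ N, ‖z n‖ ^ 2 ≤ ‖Φ‖ ^ 2 := by
    intro N
    refine le_of_forall_pos_le_add fun ε hε => ?_
    have hδ : 0 < ε / (N.card + 1) := by positivity
    choose F hF hFz using fun n => JT.exists_family (x := (z n : JT)) hδ
    have h1 := sum_sq_bidual_coordY_le Φ N hF
    have h2 : ∑ n ∈ N, ‖z n‖ ^ 2 ≤
        ∑ n ∈ N, (∑ S ∈ F n, (∑ γ ∈ S, Φ (coordY n γ)) ^ 2 + ε / (N.card + 1)) := by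
      refine Finset.sum_le_sum fun n _ => ?_
      have h3 : ‖z n‖ ^ 2 - ε / (N.card + 1) < ∑ S ∈ F n, (∑ γ ∈ S, Φ (coordY n γ)) ^ 2 := hFz n
      linarith
    rw [Finset.sum_add_distrib, Finset.sum_const, nsmul_eq_mul] at h2
    have h3 : (N.card : ℝ) * (ε / (N.card + 1)) ≤ ε := by
      rw [mul_div_assoc', div_le_iff₀ (by positivity)]
      nlinarith
    linarith
  exact ⟨⟨z, memℓp_two_of_sum_le hz⟩, fun n α => rfl⟩

/-- After removing the element of Y with the same coordinates, only the values on chain sums are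
left; by totality they determine the functional. -/
lemma IsChainEnumeration.exists_eq_add_ofMasses {q : ℕ → ℕ × Node} (hq : IsChainEnumeration q)
    (Φ : StrongDual ℝ (StrongDual ℝ Y)) :
    ∃ y a, Φ = NormedSpace.inclusionInDoubleDual ℝ Y y + hq.ofMasses a := by
  obtain ⟨y, hy⟩ := exists_forall_coordY_eq Φ
  set Ψ := Φ - NormedSpace.inclusionInDoubleDual ℝ Y y with hΨ
  let a : lp (fun _ : ℕ => ℝ) 2 := ⟨fun i => Ψ (chainSumY (q i).1 (q i).2),
    memℓp_two_of_sum_le (M := ‖Ψ‖ ^ 2) fun s => by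
      simpa using sum_sq_bidual_apply_le Ψ s (fun i => chainSumY (q i).1 (q i).2) fun z => by
        simpa using hq.sum_sq_chainSumY_le s 0 z⟩
  refine ⟨y, a, ?_⟩
  rw [← sub_eq_iff_eq_add', ← hΨ]
  refine bidual_ext_of_total closure_span_basicFunctionalsY fun φ hφ => ?_
  rcases mem_basicFunctionalsY hφ with ⟨n, α, rfl⟩ | ⟨n, β, hβ, rfl⟩
  · rw [hq.ofMasses_coordY, hΨ, sub_apply, ← hy]
    exact sub_self _
  · by_cases hr : rightTurns β ≤ n + 1
    · obtain ⟨i, hi⟩ := hq.surjective n β hβ hr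
      have h1 := hq.ofMasses_chainSumY a i
      rw [hi] at h1
      rw [h1]
      change _ = Ψ (chainSumY (q i).1 (q i).2)
      rw [hi]
    · rw [chainSumY_eq_zero (not_le.1 hr), map_zero, map_zero]

theorem nonempty_bidualQuotient_Y :
    Nonempty (BidualQuotient Y ≃ₗᵢ[ℝ] lp (fun _ : ℕ => ℝ) 2) := by
  obtain ⟨q, hq⟩ := exists_isChainEnumeration
  exact nonempty_bidualQuotient_equiv hq.ofMasses (norm_ofEllTwo_le _ _)
    hq.norm_le_norm_ofMasses_add hq.exists_eq_add_ofMasses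

end JamesTree

theorem theorem6p5 :
    -- (i)
    (∀ n : ℕ, 1 ≤ n → HasWAPWith (JamesTree.X n) (3 * √(n : ℝ))) ∧
    -- (ii)
    (∃ C : ℝ, 0 < C ∧ ∀ n : ℕ, 1 ≤ n →
      ∃ D : Set (JamesTree.X n), IsWeaklyCompact D ∧
        ∀ V : JamesTree.X n →L[ℝ] JamesTree.X n, IsWeaklyCompactOperator V →
          ApproximatesIdOn V D (1 / 10) → C * √(n : ℝ) ≤ ‖V‖) ∧
    -- (iii)
    ¬ HasWAP JamesTree.JT ∧
    -- (iv)
    (Nonempty (BidualQuotient JamesTree.Y ≃ₗᵢ[ℝ] lp (fun _ : ℕ => ℝ) 2) ∧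
      ¬ HasWAP JamesTree.Y) :=
  ⟨fun _ hn => JamesTree.hasWAPWith_X hn,
    ⟨1 / 10, by norm_num, fun n _ => ⟨JamesTree.startSet n, JamesTree.isWeaklyCompact_startSet n,
      fun _ hV hVD => JamesTree.sqrt_le_norm_of_approximates hV hVD⟩⟩,
    JamesTree.not_hasWAP_JT, JamesTree.nonempty_bidualQuotient_Y, JamesTree.not_hasWAP_Y⟩
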